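/- **Definitions.** A *restriction category* is a category with an operation $f\mapsto\bar f$, assigning to $f\colon A\to B$ an endomorphism $\bar f\colon A\to A$, such that $f\bar f=f$, $\bar f\bar g=\bar g\bar f$, $\overline{g\bar f}=\bar g\bar f$ (for $f,g$ with the same domain) and $\bar g f=f\,\overline{gf}$ (for composable $f,g$); $f$ is *total* if $\bar f=\mathrm{id}_A$. Let $\mathbf{RCat}$ be the $2$-category of restriction categories, restriction functors ($F\bar f=\overline{Ff}$) and natural transformations with total components, and $\mathbf{sRCat}$ its full sub-$2$-category on the *split* restriction categories, in which every idempotent $e=\bar e$ splits. A *tangentad* in a $2$-category $\mathbf K$ is an object $\mathbb X$ with $1$-morphisms $\mathrm T,\mathrm T_n\colon\mathbb X\to\mathbb X$ and $2$-morphisms $p\colon\mathrm T\to\mathrm{id}$, $z\colon\mathrm{id}\to\mathrm T$, $s\colon\mathrm T_2\to\mathrm T$, $l\colon\mathrm T\to\mathrm T^2$, $c\colon\mathrm T^2\to\mathrm T^2$ satisfying the usual axioms of a tangent category, where $\mathrm T_n$ is the $n$-fold pullback of $p$ along itself, and these pullbacks and the pullback expressing the universality of $l$ are pointwise (preserved by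 precomposition with any $1$-morphism $\mathbb Y\to\mathbb X$), the former being also preserved by all iterates of $\mathrm T$. $\mathsf{Tng}(\mathbf K)$ denotes the $2$-category of tangentads, lax tangent $1$-morphisms $(F,\alpha\colon F\mathrm T\to\mathrm T'F)$ and tangent $2$-morphisms. For tangentads $\mathbb X',\mathbb X$, the category $\mathsf{VF}[\mathbb X'\,|\,\mathbb X]$ has as objects the pairs $(G,u)$ of a lax tangent $1$-morphism $G\colon\mathbb X'\to\mathbb X$ and a tangent $2$-morphism $u\colon G\to(\mathrm T,c)\circ G$ with $p_G\circ u=\mathrm{id}_G$, and as morphisms $(G,u)\to(G',u')$ the tangent $2$-morphisms $\varphi\colon G\to G'$ with $u'\circ\varphi=\mathrm T\varphi\circ u$. The tangentad $\mathbb X$ *admits the construction of vector fields* if there are a tangentad $\mathsf{VF}(\mathbb X)$, a strict tangent $1$-morphism $\mathsf U\colon\mathsf{VF}(\mathbb X)\to\mathbb X$ and a vector field $\mathsf v$ on $\mathsf U$ (that is, an object $(\mathsf U,\mathsf v)$ of $\mathsf{VF}[\mathsf{VF}(\mathbb X)\,|\,\mathbb X]$) such that for every tangentad $\mathbb X'$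 the functor $[\mathbb X',\mathsf{VF}(\mathbb X)]\to\mathsf{VF}[\mathbb X'\,|\,\mathbb X]$, $H\mapsto(\mathsf UH,\mathsf vH)$, is an isomorphism of categories; then $\mathsf{VF}(\mathbb X)$ is the tangentad of vector fields of $\mathbb X$, with universal vector field $\mathsf v$. A *tangent restriction category* $(\mathbb X,\mathbb T)$ is a restriction category with a restriction functor $\mathrm T$, restriction functors $\mathrm T_n$ and total natural transformations $p,z,s,l,c$ satisfying the tangent category axioms, where $\mathrm T_nM$ is the $n$-fold restriction pullback of $p_M$, preserved by all iterates of $\mathrm T$, and the square expressing the universality of $l$ is a restriction pullback. Tangent restriction categories, lax tangent restriction functors (whose distributive law is a total natural transformation) and tangent $2$-morphisms with total components form the $2$-category $\mathbf{TngRCat}$. The tangentads of $\mathbf{sRCat}$ are exactly the tangent restriction categories whose underlying restriction category is split; let $\mathsf{Inc}\colon\mathsf{Tng}(\mathbf{sRCat})\to\mathbf{TngRCat}$ be the inclusion, let $\mathsf{Split}_R\colon\mathbf{TngRCat}\to\mathsf{Tng}(\mathbf{sRCat})$ be the $2$-functor that formally splits the restriction idempotents, so that the objects of $\mathsf{Split}_R(\mathbb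 X,\mathbb T)$ are the pairs $(A,e)$ with $e=\bar e\colon A\to A$, and let $\eta\colon(\mathbb X,\mathbb T)\to\mathsf{Inc}(\mathsf{Split}_R(\mathbb X,\mathbb T))$, $A\mapsto(A,\mathrm{id}_A)$, be the $2$-natural embedding. These data form a *pullback-extension context*, i.e. two $2$-functors $\Xi\colon\mathbf J\leftrightarrows\mathsf{Tng}(\mathbf K)\colon\mathsf{Inc}$ and a $2$-natural transformation $\eta\colon\mathrm{id}_{\mathbf J}\to\mathsf{Inc}\circ\Xi$, here with $\mathbf K=\mathbf{sRCat}$, $\mathbf J=\mathbf{TngRCat}$ and $\Xi=\mathsf{Split}_R$. An object $\mathbb X$ of $\mathbf J$ *admits the extended construction of vector fields* if $\Xi(\mathbb X)$ admits the construction of vector fields in $\mathbf K$ and the (strict) $2$-pullback of $\mathsf{Inc}(\mathsf U)\colon\mathsf{Inc}(\mathsf{VF}(\Xi\mathbb X))\to\mathsf{Inc}(\Xi\mathbb X)$ along $\eta_{\mathbb X}$ exists in $\mathbf J$; this $2$-pullback is the *object of vector fields* of $\mathbb X$. For a tangent restriction category $(\mathbb X,\mathbb T)$ let $\mathsf{VF}(\mathbb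 X,\mathbb T)$ be the following tangent restriction category. Its objects are the pairs $(M,v)$ of an object $M$ of $\mathbb X$ and a total morphism $v\colon M\to\mathrm TM$ with $p_M\circ v=\mathrm{id}_M$; its morphisms $(M,v)\to(N,u)$ are the morphisms $f\colon M\to N$ of $\mathbb X$ with $u\circ f=\mathrm Tf\circ v$, with restriction idempotent $\bar f$; its tangent bundle functor is $(M,v)\mapsto(\mathrm TM,c_M\circ\mathrm Tv)$, $f\mapsto\mathrm Tf$, and its structural transformations are those of $\mathbb T$. Let $\mathsf U_{\mathbb X}\colon\mathsf{VF}(\mathbb X,\mathbb T)\to(\mathbb X,\mathbb T)$ be the strict tangent restriction functor that forgets $v$. **Theorem.** (Restriction categories are taken in universes in which $\mathsf{Split}_R$ does not change the universe of the collection of objects, e.g. locally small ones.) Every object of the $2$-category $\mathbf{TngRCat}$ of (not necessarily split) tangent restriction categories admits the extended construction of vector fields with respect to the pullback-extension context $(\mathbf{sRCat},\mathbf{TngRCat};\mathsf{Inc},\mathsf{Split}_R;\eta)$. Moreover, the object of vector fields of $(\mathbb X,\mathbb T)$ is $\mathsf{VF}(\mathbb X,\mathbb T)$, with projection $\mathsf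 U_{\mathbb X}$: for every tangentad $\mathsf{VF}(\mathsf{Split}_R(\mathbb X,\mathbb T))$ of vector fields of $\mathsf{Split}_R(\mathbb X,\mathbb T)$, with universal vector field $\mathsf v$ on $\mathsf U$, there is a $1$-morphism $k=\mathsf{VF}(\eta)\colon\mathsf{VF}(\mathbb X,\mathbb T)\to\mathsf{Inc}(\mathsf{VF}(\mathsf{Split}_R(\mathbb X,\mathbb T)))$ such that $$\begin{array}{ccc}\mathsf{VF}(\mathbb X,\mathbb T)&\xrightarrow{\;k\;}&\mathsf{Inc}(\mathsf{VF}(\mathsf{Split}_R(\mathbb X,\mathbb T)))\\ {\scriptstyle\mathsf U_{\mathbb X}}\downarrow&&\downarrow{\scriptstyle\mathsf{Inc}(\mathsf U)}\\ (\mathbb X,\mathbb T)&\xrightarrow{\;\eta\;}&\mathsf{Inc}(\mathsf{Split}_R(\mathbb X,\mathbb T))\end{array}$$ is a $2$-pullback in $\mathbf{TngRCat}$, and $k$ sends $(M,v)$ to $(M,v)$ in the sense that $\mathsf v_{k(M,v)}=v$ for every $(M,v)$. -/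

import Mathlib

open CategoryTheory Bicategory

universe w w' v u v' u'

namespace TangentVF

/-! ### Restriction categories -/

/-- A restriction structure on a category. -/
class RestrictionCategory (C : Type u) [Category.{v} C] where
  /-- The restriction idempotent of a morphism. -/
  rest : ∀ {X Y : C}, (X ⟶ Y) → (X ⟶ X)
  rest_comp_self : ∀ {X Y : C} (f : X ⟶ Y), rest f ≫ f = f
  rest_comm : ∀ {X Y Z : C} (f : X ⟶ Y) (g : X ⟶ Z), rest f ≫ rest g = rest g ≫ rest f
  rest_rest_comp : ∀ {X Y Z : C} (f : X ⟶ Y) (g : X ⟶ Z), rest (rest f ≫ g) = rest f ≫ rest g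
  comp_rest : ∀ {X Y Z : C} (f : X ⟶ Y) (g : Y ⟶ Z), f ≫ rest g = rest (f ≫ g) ≫ f

open RestrictionCategory

section Restriction

variable {C : Type u} [Category.{v} C] [RestrictionCategory C]

/-- A morphism is total when its restriction idempotent is the identity. -/
def IsTotal {X Y : C} (f : X ⟶ Y) : Prop := rest f = 𝟙 X

/-- The canonical order on parallel morphisms: `f` is a restriction of `g`. -/
def RLe {X Y : C} (f g : X ⟶ Y) : Prop := rest f ≫ g = f

theorem isTotal_id (X : C) : IsTotal (𝟙 X) := by
  have := rest_comp_self (𝟙 X); rwa [Category.comp_id] at this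

theorem rest_id (X : C) : rest (𝟙 X) = 𝟙 X := isTotal_id X

theorem rest_idem {X Y : C} (f : X ⟶ Y) : rest f ≫ rest f = rest f := by
  rw [← rest_rest_comp, rest_comp_self]

theorem rest_rest {X Y : C} (f : X ⟶ Y) : rest (rest f) = rest f := by
  have := rest_rest_comp f (𝟙 X)
  rwa [rest_id, Category.comp_id] at this

theorem rest_comp_le {X Y Z : C} (f : X ⟶ Y) (g : Y ⟶ Z) :
    rest f ≫ rest (f ≫ g) = rest (f ≫ g) := by
  rw [← rest_rest_comp, ← Category.assoc, rest_comp_self]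

theorem rest_comp_rest {X Y Z : C} (f : X ⟶ Y) (g : Y ⟶ Z) :
    rest (f ≫ rest g) = rest (f ≫ g) := by
  rw [comp_rest, rest_rest_comp, rest_comm, rest_comp_le]

theorem IsTotal.rest_comp {X Y Z : C} (f : X ⟶ Y) {g : Y ⟶ Z} (hg : IsTotal g) :
    rest (f ≫ g) = rest f := by
  rw [← rest_comp_rest, hg, Category.comp_id]

theorem IsTotal.comp {X Y Z : C} {f : X ⟶ Y} {g : Y ⟶ Z} (hf : IsTotal f) (hg : IsTotal g) :
    IsTotal (f ≫ g) := (hg.rest_comp f).trans hf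

theorem IsTotal.of_comp {X Y Z : C} {f : X ⟶ Y} {g : Y ⟶ Z} (h : IsTotal (f ≫ g)) :
    IsTotal f := by
  have := rest_comp_le f g
  rwa [h, Category.comp_id] at this

/-- The restriction limit of a wide cospan `q i : E i ⟶ B` of total maps: a commuting cone
`pr i : P ⟶ E i` of total maps, such that every lax cone `(x, y)` factors
through it by a unique map `h` such that `h ≫ pr i` is a restriction of `x i` and `rest h` is the
meet of the domains of definition of the `x i` (the largest restriction idempotent below all the
`rest (x i)`). -/
structure IsRestrictionWidePullback {ι : Type w} {B P : C} {E : ι → C} (q : ∀ i, E i ⟶ B)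
    (pr : ∀ i, P ⟶ E i) : Prop where
  total : ∀ i, IsTotal (pr i)
  comm : ∀ i j, pr i ≫ q i = pr j ≫ q j
  lift : ∀ (A : C) (x : ∀ i, A ⟶ E i) (y : A ⟶ B), (∀ i, RLe (x i ≫ q i) y) →
    ∃! h : A ⟶ P, (∀ i, RLe (h ≫ pr i) (x i)) ∧
      ∀ e : A ⟶ A, rest e = e → (∀ i, RLe e (rest (x i))) → RLe e (rest h)

end Restriction

/-- The limit of a wide cospan `q i : E i ⟶ B` (over a non-empty index type). -/
structure IsWidePullbackCone {C : Type u} [Category.{v} C] {ι : Type w} {B P : C} {E : ι → C}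
    (q : ∀ i, E i ⟶ B) (pr : ∀ i, P ⟶ E i) : Prop where
  comm : ∀ i j, pr i ≫ q i = pr j ≫ q j
  lift : ∀ (A : C) (x : ∀ i, A ⟶ E i), (∀ i j, x i ≫ q i = x j ≫ q j) →
    ∃! h : A ⟶ P, ∀ i, h ≫ pr i = x i

section Restriction

variable {C : Type u} [Category.{v} C] [RestrictionCategory C]

theorem exists_domain_meet {ι : Type w} {A : C} {E : ι → C} (x : ∀ i, A ⟶ E i) (s : Finset ι) :
    ∃ e : A ⟶ A, rest e = e ∧ (∀ i ∈ s, RLe e (rest (x i))) ∧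
      ∀ d : A ⟶ A, rest d = d → (∀ i ∈ s, RLe d (rest (x i))) → RLe d e := by
  classical
  induction s using Finset.induction_on with
  | empty =>
    refine ⟨𝟙 A, rest_id A, by simp, fun d hd _ => ?_⟩
    rw [RLe, hd, Category.comp_id]
  | insert a s ha ih =>
    obtain ⟨e, he, h1, h2⟩ := ih
    have hr : rest (e ≫ rest (x a)) = e ≫ rest (x a) := by
      rw [← he, rest_rest_comp, rest_rest]
    refine ⟨e ≫ rest (x a), hr, fun i hi => ?_, fun d hd h => ?_⟩
    · rw [RLe, hr]
      rcases Finset.mem_insert.1 hi with rfl | hi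
      · rw [Category.assoc, rest_idem]
      · have := h1 i hi
        rw [RLe, he] at this
        rw [Category.assoc, rest_comm, ← Category.assoc, this]
    · have := h2 d hd fun i hi => h i (Finset.mem_insert_of_mem hi)
      rw [RLe] at this ⊢
      rw [← Category.assoc, this]
      have h' := h a (Finset.mem_insert_self _ _)
      rwa [RLe, hd] at h'

/-- For a finite non-empty wide cospan of total maps, restriction limits are ordinary limits. -/
theorem isRestrictionWidePullback_iff {ι : Type w} [Finite ι] [Nonempty ι] {B P : C} {E : ι → C}
    {q : ∀ i, E i ⟶ B} {pr : ∀ i, P ⟶ E i} (hq : ∀ i, IsTotal (q i)) :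
    IsRestrictionWidePullback q pr ↔ IsWidePullbackCone q pr := by
  constructor
  · intro H
    refine ⟨H.comm, fun A x hx => ?_⟩
    obtain ⟨i₀⟩ := ‹Nonempty ι›
    have hdom : ∀ i, rest (x i) = rest (x i₀) := fun i => by
      rw [← (hq i).rest_comp (x i), hx i i₀, (hq i₀).rest_comp]
    obtain ⟨h, ⟨h1, h2⟩, h3⟩ := H.lift A x (x i₀ ≫ q i₀) fun i => by
      rw [RLe, hx i i₀, rest_comp_self]
    have hh : rest h = rest (x i₀) := by
      have a := h2 (rest (x i₀)) (rest_rest _) fun i => by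
        rw [RLe, rest_rest, hdom i, rest_idem]
      have b := h1 i₀
      rw [RLe, (H.total i₀).rest_comp] at b
      have c : rest (rest h ≫ x i₀) = rest h := by rw [b, (H.total i₀).rest_comp]
      rw [rest_rest_comp] at c
      rw [RLe, rest_rest, rest_comm, c] at a
      exact a
    refine ⟨h, fun i => ?_, fun h' hh' => h3 h' ⟨fun i => ?_, fun e he hi => ?_⟩⟩
    · have := h1 i
      rw [RLe, (H.total i).rest_comp, hh, ← hdom i, rest_comp_self] at this
      exact this.symm
    · rw [RLe, hh' i, rest_comp_self]
    · have := hi i₀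
      rwa [← hh' i₀, (H.total i₀).rest_comp] at this
  · intro H
    have htot : ∀ i, IsTotal (pr i) := by
      have hd : ∀ i j, rest (pr i) = rest (pr j) := fun i j => by
        rw [← (hq i).rest_comp (pr i), H.comm i j, (hq j).rest_comp]
      intro i
      refine (H.lift P pr H.comm).unique (fun j => ?_) (fun j => Category.id_comp _)
      rw [hd i j, rest_comp_self]
    refine ⟨htot, H.comm, fun A x y hxy => ?_⟩
    cases nonempty_fintype ι
    obtain ⟨e, he, h1, h2⟩ := exists_domain_meet x Finset.univ
    have h1 : ∀ i, e ≫ rest (x i) = e := fun i => by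
      have := h1 i (Finset.mem_univ i); rwa [RLe, he] at this
    have hr : ∀ i, rest (e ≫ x i) = e := fun i => by rw [← he, rest_rest_comp, he, h1]
    obtain ⟨h, hh, hu⟩ := H.lift A (fun i => e ≫ x i) fun i j => by
      have key : ∀ i, (e ≫ x i) ≫ q i = e ≫ y := fun i => by
        have := hxy i
        rw [RLe, (hq i).rest_comp] at this
        rw [Category.assoc, ← this, ← Category.assoc, h1]
      rw [key, key]
    obtain ⟨i₀⟩ := ‹Nonempty ι›
    have hrh : rest h = e := by rw [← (htot i₀).rest_comp h, hh, hr]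
    refine ⟨h, ⟨fun i => by rw [RLe, hh, hr], fun d hd hdi => ?_⟩, fun h' ⟨a, b⟩ => ?_⟩
    · rw [hrh]; exact h2 d hd fun i _ => hdi i
    · refine hu h' fun i => ?_
      have hle := b e he fun i => by rw [RLe, he, h1]
      rw [RLe, he] at hle
      have hle' := h2 (rest h') (rest_rest _) fun i _ => by
        have := a i
        rw [RLe, (htot i).rest_comp] at this
        have c : rest (rest h' ≫ x i) = rest h' := by rw [this, (htot i).rest_comp]
        rw [rest_rest_comp] at c
        rw [RLe, rest_rest, c]
      rw [RLe, rest_rest] at hle'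
      have : rest h' = e := by
        rw [← hle', ← hle, ← he, rest_comm, ← Category.assoc, rest_idem]
      have ha := a i
      rw [RLe, (htot i).rest_comp, this] at ha
      exact ha.symm

/-- Restriction pullbacks of total maps: the restriction limits of binary cospans. -/
def IsRestrictionPullback {P A B D : C} (fst : P ⟶ A) (snd : P ⟶ B) (f : A ⟶ D) (g : B ⟶ D) :
    Prop :=
  IsRestrictionWidePullback (ι := Bool) (E := fun b => cond b A B)
    (fun b => match b with
      | true => f
      | false => g)
    (fun b => match b with
      | true => fst
      | false => snd)

theorem isRestrictionPullback_iff {P A B D : C} {fst : P ⟶ A} {snd : P ⟶ B} {f : A ⟶ D}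
    {g : B ⟶ D} (hf : IsTotal f) (hg : IsTotal g) :
    IsRestrictionPullback fst snd f g ↔ IsPullback fst snd f g := by
  unfold IsRestrictionPullback
  rw [isRestrictionWidePullback_iff (fun b => by cases b <;> assumption)]
  constructor
  · intro H
    have key : ∀ s : Limits.PullbackCone f g, ∃ k : s.pt ⟶ P, (k ≫ fst = s.fst ∧ k ≫ snd = s.snd) ∧
        ∀ m : s.pt ⟶ P, m ≫ fst = s.fst → m ≫ snd = s.snd → m = k := fun s => by
      obtain ⟨k, hk, hu⟩ := H.lift s.pt (fun b => match b with
        | true => s.fst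
        | false => s.snd) (by
          rintro (_ | _) (_ | _)
          exacts [rfl, s.condition.symm, s.condition, rfl])
      refine ⟨k, ⟨hk true, hk false⟩, fun m h1 h2 => hu m ?_⟩
      rintro (_ | _)
      exacts [h2, h1]
    exact ⟨⟨H.comm true false⟩, ⟨Limits.PullbackCone.IsLimit.mk _
      (fun s => (key s).choose) (fun s => (key s).choose_spec.1.1)
      (fun s => (key s).choose_spec.1.2) (fun s m h1 h2 => (key s).choose_spec.2 m h1 h2)⟩⟩
  · intro H
    refine ⟨?_, fun A' x hx => ⟨H.lift (x true) (x false) (hx true false), ?_, fun k hk => ?_⟩⟩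
    · rintro (_ | _) (_ | _)
      exacts [rfl, H.w.symm, H.w, rfl]
    · rintro (_ | _)
      exacts [H.lift_snd _ _ _, H.lift_fst _ _ _]
    · refine H.hom_ext ?_ ?_
      · rw [H.lift_fst]; exact hk true
      · rw [H.lift_snd]; exact hk false

end Restriction

/-! ### The 2-categories of restriction categories and of split restriction categories -/

set_option linter.checkUnivs false in
/-- Bundled restriction categories. -/
structure RCat where
  carrier : Type u
  [cat : Category.{v} carrier]
  [restr : RestrictionCategory carrier]

namespace RCat

instance : CoeSort RCat.{v, u} (Type u) := ⟨carrier⟩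

attribute [instance] cat restr

end RCat

/-- Restriction functors. -/
structure RFunctor (X Y : RCat.{v, u}) extends X ⥤ Y where
  map_rest : ∀ {A B : X} (f : A ⟶ B), map (rest f) = rest (map f)

/-- Total natural transformations: (strictly) natural, with total components. -/
@[ext]
structure TotalNatTrans {X Y : RCat.{v, u}} (F G : RFunctor X Y) extends
    NatTrans F.toFunctor G.toFunctor where
  total : ∀ A, IsTotal (app A)

namespace RCat

instance : CategoryStruct RCat.{v, u} where
  Hom X Y := RFunctor X Y
  id X := { 𝟭 X with map_rest := fun _ => rfl }
  comp F G :=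
    { F.toFunctor ⋙ G.toFunctor with
      map_rest := fun f => by
        change G.map (F.map (rest f)) = rest (G.map (F.map f))
        rw [F.map_rest, G.map_rest] }

@[simp] theorem id_obj₀ {X : RCat.{v, u}} (A : X) : (𝟙 X : X ⟶ X).obj A = A := rfl

@[simp] theorem id_map₀ {X : RCat.{v, u}} {A B : X} (f : A ⟶ B) : (𝟙 X : X ⟶ X).map f = f := rfl

@[simp] theorem comp_obj₀ {X Y Z : RCat.{v, u}} (F : X ⟶ Y) (G : Y ⟶ Z) (A : X) :
    (F ≫ G).obj A = G.obj (F.obj A) := rfl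

@[simp] theorem comp_map₀ {X Y Z : RCat.{v, u}} (F : X ⟶ Y) (G : Y ⟶ Z) {A B : X} (f : A ⟶ B) :
    (F ≫ G).map f = G.map (F.map f) := rfl

theorem map_total {X Y : RCat.{v, u}} (F : X ⟶ Y) {A B : X} {f : A ⟶ B} (hf : IsTotal f) :
    IsTotal (F.map f) := by
  rw [IsTotal, ← F.map_rest, hf, F.map_id]

instance homCategory (X Y : RCat.{v, u}) : Category (X ⟶ Y) where
  Hom F G := TotalNatTrans F G
  id F := { app := fun A => 𝟙 (F.obj A), total := fun A => isTotal_id _ }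
  comp a b :=
    { app := fun A => a.app A ≫ b.app A
      total := fun A => (a.total A).comp (b.total A) }

@[ext]
theorem hom₂_ext {X Y : RCat.{v, u}} {F G : X ⟶ Y} {a b : F ⟶ G} (h : ∀ A, a.app A = b.app A) :
    a = b := TotalNatTrans.ext (funext h)

theorem congr_app {X Y : RCat.{v, u}} {F G : X ⟶ Y} {a b : F ⟶ G} (h : a = b) (A : X) :
    a.app A = b.app A := by rw [h]

@[simp] theorem id_app {X Y : RCat.{v, u}} (F : X ⟶ Y) (A : X) : (𝟙 F : F ⟶ F).app A = 𝟙 _ := rfl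

@[simp] theorem comp_app {X Y : RCat.{v, u}} {F G H : X ⟶ Y} (a : F ⟶ G) (b : G ⟶ H) (A : X) :
    (a ≫ b).app A = a.app A ≫ b.app A := rfl

instance bicategory : Bicategory RCat.{v, u} where
  homCategory := homCategory
  whiskerLeft F _ _ a :=
    { app := fun A => a.app (F.obj A)
      naturality := fun _ _ f => a.naturality (F.map f)
      total := fun A => a.total (F.obj A) }
  whiskerRight {_ _ _ F F₀} a G :=
    { app := fun A => G.map (a.app A)
      naturality := fun A B f => by
        change G.map (F.map f) ≫ G.map (a.app B) = G.map (a.app A) ≫ G.map (F₀.map f)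
        rw [← G.map_comp, ← G.map_comp, a.naturality]
      total := fun A => map_total G (a.total A) }
  associator F G H :=
    { hom := { app := fun A => 𝟙 (H.obj (G.obj (F.obj A))), total := fun _ => isTotal_id _ }
      inv := { app := fun A => 𝟙 (H.obj (G.obj (F.obj A))), total := fun _ => isTotal_id _ } }
  leftUnitor F :=
    { hom := { app := fun A => 𝟙 (F.obj A), total := fun _ => isTotal_id _ }
      inv := { app := fun A => 𝟙 (F.obj A), total := fun _ => isTotal_id _ } }
  rightUnitor F :=
    { hom := { app := fun A => 𝟙 (F.obj A), total := fun _ => isTotal_id _ }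
      inv := { app := fun A => 𝟙 (F.obj A), total := fun _ => isTotal_id _ } }

@[simp] theorem whiskerLeft_app {X Y Z : RCat.{v, u}} (F : X ⟶ Y) {G H : Y ⟶ Z} (a : G ⟶ H)
    (A : X) : (F ◁ a).app A = a.app (F.obj A) := rfl

@[simp] theorem whiskerRight_app {X Y Z : RCat.{v, u}} {F G : X ⟶ Y} (a : F ⟶ G) (H : Y ⟶ Z)
    (A : X) : (a ▷ H).app A = H.map (a.app A) := rfl

@[simp] theorem associator_hom_app {X Y Z W : RCat.{v, u}} (F : X ⟶ Y) (G : Y ⟶ Z) (H : Z ⟶ W)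
    (A : X) : (α_ F G H).hom.app A = 𝟙 (H.obj (G.obj (F.obj A))) := rfl

@[simp] theorem associator_inv_app {X Y Z W : RCat.{v, u}} (F : X ⟶ Y) (G : Y ⟶ Z) (H : Z ⟶ W)
    (A : X) : (α_ F G H).inv.app A = 𝟙 (H.obj (G.obj (F.obj A))) := rfl

@[simp] theorem leftUnitor_hom_app {X Y : RCat.{v, u}} (F : X ⟶ Y) (A : X) :
    (λ_ F).hom.app A = 𝟙 (F.obj A) := rfl

@[simp] theorem leftUnitor_inv_app {X Y : RCat.{v, u}} (F : X ⟶ Y) (A : X) :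
    (λ_ F).inv.app A = 𝟙 (F.obj A) := rfl

@[simp] theorem rightUnitor_hom_app {X Y : RCat.{v, u}} (F : X ⟶ Y) (A : X) :
    (ρ_ F).hom.app A = 𝟙 (F.obj A) := rfl

@[simp] theorem rightUnitor_inv_app {X Y : RCat.{v, u}} (F : X ⟶ Y) (A : X) :
    (ρ_ F).inv.app A = 𝟙 (F.obj A) := rfl

theorem eqToHom_app₀ {X Y : RCat.{v, u}} {F G : X ⟶ Y} (h : F = G) (A : X) :
    (eqToHom h).app A = eqToHom (by rw [h]) := by
  subst h; rfl

instance : Bicategory.Strict RCat.{v, u} where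
  id_comp _ := rfl
  comp_id _ := rfl
  assoc _ _ _ := rfl

/-- Every restriction idempotent splits. -/
def IsSplit (X : RCat.{v, u}) : Prop :=
  ∀ (A : X) (e : A ⟶ A), rest e = e → ∃ (B : X) (r : A ⟶ B) (m : B ⟶ A), r ≫ m = e ∧ m ≫ r = 𝟙 B

end RCat

set_option linter.checkUnivs false in
/-- Split restriction categories. -/
structure sRCat extends RCat.{v, u} where
  isSplit : toRCat.IsSplit

namespace sRCat

instance : CategoryStruct sRCat.{v, u} where
  Hom X Y := X.toRCat ⟶ Y.toRCat
  id X := 𝟙 X.toRCat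
  comp F G := CategoryStruct.comp (obj := RCat.{v, u}) F G

instance homCategory (X Y : sRCat.{v, u}) : Category (X ⟶ Y) :=
  RCat.homCategory X.toRCat Y.toRCat

/-- The full sub-2-category of `RCat` on the split restriction categories. -/
instance bicategory : Bicategory sRCat.{v, u} where
  homCategory := homCategory
  whiskerLeft F _ _ a := Bicategory.whiskerLeft (B := RCat.{v, u}) F a
  whiskerRight a G := Bicategory.whiskerRight (B := RCat.{v, u}) a G
  associator F G H := Bicategory.associator (B := RCat.{v, u}) F G H
  leftUnitor F := Bicategory.leftUnitor (B := RCat.{v, u}) F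
  rightUnitor F := Bicategory.rightUnitor (B := RCat.{v, u}) F
  whiskerLeft_id _ _ := whiskerLeft_id (B := RCat.{v, u}) _ _
  whiskerLeft_comp _ _ _ _ _ _ := whiskerLeft_comp (B := RCat.{v, u}) _ _ _
  id_whiskerLeft _ := id_whiskerLeft (B := RCat.{v, u}) _
  comp_whiskerLeft _ _ _ _ _ := comp_whiskerLeft (B := RCat.{v, u}) _ _ _
  id_whiskerRight _ _ := id_whiskerRight (B := RCat.{v, u}) _ _
  comp_whiskerRight _ _ _ := comp_whiskerRight (B := RCat.{v, u}) _ _ _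
  whiskerRight_id _ := whiskerRight_id (B := RCat.{v, u}) _
  whiskerRight_comp _ _ _ := whiskerRight_comp (B := RCat.{v, u}) _ _ _
  whisker_assoc _ _ _ _ _ := whisker_assoc (B := RCat.{v, u}) _ _ _
  whisker_exchange _ _ := whisker_exchange (B := RCat.{v, u}) _ _
  pentagon _ _ _ _ := pentagon (B := RCat.{v, u}) _ _ _ _
  triangle _ _ := triangle (B := RCat.{v, u}) _ _

instance : Bicategory.Strict sRCat.{v, u} where
  id_comp _ := rfl
  comp_id _ := rfl
  assoc _ _ _ := rfl

end sRCat

/-! ### Additive bundles -/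

/-- The data of an additive bundle: a projection `q`, a zero `z`, the projections
`π₁ π₂ : E₂ ⟶ E` of a kernel pair of `q`, and a sum `s`. -/
structure PreBundle (C : Type u) [Category.{v} C] where
  (B E E₂ : C)
  q : E ⟶ B
  z : B ⟶ E
  π₁ : E₂ ⟶ E
  π₂ : E₂ ⟶ E
  s : E₂ ⟶ E

namespace PreBundle

variable {C : Type u} [Category.{v} C]

/-- The image of an additive bundle under a functor. -/
@[simps]
def map (b : PreBundle C) {D : Type u'} [Category.{v'} D] (F : C ⥤ D) : PreBundle D where
  B := F.obj b.B
  E := F.obj b.E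
  E₂ := F.obj b.E₂
  q := F.map b.q
  z := F.map b.z
  π₁ := F.map b.π₁
  π₂ := F.map b.π₂
  s := F.map b.s

/-- The equations of an additive bundle; the morphisms into fibre powers that occur in the
associativity, unit and symmetry diagrams are given by their components. -/
structure IsAdditive (b : PreBundle C) : Prop where
  zero_proj : b.z ≫ b.q = 𝟙 b.B
  sum_proj : b.s ≫ b.q = b.π₁ ≫ b.q
  sum_assoc : ∀ {A : C} (u v w w' : A ⟶ b.E₂), u ≫ b.π₂ = v ≫ b.π₁ →
    w ≫ b.π₁ = u ≫ b.s → w ≫ b.π₂ = v ≫ b.π₂ →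
    w' ≫ b.π₁ = u ≫ b.π₁ → w' ≫ b.π₂ = v ≫ b.s → w ≫ b.s = w' ≫ b.s
  zero_sum : ∀ {A : C} (u : A ⟶ b.E₂), u ≫ b.π₁ = u ≫ b.π₂ ≫ b.q ≫ b.z → u ≫ b.s = u ≫ b.π₂
  sum_comm : ∀ {A : C} (u v : A ⟶ b.E₂), u ≫ b.π₁ = v ≫ b.π₂ → u ≫ b.π₂ = v ≫ b.π₁ →
    u ≫ b.s = v ≫ b.s

/-- `(f, g)` is an additive bundle morphism from `b` to `b'`. -/
structure IsHom (b b' : PreBundle C) (f : b.B ⟶ b'.B) (g : b.E ⟶ b'.E) : Prop where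
  proj : g ≫ b'.q = b.q ≫ f
  zero : b.z ≫ g = f ≫ b'.z
  sum : ∀ {A : C} (u : A ⟶ b.E₂) (u' : A ⟶ b'.E₂), u' ≫ b'.π₁ = u ≫ b.π₁ ≫ g →
    u' ≫ b'.π₂ = u ≫ b.π₂ ≫ g → u' ≫ b'.s = u ≫ b.s ≫ g

end PreBundle

/-! ### Tangentads -/

section Tangentad

variable {K : Type u} [Bicategory.{w, v} K]

/-- The iterates of a 1-endomorphism. -/
def iter {X : K} (T : X ⟶ X) : ℕ → (X ⟶ X)
  | 0 => 𝟙 X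
  | m + 1 => iter T m ≫ T

/-- The data underlying a tangent structure on an object `X` of a 2-category. `pow n` is the
`(n+1)`-fold fibre power `T_{n+1}` of the projection, with projections `π n i`. -/
structure TangentData (X : K) where
  T : X ⟶ X
  p : T ⟶ 𝟙 X
  pow : ℕ → (X ⟶ X)
  π : ∀ (n : ℕ), Fin (n + 1) → (pow n ⟶ T)
  z : 𝟙 X ⟶ T
  s : pow 1 ⟶ T
  l : T ⟶ T ≫ T
  c : T ≫ T ⟶ T ≫ T

namespace TangentData

variable {X : K} (D : TangentData X)

/-- The additive bundle `(p, z, s)` in the category of endomorphisms of `X`. -/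
@[simps]
def bundle : PreBundle (X ⟶ X) where
  B := 𝟙 X
  E := D.T
  E₂ := D.pow 1
  q := D.p
  z := D.z
  π₁ := D.π 1 0
  π₂ := D.π 1 1
  s := D.s

/-- The axioms of a tangentad. Composition is written in diagrammatic order: the
composite `T ∘ T_n` is `pow _ ≫ T`, the 2-cell `T p` is `p ▷ T`, and `p_T` is `T ◁ p`. -/
structure IsTangentad : Prop where
  bundle_additive : D.bundle.IsAdditive
  /-- The fibre powers of `p` are pointwise and preserved by the iterates of `T`. -/
  pow_limit : ∀ (n m : ℕ) {Y : K} (F : Y ⟶ X),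
    IsWidePullbackCone (fun _ : Fin (n + 1) => F ◁ (D.p ▷ iter D.T m))
      (fun i => F ◁ (D.π n i ▷ iter D.T m))
  /-- `(z, l)` is an additive bundle morphism from `p` to `T p`. -/
  lift_additive : D.bundle.IsHom (D.bundle.map (postcomp X D.T)) (D.z ≫ (λ_ D.T).inv) D.l
  /-- `(id, c)` is an additive bundle morphism from `T p` to `p_T`. -/
  flip_additive : (D.bundle.map (postcomp X D.T)).IsHom (D.bundle.map (precomp X D.T))
    ((λ_ D.T).hom ≫ (ρ_ D.T).inv) D.c
  lift_coassoc : D.l ≫ D.l ▷ D.T = D.l ≫ D.T ◁ D.l ≫ (α_ D.T D.T D.T).inv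
  lift_flip : D.l ≫ D.c = D.l
  lift_flip_flip : D.T ◁ D.l ≫ (α_ D.T D.T D.T).inv ≫ D.c ▷ D.T ≫ (α_ D.T D.T D.T).hom ≫
    D.T ◁ D.c = D.c ≫ D.l ▷ D.T ≫ (α_ D.T D.T D.T).hom
  flip_flip : D.c ≫ D.c = 𝟙 (D.T ≫ D.T)
  flip_braid : D.c ▷ D.T ≫ (α_ D.T D.T D.T).hom ≫ D.T ◁ D.c ≫ (α_ D.T D.T D.T).inv ≫
      D.c ▷ D.T ≫ (α_ D.T D.T D.T).hom =
    (α_ D.T D.T D.T).hom ≫ D.T ◁ D.c ≫ (α_ D.T D.T D.T).inv ≫ D.c ▷ D.T ≫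
      (α_ D.T D.T D.T).hom ≫ D.T ◁ D.c
  /-- Universality of the vertical lift: `w` is the 2-cell `⟨l ∘ π₁, z_T ∘ π₂⟩ : T_2 ⟶ T ∘ T_2`. -/
  lift_universal : ∀ w : D.pow 1 ⟶ D.pow 1 ≫ D.T,
    w ≫ D.π 1 0 ▷ D.T = D.π 1 0 ≫ D.l →
    w ≫ D.π 1 1 ▷ D.T = D.π 1 1 ≫ (ρ_ D.T).inv ≫ D.T ◁ D.z →
    ∀ {Y : K} (F : Y ⟶ X), IsPullback (F ◁ (w ≫ D.s ▷ D.T)) (F ◁ (D.π 1 0 ≫ D.p))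
      (F ◁ (D.p ▷ D.T ≫ (λ_ D.T).hom)) (F ◁ D.z)

end TangentData

variable (K) in
/-- Objects equipped with the data of a tangent structure. -/
structure TngPair where
  X : K
  D : TangentData X

/-- The double `T ∘ T` instance `F ∘ T ∘ T ⟶ T' ∘ T' ∘ F` of a distributive law. -/
def twice {X Y : K} {T : X ⟶ X} {T' : Y ⟶ Y} {F : X ⟶ Y} (a : T ≫ F ⟶ F ≫ T') :
    (T ≫ T) ≫ F ⟶ F ≫ T' ≫ T' :=
  (α_ T T F).hom ≫ T ◁ a ≫ (α_ T F T').inv ≫ a ▷ T' ≫ (α_ F T' T').hom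

/-- Lax tangent 1-morphisms. -/
structure LaxMor (A B : TngPair K) where
  F : A.X ⟶ B.X
  α : A.D.T ≫ F ⟶ F ≫ B.D.T
  proj : α ≫ F ◁ B.D.p = A.D.p ▷ F ≫ (λ_ F).hom ≫ (ρ_ F).inv
  zero : A.D.z ▷ F ≫ α = (λ_ F).hom ≫ (ρ_ F).inv ≫ F ◁ B.D.z
  sum : ∃ a₂ : A.D.pow 1 ≫ F ⟶ F ≫ B.D.pow 1,
    (∀ i, a₂ ≫ F ◁ B.D.π 1 i = A.D.π 1 i ▷ F ≫ α) ∧ A.D.s ▷ F ≫ α = a₂ ≫ F ◁ B.D.s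
  lift : A.D.l ▷ F ≫ twice α = α ≫ F ◁ B.D.l
  flip : A.D.c ▷ F ≫ twice α = twice α ≫ F ◁ B.D.c

/-- Tangent 2-morphisms. -/
@[ext]
structure LaxMor.Hom {A B : TngPair K} (f g : LaxMor A B) where
  cell : f.F ⟶ g.F
  comm : f.α ≫ cell ▷ B.D.T = A.D.T ◁ cell ≫ g.α

/-- The composite of two distributive laws. -/
def compLaw {X Y Z : K} {T : X ⟶ X} {T' : Y ⟶ Y} {T'' : Z ⟶ Z} {F : X ⟶ Y} {G : Y ⟶ Z}
    (a : T ≫ F ⟶ F ≫ T') (b : T' ≫ G ⟶ G ≫ T'') : T ≫ F ≫ G ⟶ (F ≫ G) ≫ T'' :=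
  (α_ T F G).inv ≫ a ▷ G ≫ (α_ F T' G).hom ≫ F ◁ b ≫ (α_ F G T'').inv

theorem twice_compLaw {X Y Z : K} {T : X ⟶ X} {T' : Y ⟶ Y} {T'' : Z ⟶ Z} {F : X ⟶ Y} {G : Y ⟶ Z}
    (a : T ≫ F ⟶ F ≫ T') (b : T' ≫ G ⟶ G ≫ T'') :
    twice (compLaw a b) = compLaw (twice a) (twice b) := by
  have h : (T ≫ F) ◁ b ≫ a ▷ (G ≫ T'') = a ▷ (T' ≫ G) ≫ (F ≫ T') ◁ b := whisker_exchange a b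
  unfold twice compLaw
  calc _ = 𝟙 _ ⊗≫ T ◁ a ▷ G ⊗≫ ((T ≫ F) ◁ b ≫ a ▷ (G ≫ T'')) ⊗≫ F ◁ b ▷ T'' ⊗≫ 𝟙 _ := by
        bicategory
    _ = _ := by rw [h]; bicategory

theorem compLaw_square {X Y Z : K} {T S : X ⟶ X} {T' S' : Y ⟶ Y} {T'' S'' : Z ⟶ Z} {F : X ⟶ Y}
    {G : Y ⟶ Z} {x : T ⟶ S} {x' : T' ⟶ S'} {x'' : T'' ⟶ S''}
    {a : T ≫ F ⟶ F ≫ T'} {a' : S ≫ F ⟶ F ≫ S'} {b : T' ≫ G ⟶ G ≫ T''} {b' : S' ≫ G ⟶ G ≫ S''}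
    (ha : a ≫ F ◁ x' = x ▷ F ≫ a') (hb : b ≫ G ◁ x'' = x' ▷ G ≫ b') :
    compLaw a b ≫ (F ≫ G) ◁ x'' = x ▷ (F ≫ G) ≫ compLaw a' b' := by
  unfold compLaw
  calc _ = 𝟙 _ ⊗≫ a ▷ G ⊗≫ F ◁ (b ≫ G ◁ x'') ⊗≫ 𝟙 _ := by bicategory
    _ = 𝟙 _ ⊗≫ (a ≫ F ◁ x') ▷ G ⊗≫ F ◁ b' ⊗≫ 𝟙 _ := by rw [hb]; bicategory
    _ = _ := by rw [ha]; bicategory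

theorem compLaw_whiskerLeft {X Y Z : K} {T : X ⟶ X} {T' : Y ⟶ Y} {T'' : Z ⟶ Z} {F : X ⟶ Y}
    {G H : Y ⟶ Z} (a : T ≫ F ⟶ F ≫ T') {b : T' ≫ G ⟶ G ≫ T''} {b' : T' ≫ H ⟶ H ≫ T''}
    {y : G ⟶ H} (hy : b ≫ y ▷ T'' = T' ◁ y ≫ b') :
    compLaw a b ≫ (F ◁ y) ▷ T'' = T ◁ (F ◁ y) ≫ compLaw a b' := by
  have h : (T ≫ F) ◁ y ≫ a ▷ H = a ▷ G ≫ (F ≫ T') ◁ y := whisker_exchange a y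
  unfold compLaw
  calc _ = 𝟙 _ ⊗≫ a ▷ G ⊗≫ F ◁ (b ≫ y ▷ T'') ⊗≫ 𝟙 _ := by bicategory
    _ = 𝟙 _ ⊗≫ (a ▷ G ≫ (F ≫ T') ◁ y) ⊗≫ F ◁ b' ⊗≫ 𝟙 _ := by rw [hy]; bicategory
    _ = _ := by rw [← h]; bicategory

theorem compLaw_whiskerRight {X Y Z : K} {T : X ⟶ X} {T' : Y ⟶ Y} {T'' : Z ⟶ Z} {F F' : X ⟶ Y}
    {G : Y ⟶ Z} {a : T ≫ F ⟶ F ≫ T'} {a' : T ≫ F' ⟶ F' ≫ T'} (b : T' ≫ G ⟶ G ≫ T'')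
    {x : F ⟶ F'} (hx : a ≫ x ▷ T' = T ◁ x ≫ a') :
    compLaw a b ≫ (x ▷ G) ▷ T'' = T ◁ (x ▷ G) ≫ compLaw a' b := by
  have h : F ◁ b ≫ x ▷ (G ≫ T'') = x ▷ (T' ≫ G) ≫ F' ◁ b := whisker_exchange x b
  unfold compLaw
  calc _ = 𝟙 _ ⊗≫ a ▷ G ⊗≫ (F ◁ b ≫ x ▷ (G ≫ T'')) ⊗≫ 𝟙 _ := by bicategory
    _ = 𝟙 _ ⊗≫ (a ≫ x ▷ T') ▷ G ⊗≫ F' ◁ b ⊗≫ 𝟙 _ := by rw [h]; bicategory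
    _ = _ := by rw [hx]; bicategory

theorem compLaw_unit {X Y Z : K} (F : X ⟶ Y) (G : Y ⟶ Z) :
    compLaw ((λ_ F).hom ≫ (ρ_ F).inv) ((λ_ G).hom ≫ (ρ_ G).inv) =
      (λ_ (F ≫ G)).hom ≫ (ρ_ (F ≫ G)).inv := by
  unfold compLaw
  bicategory

theorem twice_id {X : K} (T : X ⟶ X) :
    twice ((ρ_ T).hom ≫ (λ_ T).inv) = (ρ_ (T ≫ T)).hom ≫ (λ_ (T ≫ T)).inv := by
  unfold twice
  bicategory

theorem LaxMor.ext_of_comm {A B : TngPair K} {f g : LaxMor A B} (h : f.F = g.F)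
    (hα : f.α ≫ eqToHom h ▷ B.D.T = A.D.T ◁ eqToHom h ≫ g.α) : f = g := by
  obtain ⟨F, α, _, _, _, _, _⟩ := f
  obtain ⟨G, β, _, _, _, _, _⟩ := g
  dsimp only at h
  subst h
  simp only [eqToHom_refl, id_whiskerRight, whiskerLeft_id, Category.comp_id,
    Category.id_comp] at hα
  subst hα
  rfl

namespace TngPair

/-- The identity lax tangent 1-morphism. -/
@[simps]
def idMor (A : TngPair K) : LaxMor A A where
  F := 𝟙 A.X
  α := (ρ_ A.D.T).hom ≫ (λ_ A.D.T).inv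
  proj := by simp
  zero := by simp
  sum := ⟨(ρ_ _).hom ≫ (λ_ _).inv, fun i => by simp, by simp⟩
  lift := by rw [twice_id]; simp
  flip := by rw [twice_id]; simp

/-- Composition of lax tangent 1-morphisms. -/
@[simps]
def compMor {A B C : TngPair K} (f : LaxMor A B) (g : LaxMor B C) : LaxMor A C where
  F := f.F ≫ g.F
  α := compLaw f.α g.α
  proj := by
    rw [compLaw_square f.proj g.proj, compLaw_unit]
  zero := by
    rw [← compLaw_square (x := A.D.z) (x'' := C.D.z) (by rw [f.zero, Category.assoc])
      (by rw [g.zero, Category.assoc]), compLaw_unit, Category.assoc]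
  sum := by
    obtain ⟨a, ha, ha'⟩ := f.sum
    obtain ⟨b, hb, hb'⟩ := g.sum
    exact ⟨compLaw a b, fun i => compLaw_square (ha i) (hb i),
      (compLaw_square ha'.symm hb'.symm).symm⟩
  lift := by rw [twice_compLaw, compLaw_square f.lift.symm g.lift.symm]
  flip := by rw [twice_compLaw, compLaw_square f.flip.symm g.flip.symm]

instance : CategoryStruct (TngPair K) where
  Hom A B := LaxMor A B
  id := idMor
  comp := compMor

instance homCategory (A B : TngPair K) : Category (A ⟶ B) where
  Hom f g := LaxMor.Hom f g
  id f := { cell := 𝟙 f.F, comm := by simp }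
  comp a b :=
    { cell := a.cell ≫ b.cell
      comm := by
        rw [comp_whiskerRight, ← Category.assoc, a.comm, Category.assoc, b.comm, 
          whiskerLeft_comp, Category.assoc] }
  id_comp a := LaxMor.Hom.ext (Category.id_comp a.cell)
  comp_id a := LaxMor.Hom.ext (Category.comp_id a.cell)
  assoc a b c := LaxMor.Hom.ext (Category.assoc a.cell b.cell c.cell)

@[ext]
theorem hom₂_ext {A B : TngPair K} {f g : A ⟶ B} {a b : f ⟶ g} (h : a.cell = b.cell) : a = b :=
  LaxMor.Hom.ext h

@[simp] theorem id_F (A : TngPair K) : (𝟙 A : A ⟶ A).F = 𝟙 A.X := rfl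

@[simp] theorem comp_F {A B C : TngPair K} (f : A ⟶ B) (g : B ⟶ C) : (f ≫ g).F = f.F ≫ g.F := rfl

@[simp] theorem id_α (A : TngPair K) : (𝟙 A : A ⟶ A).α = (ρ_ A.D.T).hom ≫ (λ_ A.D.T).inv := rfl

@[simp] theorem comp_α {A B C : TngPair K} (f : A ⟶ B) (g : B ⟶ C) :
    (f ≫ g).α = compLaw f.α g.α := rfl

@[simp] theorem id_cell {A B : TngPair K} (f : A ⟶ B) : (𝟙 f : f ⟶ f).cell = 𝟙 f.F := rfl

@[simp] theorem comp_cell {A B : TngPair K} {f g h : A ⟶ B} (a : f ⟶ g) (b : g ⟶ h) :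
    (a ≫ b).cell = a.cell ≫ b.cell := rfl

/-- An invertible 2-cell of the underlying 2-category that is tangent is invertible as
a tangent 2-morphism. -/
@[simps]
def isoMk {A B : TngPair K} {f g : A ⟶ B} (e : f.F ≅ g.F)
    (h : f.α ≫ e.hom ▷ B.D.T = A.D.T ◁ e.hom ≫ g.α) : f ≅ g where
  hom := { cell := e.hom, comm := h }
  inv :=
    { cell := e.inv
      comm := by
        rw [← cancel_epi (A.D.T ◁ e.hom), ← Category.assoc, ← h, Category.assoc,
          ← comp_whiskerRight, e.hom_inv_id, id_whiskerRight, Category.comp_id,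
          ← Category.assoc, ← whiskerLeft_comp, e.hom_inv_id, whiskerLeft_id, Category.id_comp] }
  hom_inv_id := hom₂_ext e.hom_inv_id
  inv_hom_id := hom₂_ext e.inv_hom_id

instance bicategory : Bicategory (TngPair K) where
  homCategory := homCategory
  whiskerLeft f _ _ a :=
    { cell := f.F ◁ a.cell
      comm := compLaw_whiskerLeft f.α a.comm }
  whiskerRight a h :=
    { cell := a.cell ▷ h.F
      comm := compLaw_whiskerRight h.α a.comm }
  associator f g h := isoMk (α_ f.F g.F h.F) (by simp [compLaw])
  leftUnitor f := isoMk (λ_ f.F) (by simp [compLaw])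
  rightUnitor f := isoMk (ρ_ f.F) (by simp [compLaw])
  whiskerLeft_id _ _ := hom₂_ext (whiskerLeft_id _ _)
  whiskerLeft_comp _ _ _ _ _ _ := hom₂_ext (whiskerLeft_comp _ _ _)
  id_whiskerLeft _ := hom₂_ext (id_whiskerLeft _)
  comp_whiskerLeft _ _ _ _ _ := hom₂_ext (comp_whiskerLeft _ _ _)
  id_whiskerRight _ _ := hom₂_ext (id_whiskerRight _ _)
  comp_whiskerRight _ _ _ := hom₂_ext (comp_whiskerRight _ _ _)
  whiskerRight_id _ := hom₂_ext (whiskerRight_id _)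
  whiskerRight_comp _ _ _ := hom₂_ext (whiskerRight_comp _ _ _)
  whisker_assoc _ _ _ _ _ := hom₂_ext (whisker_assoc _ _ _)
  whisker_exchange _ _ := hom₂_ext (whisker_exchange _ _)
  pentagon _ _ _ _ := hom₂_ext (pentagon _ _ _ _)
  triangle _ _ := hom₂_ext (triangle _ _)

@[simp] theorem whiskerLeft_cell {A B C : TngPair K} (f : A ⟶ B) {g h : B ⟶ C} (a : g ⟶ h) :
    (f ◁ a).cell = f.F ◁ a.cell := rfl

@[simp] theorem whiskerRight_cell {A B C : TngPair K} {f g : A ⟶ B} (a : f ⟶ g) (h : B ⟶ C) :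
    (a ▷ h).cell = a.cell ▷ h.F := rfl

theorem eqToHom_cell {A B : TngPair K} {f g : A ⟶ B} (h : f = g) :
    (eqToHom h).cell = eqToHom (congrArg LaxMor.F h) := by
  subst h; rfl

theorem eq_of_iso {A B : TngPair K} {f g : A ⟶ B} (e : f ≅ g) (h : f.F = g.F)
    (he : e.hom.cell = eqToHom h) : f = g :=
  LaxMor.ext_of_comm h (by rw [← he]; exact e.hom.comm)

theorem iso_eq_eqToIso {A B : TngPair K} {f g : A ⟶ B} (e : f ≅ g) (h : f = g)
    (he : e.hom.cell = eqToHom (congrArg LaxMor.F h)) : e = eqToIso h :=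
  Iso.ext (hom₂_ext (by rw [he, eqToIso.hom, eqToHom_cell]))

instance [Bicategory.Strict K] : Bicategory.Strict (TngPair K) where
  id_comp f := eq_of_iso (λ_ f) (Strict.id_comp f.F)
    (congrArg Iso.hom (Strict.leftUnitor_eqToIso f.F))
  comp_id f := eq_of_iso (ρ_ f) (Strict.comp_id f.F)
    (congrArg Iso.hom (Strict.rightUnitor_eqToIso f.F))
  assoc f g h := eq_of_iso (α_ f g h) (Strict.assoc f.F g.F h.F)
    (congrArg Iso.hom (Strict.associator_eqToIso f.F g.F h.F))
  leftUnitor_eqToIso f := iso_eq_eqToIso _ _ (congrArg Iso.hom (Strict.leftUnitor_eqToIso f.F))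
  rightUnitor_eqToIso f := iso_eq_eqToIso _ _ (congrArg Iso.hom (Strict.rightUnitor_eqToIso f.F))
  associator_eqToIso f g h :=
    iso_eq_eqToIso _ _ (congrArg Iso.hom (Strict.associator_eqToIso f.F g.F h.F))

end TngPair

variable (K) in
/-- A tangentad: an object of a 2-category equipped with a tangent structure. -/
structure Tangentad extends TngPair K where
  isTangentad : D.IsTangentad

variable (K) in
/-- The 2-category of tangentads in `K`, lax tangent 1-morphisms and tangent 2-morphisms. -/
abbrev Tng := InducedBicategory (TngPair K) (Tangentad.toTngPair (K := K))

/-! ### Vector fields in the Hom-tangent categories of tangentads -/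

theorem IsWidePullbackCone.of_iso {C : Type u'} [Category.{v'} C] {ι : Type*} {B B' P P' : C}
    {E E' : ι → C} {q : ∀ i, E i ⟶ B} {pr : ∀ i, P ⟶ E i} {q' : ∀ i, E' i ⟶ B'}
    {pr' : ∀ i, P' ⟶ E' i} (H : IsWidePullbackCone q pr) (eB : B ≅ B') (eP : P ≅ P')
    (eE : ∀ i, E i ≅ E' i) (hq : ∀ i, (eE i).hom ≫ q' i = q i ≫ eB.hom)
    (hpr : ∀ i, eP.hom ≫ pr' i = pr i ≫ (eE i).hom) : IsWidePullbackCone q' pr' := by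
  have hq' : ∀ i, q' i = (eE i).inv ≫ q i ≫ eB.hom := fun i => by
    rw [← hq, Iso.inv_hom_id_assoc]
  have hpr' : ∀ i, pr' i = eP.inv ≫ pr i ≫ (eE i).hom := fun i => by
    rw [← hpr, Iso.inv_hom_id_assoc]
  refine ⟨fun i j => ?_, fun A x hx => ?_⟩
  · have := H.comm i j
    simp only [hq', hpr', Category.assoc, Iso.hom_inv_id_assoc]
    rw [← Category.assoc (pr i), ← Category.assoc (pr j), this]
  · obtain ⟨k, hk, hu⟩ := H.lift A (fun i => x i ≫ (eE i).inv) fun i j => by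
      have := hx i j
      rw [hq', hq', ← Category.assoc, ← Category.assoc, ← Category.assoc, ← Category.assoc,
        cancel_mono] at this
      exact this
    refine ⟨k ≫ eP.hom, fun i => ?_, fun k' hk' => ?_⟩
    · rw [Category.assoc, hpr, ← Category.assoc, hk, Category.assoc, Iso.inv_hom_id,
        Category.comp_id]
    · rw [← hu (k' ≫ eP.inv) fun i => ?_, Category.assoc, Iso.inv_hom_id, Category.comp_id]
      have := hk' i
      rw [← this, hpr']
      simp

theorem TangentData.IsTangentad.pow_limit₀ {X : K} {D : TangentData X} (h : D.IsTangentad) (n : ℕ)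
    {Y : K} (F : Y ⟶ X) :
    IsWidePullbackCone (fun _ : Fin (n + 1) => F ◁ D.p) (fun i => F ◁ D.π n i) :=
  (h.pow_limit n 0 F).of_iso (whiskerLeftIso F (ρ_ _)) (whiskerLeftIso F (ρ_ _))
    (fun _ => whiskerLeftIso F (ρ_ _))
    (fun i => by
      change F ◁ _ ≫ F ◁ _ = F ◁ (_ ▷ 𝟙 X) ≫ F ◁ _
      rw [← whiskerLeft_comp, ← whiskerLeft_comp, rightUnitor_naturality])
    (fun i => by
      change F ◁ _ ≫ F ◁ _ = F ◁ (_ ▷ 𝟙 X) ≫ F ◁ _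
      rw [← whiskerLeft_comp, ← whiskerLeft_comp, rightUnitor_naturality])

/-- The lax tangent 1-endomorphism `(T, c)` of a tangentad. -/
@[simps]
def TangentData.IsTangentad.tanMor {X : K} {D : TangentData X} (h : D.IsTangentad) :
    LaxMor (TngPair.mk X D) (TngPair.mk X D) where
  F := D.T
  α := D.c
  proj := h.flip_additive.proj
  zero := h.flip_additive.zero.trans (Category.assoc _ _ _)
  sum := by
    have hc : D.c ≫ D.T ◁ D.p = D.p ▷ D.T ≫ (λ_ D.T).hom ≫ (ρ_ D.T).inv := h.flip_additive.proj
    obtain ⟨a, ha, -⟩ := (h.pow_limit₀ 1 D.T).lift _ (fun i => D.π 1 i ▷ D.T ≫ D.c) fun i j => by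
      have := (h.pow_limit₀ 1 (𝟙 X)).comm i j
      rw [id_whiskerLeft, id_whiskerLeft, id_whiskerLeft] at this
      simp only [Category.assoc, Iso.inv_hom_id_assoc, Iso.cancel_iso_hom_left] at this
      rw [← Category.assoc, ← Category.assoc, cancel_mono] at this
      rw [Category.assoc, Category.assoc, hc, ← comp_whiskerRight_assoc, ← comp_whiskerRight_assoc,
        this]
    refine ⟨a, ha, ?_⟩
    have := h.flip_additive.sum (𝟙 _) a (by rw [Category.id_comp]; exact ha 0)
      (by rw [Category.id_comp]; exact ha 1)
    rw [Category.id_comp] at this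
    exact this.symm
  lift := by
    change D.l ▷ D.T ≫ twice D.c = D.c ≫ D.T ◁ D.l
    have h1 : D.l ▷ D.T ≫ (α_ D.T D.T D.T).hom = D.c ≫ D.T ◁ D.l ≫ (α_ D.T D.T D.T).inv ≫
        D.c ▷ D.T ≫ (α_ D.T D.T D.T).hom ≫ D.T ◁ D.c := by
      rw [h.lift_flip_flip, ← Category.assoc D.c D.c, h.flip_flip, Category.id_comp]
    have h2 : D.T ◁ D.c ≫ D.T ◁ D.c = 𝟙 _ := by
      rw [← whiskerLeft_comp, h.flip_flip, whiskerLeft_id]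
    have h3 : D.c ▷ D.T ≫ D.c ▷ D.T = 𝟙 _ := by
      rw [← comp_whiskerRight, h.flip_flip, id_whiskerRight]
    unfold twice
    rw [← Category.assoc, h1]
    simp only [Category.assoc]
    rw [reassoc_of% h2, Iso.hom_inv_id_assoc, reassoc_of% h3, Iso.inv_hom_id, Category.comp_id]
  flip := by
    change D.c ▷ D.T ≫ twice D.c = twice D.c ≫ D.T ◁ D.c
    unfold twice
    simpa using h.flip_braid

/-- The lax tangent 1-endomorphism `(T, c)` of a tangentad. -/
def tan (X : Tng K) : X ⟶ X := InducedBicategory.mkHom X.isTangentad.tanMor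

/-- The projection, as a tangent 2-morphism `(T, c) ⟶ id`. -/
def tanProj (X : Tng K) : tan X ⟶ 𝟙 X where
  hom :=
    { cell := X.D.p
      comm := by
        have hc : X.D.c ≫ X.D.T ◁ X.D.p = X.D.p ▷ X.D.T ≫ (λ_ X.D.T).hom ≫ (ρ_ X.D.T).inv :=
          X.isTangentad.flip_additive.proj
        change X.D.c ≫ X.D.p ▷ X.D.T = X.D.T ◁ X.D.p ≫ (ρ_ X.D.T).hom ≫ (λ_ X.D.T).inv
        have h : X.D.p ▷ X.D.T = X.D.c ≫ X.D.T ◁ X.D.p ≫ (ρ_ X.D.T).hom ≫ (λ_ X.D.T).inv := by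
          rw [← Category.assoc, hc]
          simp
        rw [h, ← Category.assoc, X.isTangentad.flip_flip, Category.id_comp] }

theorem section_comp {X' V X : K} (H : X' ⟶ V) {G : V ⟶ X} {T : X ⟶ X} {p : T ⟶ 𝟙 X}
    {u : G ⟶ G ≫ T} (h : u ≫ G ◁ p ≫ (ρ_ G).hom = 𝟙 G) :
    (H ◁ u ≫ (α_ H G T).inv) ≫ (H ≫ G) ◁ p ≫ (ρ_ (H ≫ G)).hom = 𝟙 (H ≫ G) := by
  have := congrArg (H ◁ ·) h
  simpa using this

theorem section_natural {X' V X : K} {H H' : X' ⟶ V} (φ : H ⟶ H') {G : V ⟶ X} {T : X ⟶ X}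
    (u : G ⟶ G ≫ T) :
    (H ◁ u ≫ (α_ H G T).inv) ≫ (φ ▷ G) ▷ T = φ ▷ G ≫ H' ◁ u ≫ (α_ H' G T).inv := by
  rw [← whisker_exchange_assoc]
  simp

/-- A vector field in the Hom-tangent category `[X', X]`: a lax tangent 1-morphism `G` with a
tangent 2-morphism `u` from `G` to its tangent bundle `(T, c) ∘ G`, that is a section of the
projection. -/
structure HomVectorField (X' X : Tng K) where
  G : X' ⟶ X
  u : G ⟶ G ≫ tan X
  sect : u ≫ G ◁ tanProj X ≫ (ρ_ G).hom = 𝟙 G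

namespace HomVectorField

/-- Morphisms of vector fields. -/
@[ext]
structure Hom {X' X : Tng K} (a b : HomVectorField X' X) where
  φ : a.G ⟶ b.G
  comm : a.u ≫ φ ▷ tan X = φ ≫ b.u

instance (X' X : Tng K) : Category (HomVectorField X' X) where
  Hom := Hom
  id a :=
    { φ := 𝟙 a.G
      comm := (congrArg (a.u ≫ ·) (id_whiskerRight _ _)).trans
        ((Category.comp_id _).trans (Category.id_comp _).symm) }
  comp f g :=
    { φ := f.φ ≫ g.φ
      comm := by rw [comp_whiskerRight, ← Category.assoc, f.comm, Category.assoc, g.comm, Category.assoc] }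
  id_comp f := Hom.ext (Category.id_comp f.φ)
  comp_id f := Hom.ext (Category.comp_id f.φ)
  assoc f g h := Hom.ext (Category.assoc f.φ g.φ h.φ)

/-- The functor `Γ` from `[X', V]` to vector fields in `[X', X]` induced by a vector
field in `[V, X]`. -/
def Γ {V X : Tng K} (a : HomVectorField V X) (X' : Tng K) : (X' ⟶ V) ⥤ HomVectorField X' X where
  obj H :=
    { G := H ≫ a.G
      u := H ◁ a.u ≫ (α_ H a.G (tan X)).inv
      sect := section_comp H a.sect }
  map {H H'} φ :=
    { φ := φ ▷ a.G
      comm := section_natural φ a.u }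
  map_id H := Hom.ext (id_whiskerRight _ _)
  map_comp f g := Hom.ext (comp_whiskerRight _ _ _)

end HomVectorField

/-- Strict tangent 1-morphisms: those whose distributive law is an identity. -/
def IsStrictMor {X Y : Tng K} (f : X ⟶ Y) : Prop :=
  ∃ h : X.D.T ≫ f.hom.F = f.hom.F ≫ Y.D.T, f.hom.α = eqToHom h

/-- Isomorphisms of categories: fully faithful functors that are bijective on objects. -/
structure IsCatIso {C : Type u} [Category.{v} C] {D : Type u'} [Category.{v'} D] (F : C ⥤ D) :
    Prop where
  full : F.Full
  faithful : F.Faithful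
  bijective_obj : Function.Bijective F.obj

/-- A tangentad of vector fields of `X`, with its universal vector field. The underlying 1-morphism
`U` of the universal vector field is strict, so that `Γ` is a strict tangent morphism, and it
is invertible precisely when its underlying functor is an isomorphism of categories. -/
structure UniversalVectorField (X : Tng K) where
  V : Tng K
  vf : HomVectorField V X
  strict : IsStrictMor vf.G
  universal : ∀ X' : Tng K, IsCatIso (vf.Γ X')

/-- `X` admits the construction of vector fields. -/
def AdmitsVectorFields (X : Tng K) : Prop := Nonempty (UniversalVectorField X)

end Tangentad

/-! ### Pullback-extension contexts -/

/-- Strict 2-pullback squares in a 2-category. -/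
structure IsTwoPullback {J : Type u} [Bicategory.{w, v} J] [Bicategory.Strict J] {P A B C : J}
    (fst : P ⟶ A) (snd : P ⟶ B) (f : A ⟶ C) (g : B ⟶ C) : Prop where
  comm : fst ≫ f = snd ≫ g
  lift : ∀ (Z : J) (a : Z ⟶ A) (b : Z ⟶ B), a ≫ f = b ≫ g →
    ∃! h : Z ⟶ P, h ≫ fst = a ∧ h ≫ snd = b
  lift₂ : ∀ (Z : J) (h k : Z ⟶ P) (a : h ≫ fst ⟶ k ≫ fst) (b : h ≫ snd ⟶ k ≫ snd),
    a ▷ f ≫ eqToHom (by rw [Strict.assoc, comm, Strict.assoc]) =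
      eqToHom (by rw [Strict.assoc, comm, Strict.assoc]) ≫ b ▷ g →
    ∃! θ : h ⟶ k, θ ▷ fst = a ∧ θ ▷ snd = b

/-- A pullback-extension context: 2-functors `Ξ : J ⇆ Tng K : Inc` and a 2-natural transformation
`η` from the identity to `Inc ∘ Ξ`. -/
structure PullbackExtensionContext (K : Type u) [Bicategory.{w, v} K] [Bicategory.Strict K]
    (J : Type u') [Bicategory.{w', v'} J] [Bicategory.Strict J] where
  Ξ : StrictPseudofunctor J (Tng K)
  Inc : StrictPseudofunctor (Tng K) J
  η : ∀ X : J, X ⟶ Inc.obj (Ξ.obj X)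
  naturality : ∀ {X Y : J} (f : X ⟶ Y), f ≫ η Y = η X ≫ Inc.map (Ξ.map f)
  naturality₂ : ∀ {X Y : J} {f g : X ⟶ Y} (θ : f ⟶ g),
    θ ▷ η Y ≫ eqToHom (naturality g) = eqToHom (naturality f) ≫ η X ◁ Inc.map₂ (Ξ.map₂ θ)

namespace PullbackExtensionContext

variable {K : Type u} [Bicategory.{w, v} K] [Bicategory.Strict K]
  {J : Type u'} [Bicategory.{w', v'} J] [Bicategory.Strict J] (S : PullbackExtensionContext K J)

/-- `P`, with the 1-morphism `U : P ⟶ X`, is an object of vector fields of `X`: the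
2-pullback along `η` of the 1-morphism from a tangentad of vector fields of `Ξ X` to `Ξ X`. -/
def IsObjectOfVectorFields {X P : J} (U : P ⟶ X) : Prop :=
  ∃ (V : UniversalVectorField (S.Ξ.obj X)) (k : P ⟶ S.Inc.obj V.V),
    IsTwoPullback U k (S.η X) (S.Inc.map V.vf.G)

/-- `X` admits the extended construction of vector fields. -/
def AdmitsExtended (X : J) : Prop :=
  AdmitsVectorFields (S.Ξ.obj X) ∧ ∃ (P : J) (U : P ⟶ X), S.IsObjectOfVectorFields U

end PullbackExtensionContext

/-! ### Tangent restriction categories -/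

namespace TangentData

section Components

variable {X : RCat.{v, u}} (D : TangentData X) (M : X)

/-- The component `p_M`. -/
def projAt : D.T.obj M ⟶ M := D.p.app M

/-- The component `z_M`. -/
def zeroAt : M ⟶ D.T.obj M := D.z.app M

/-- The components of the projections of the fibre powers. -/
def prAt (n : ℕ) (i : Fin (n + 1)) : (D.pow n).obj M ⟶ D.T.obj M := (D.π n i).app M

/-- The component `s_M`. -/
def sumAt : (D.pow 1).obj M ⟶ D.T.obj M := D.s.app M

/-- The component `l_M`. -/
def liftAt : D.T.obj M ⟶ D.T.obj (D.T.obj M) := D.l.app M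

/-- The component `c_M`. -/
def flipAt : D.T.obj (D.T.obj M) ⟶ D.T.obj (D.T.obj M) := D.c.app M

/-- The additive bundle `(p_M, z_M, s_M)`. -/
@[simps]
def bundleAt : PreBundle X where
  B := M
  E := D.T.obj M
  E₂ := (D.pow 1).obj M
  q := D.projAt M
  z := D.zeroAt M
  π₁ := D.prAt M 1 0
  π₂ := D.prAt M 1 1
  s := D.sumAt M

end Components

/-- The axioms of a tangent restriction category. The tangent bundle functor is a restriction
functor and the structural natural transformations are total, since they are 1- and 2-cells
of `RCat`. -/
structure IsTangentRestriction {X : RCat.{v, u}} (D : TangentData X) : Prop where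
  bundle_additive : ∀ M, (D.bundleAt M).IsAdditive
  /-- The fibre powers of `p` are restriction limits, preserved by the iterates of `T`. -/
  pow_limit : ∀ (n m : ℕ) (M : X), IsRestrictionWidePullback
    (fun _ : Fin (n + 1) => (iter D.T m).map (D.projAt M))
    (fun i => (iter D.T m).map (D.prAt M n i))
  /-- `(z, l)` is an additive bundle morphism from `p` to `T p`. -/
  lift_additive : ∀ M, (D.bundleAt M).IsHom ((D.bundleAt M).map D.T.toFunctor)
    (D.zeroAt M) (D.liftAt M)
  /-- `(id, c)` is an additive bundle morphism from `T p` to `p_T`. -/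
  flip_additive : ∀ M, ((D.bundleAt M).map D.T.toFunctor).IsHom (D.bundleAt (D.T.obj M))
    (𝟙 (D.T.obj M)) (D.flipAt M)
  lift_coassoc : ∀ M, D.liftAt M ≫ D.T.map (D.liftAt M) = D.liftAt M ≫ D.liftAt (D.T.obj M)
  lift_flip : ∀ M, D.liftAt M ≫ D.flipAt M = D.liftAt M
  lift_flip_flip : ∀ M, D.liftAt (D.T.obj M) ≫ D.T.map (D.flipAt M) ≫ D.flipAt (D.T.obj M) =
    D.flipAt M ≫ D.T.map (D.liftAt M)
  flip_flip : ∀ M, D.flipAt M ≫ D.flipAt M = 𝟙 _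
  flip_braid : ∀ M, D.T.map (D.flipAt M) ≫ D.flipAt (D.T.obj M) ≫ D.T.map (D.flipAt M) =
    D.flipAt (D.T.obj M) ≫ D.T.map (D.flipAt M) ≫ D.flipAt (D.T.obj M)
  /-- Universality of the vertical lift. -/
  lift_universal : ∀ (M : X) (w : (D.pow 1).obj M ⟶ D.T.obj ((D.pow 1).obj M)),
    w ≫ D.T.map (D.prAt M 1 0) = D.prAt M 1 0 ≫ D.liftAt M →
    w ≫ D.T.map (D.prAt M 1 1) = D.prAt M 1 1 ≫ D.zeroAt (D.T.obj M) →
    IsRestrictionPullback (w ≫ D.T.map (D.sumAt M)) (D.prAt M 1 0 ≫ D.projAt M)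
      (D.T.map (D.projAt M)) (D.zeroAt M)

end TangentData

set_option linter.checkUnivs false in
/-- A tangent restriction category. -/
structure TangentRestrictionCategory extends TngPair RCat.{v, u} where
  isTangentRestriction : D.IsTangentRestriction

set_option linter.checkUnivs false in
/-- The 2-category of tangent restriction categories, lax tangent restriction functors (restriction
functors with a total lax distributive law) and total tangent natural transformations. -/
abbrev TngRCat := InducedBicategory (TngPair RCat.{v, u}) TangentRestrictionCategory.toTngPair

/-! Componentwise limits give limits in the Hom-categories of `RCat`. -/

theorem RCat.widePullback_of_components {X Y : RCat.{v, u}} {ι : Type w} [Nonempty ι]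
    {Q P : X ⟶ Y} {E : ι → (X ⟶ Y)} {q : ∀ i, E i ⟶ Q} {pr : ∀ i, P ⟶ E i}
    (H : ∀ A, IsWidePullbackCone (fun i => (q i).app A) (fun i => (pr i).app A)) :
    IsWidePullbackCone q pr := by
  refine ⟨fun i j => hom₂_ext fun A => (H A).comm i j, fun F x hx => ?_⟩
  choose h hh hu using fun A => (H A).lift (F.obj A) (fun i => (x i).app A) fun i j =>
    congr_app (hx i j) A
  obtain ⟨i₀⟩ := ‹Nonempty ι›
  refine ⟨{ app := h, naturality := fun A B f => ?_, total := fun A => ?_ }, fun i => ?_,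
    fun k hk => ?_⟩
  · obtain ⟨t, ht, hut⟩ := (H B).lift (F.obj A) (fun i => F.map f ≫ (x i).app B) fun i j => by
      have : (x i).app B ≫ (q i).app B = (x j).app B ≫ (q j).app B := congr_app (hx i j) B
      rw [Category.assoc, this, Category.assoc]
    rw [hut (F.map f ≫ h B) fun i => by rw [Category.assoc, hh], hut (h A ≫ P.map f) fun i => ?_]
    rw [Category.assoc, (pr i).naturality, ← Category.assoc, hh, (x i).naturality]
  · refine IsTotal.of_comp (g := (pr i₀).app A) ?_
    rw [hh]
    exact (x i₀).total A
  · exact hom₂_ext fun A => hh A i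
  · exact hom₂_ext fun A => hu A _ fun i => congr_app (hk i) A

theorem RCat.isPullback_of_components {X Y : RCat.{v, u}} {P A B D : X ⟶ Y} {fst : P ⟶ A}
    {snd : P ⟶ B} {f : A ⟶ D} {g : B ⟶ D}
    (H : ∀ M, IsPullback (fst.app M) (snd.app M) (f.app M) (g.app M)) :
    IsPullback fst snd f g := by
  have w : fst ≫ f = snd ≫ g := hom₂_ext fun M => (H M).w
  have key : ∀ (F : X ⟶ Y) (x : F ⟶ A) (y : F ⟶ B), x ≫ f = y ≫ g →
      ∃ k : F ⟶ P, k ≫ fst = x ∧ k ≫ snd = y := fun F x y hxy => by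
    have hxy' : ∀ M, x.app M ≫ f.app M = y.app M ≫ g.app M := fun M =>
      congr_app hxy M
    refine ⟨{ app := fun M => (H M).lift (x.app M) (y.app M) (hxy' M)
              naturality := fun M N a => (H N).hom_ext ?_ ?_
              total := fun M => IsTotal.of_comp (g := fst.app M) ?_ }, ?_, ?_⟩
    · rw [Category.assoc, Category.assoc, (H N).lift_fst, fst.naturality, (H M).lift_fst_assoc,
        x.naturality]
    · rw [Category.assoc, Category.assoc, (H N).lift_snd, snd.naturality, (H M).lift_snd_assoc,
        y.naturality]
    · rw [(H M).lift_fst]; exact x.total M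
    · exact hom₂_ext fun M => (H M).lift_fst _ _ _
    · exact hom₂_ext fun M => (H M).lift_snd _ _ _
  refine ⟨⟨w⟩, ⟨Limits.PullbackCone.IsLimit.mk w (fun s => (key s.pt s.fst s.snd s.condition).choose)
    (fun s => (key s.pt s.fst s.snd s.condition).choose_spec.1)
    (fun s => (key s.pt s.fst s.snd s.condition).choose_spec.2) fun s m h1 h2 => ?_⟩⟩
  refine hom₂_ext fun M => (H M).hom_ext ?_ ?_
  · have := h1.trans (key s.pt s.fst s.snd s.condition).choose_spec.1.symm
    exact congr_app this M
  · have := h2.trans (key s.pt s.fst s.snd s.condition).choose_spec.2.symm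
    exact congr_app this M

namespace TangentData.IsTangentRestriction

variable {X : RCat.{v, u}} {D : TangentData X}

theorem pow_limit' (h : D.IsTangentRestriction) (n m : ℕ) (M : X) : IsWidePullbackCone
    (fun _ : Fin (n + 1) => (iter D.T m).map (D.projAt M))
    (fun i => (iter D.T m).map (D.prAt M n i)) :=
  (isRestrictionWidePullback_iff fun _ => RCat.map_total _ (D.p.total M)).1 (h.pow_limit n m M)

theorem lift_universal' (h : D.IsTangentRestriction) (M : X) (w : (D.pow 1).obj M ⟶ D.T.obj ((D.pow 1).obj M))
    (h0 : w ≫ D.T.map (D.prAt M 1 0) = D.prAt M 1 0 ≫ D.liftAt M)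
    (h1 : w ≫ D.T.map (D.prAt M 1 1) = D.prAt M 1 1 ≫ D.zeroAt (D.T.obj M)) :
    IsPullback (w ≫ D.T.map (D.sumAt M)) (D.prAt M 1 0 ≫ D.projAt M)
      (D.T.map (D.projAt M)) (D.zeroAt M) :=
  (isRestrictionPullback_iff (RCat.map_total _ (D.p.total M)) (D.z.total M)).1
    (h.lift_universal M w h0 h1)

/-- A tangent restriction category is in particular a tangentad in `RCat`. -/
theorem isTangentad (h : D.IsTangentRestriction) : D.IsTangentad where
  bundle_additive :=
    { zero_proj := RCat.hom₂_ext fun M => (h.bundle_additive M).zero_proj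
      sum_proj := RCat.hom₂_ext fun M => (h.bundle_additive M).sum_proj
      sum_assoc := fun {A} u v w w' h1 h2 h3 h4 h5 => RCat.hom₂_ext fun M =>
        (h.bundle_additive M).sum_assoc (u.app M) (v.app M) (w.app M) (w'.app M)
          (RCat.congr_app h1 M) (RCat.congr_app h2 M) (RCat.congr_app h3 M)
          (RCat.congr_app h4 M) (RCat.congr_app h5 M)
      zero_sum := fun {A} u h1 => RCat.hom₂_ext fun M =>
        (h.bundle_additive M).zero_sum (u.app M) (RCat.congr_app h1 M)
      sum_comm := fun {A} u v h1 h2 => RCat.hom₂_ext fun M =>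
        (h.bundle_additive M).sum_comm (u.app M) (v.app M)
          (RCat.congr_app h1 M) (RCat.congr_app h2 M) }
  pow_limit n m Y F := RCat.widePullback_of_components fun A => h.pow_limit' n m (F.obj A)
  lift_additive :=
    { proj := RCat.hom₂_ext fun M => (h.lift_additive M).proj.trans
        (congrArg (D.projAt M ≫ ·) (Category.comp_id _).symm)
      zero := RCat.hom₂_ext fun M => (h.lift_additive M).zero.trans
        (congrArg (· ≫ D.T.map (D.zeroAt M)) (Category.comp_id _).symm)
      sum := fun {A} u u' h1 h2 => RCat.hom₂_ext fun M =>
        (h.lift_additive M).sum (u.app M) (u'.app M) (RCat.congr_app h1 M) (RCat.congr_app h2 M) }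
  flip_additive :=
    { proj := RCat.hom₂_ext fun M => (h.flip_additive M).proj.trans
        (congrArg (D.T.map (D.projAt M) ≫ ·) (Category.comp_id _).symm)
      zero := RCat.hom₂_ext fun M => (h.flip_additive M).zero.trans
        (congrArg (· ≫ D.zeroAt (D.T.obj M)) (Category.comp_id _).symm)
      sum := fun {A} u u' h1 h2 => RCat.hom₂_ext fun M =>
        (h.flip_additive M).sum (u.app M) (u'.app M) (RCat.congr_app h1 M) (RCat.congr_app h2 M) }
  lift_coassoc := RCat.hom₂_ext fun M => by
    have := h.lift_coassoc M
    simpa [projAt, zeroAt, prAt, sumAt, liftAt, flipAt] using this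
  lift_flip := RCat.hom₂_ext fun M => h.lift_flip M
  lift_flip_flip := RCat.hom₂_ext fun M => by
    have := h.lift_flip_flip M
    simpa [projAt, zeroAt, prAt, sumAt, liftAt, flipAt] using this
  flip_flip := RCat.hom₂_ext fun M => h.flip_flip M
  flip_braid := RCat.hom₂_ext fun M => by
    have := h.flip_braid M
    simpa [projAt, zeroAt, prAt, sumAt, liftAt, flipAt] using this
  lift_universal w h0 h1 Y F := RCat.isPullback_of_components fun A => by
    have := h.lift_universal' (F.obj A) (w.app (F.obj A)) (RCat.congr_app h0 _)
      (by have := RCat.congr_app h1 (F.obj A); simpa [projAt, zeroAt, prAt, sumAt, liftAt, flipAt] using this)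
    simpa [projAt, zeroAt, prAt, sumAt, liftAt, flipAt] using this

end TangentData.IsTangentRestriction

/-! ### Tangent split restriction categories are the tangentads in `sRCat` -/

namespace TangentData

/-- A tangent structure on a split restriction category, as one internal to `sRCat`. -/
@[simps]
def toSplit (X : sRCat.{v, u}) (D : TangentData X.toRCat) : TangentData X where
  T := D.T
  p := D.p
  pow := D.pow
  π := D.π
  z := D.z
  s := D.s
  l := D.l
  c := D.c

/-- A tangent structure internal to `sRCat`, as one internal to `RCat`. -/
@[simps]
def ofSplit {X : sRCat.{v, u}} (D : TangentData X) : TangentData X.toRCat where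
  T := D.T
  p := D.p
  pow := D.pow
  π := D.π
  z := D.z
  s := D.s
  l := D.l
  c := D.c

end TangentData

theorem iter_toSplit (X : sRCat.{v, u}) (T : X ⟶ X) (m : ℕ) :
    iter T m = iter (K := RCat.{v, u}) (X := X.toRCat) T m := by
  induction m with
  | zero => rfl
  | succ m ih => exact congrArg (fun S => S ≫ T) ih

theorem TangentData.IsTangentRestriction.toSplit {X : sRCat.{v, u}} {D : TangentData X.toRCat}
    (h : D.IsTangentRestriction) : (D.toSplit X).IsTangentad where
  bundle_additive :=
    { zero_proj := h.isTangentad.bundle_additive.zero_proj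
      sum_proj := h.isTangentad.bundle_additive.sum_proj
      sum_assoc := h.isTangentad.bundle_additive.sum_assoc
      zero_sum := h.isTangentad.bundle_additive.zero_sum
      sum_comm := h.isTangentad.bundle_additive.sum_comm }
  pow_limit n m Y F := by
    have := h.isTangentad.pow_limit n m (Y := Y.toRCat) F
    rw [← iter_toSplit] at this
    exact ⟨this.comm, this.lift⟩
  lift_additive :=
    { proj := h.isTangentad.lift_additive.proj
      zero := h.isTangentad.lift_additive.zero
      sum := h.isTangentad.lift_additive.sum }
  flip_additive :=
    { proj := h.isTangentad.flip_additive.proj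
      zero := h.isTangentad.flip_additive.zero
      sum := h.isTangentad.flip_additive.sum }
  lift_coassoc := h.isTangentad.lift_coassoc
  lift_flip := h.isTangentad.lift_flip
  lift_flip_flip := h.isTangentad.lift_flip_flip
  flip_flip := h.isTangentad.flip_flip
  flip_braid := h.isTangentad.flip_braid
  lift_universal w h0 h1 Y F := h.isTangentad.lift_universal w h0 h1 (Y := Y.toRCat) F

/-! The one-point category is used to read off componentwise statements. -/

/-- The point of the one-point category. -/
inductive Pt : Type u
  | pt

instance Pt.category : Category.{v} Pt.{u} where
  Hom _ _ := PUnit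
  id _ := ⟨⟩
  comp _ _ := ⟨⟩

/-- The one-point restriction category. -/
def ptCat : sRCat.{v, u} where
  carrier := Pt.{u}
  restr :=
    { rest := fun _ => PUnit.unit
      rest_comp_self := fun _ => rfl
      rest_comm := fun _ _ => rfl
      rest_rest_comp := fun _ _ => rfl
      comp_rest := fun _ _ => rfl }
  isSplit A e _ := ⟨A, ⟨⟩, ⟨⟩, rfl, rfl⟩

namespace RCat

variable {X : RCat.{v, u}}

/-- The functor from the one-point category at an object. -/
def const (M : X) : ptCat.{v, u}.toRCat ⟶ X :=
  { obj := fun _ => M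
    map := fun _ => 𝟙 M
    map_id := fun _ => rfl
    map_comp := fun _ _ => (Category.comp_id _).symm
    map_rest := fun _ => (rest_id M).symm }

/-- The transformation out of a constant functor with a given component. -/
def constHom {A : X} {G : ptCat.{v, u}.toRCat ⟶ X} (f : A ⟶ G.obj Pt.pt) (hf : IsTotal f) :
    const A ⟶ G :=
  { app := fun b => match b with
      | Pt.pt => f
    naturality := fun a b g => by
      cases a; cases b
      have : G.map g = 𝟙 (G.obj Pt.pt) := G.map_id Pt.pt
      change 𝟙 A ≫ f = f ≫ G.map g
      rw [this, Category.id_comp]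
      exact (Category.comp_id f).symm
    total := fun b => match b with
      | Pt.pt => hf }

theorem widePullback_of_total (hX : X.IsSplit) {ι : Type w} [Nonempty ι] {B P : X} {E : ι → X}
    {q : ∀ i, E i ⟶ B} {pr : ∀ i, P ⟶ E i} (hq : ∀ i, IsTotal (q i)) (hpr : ∀ i, IsTotal (pr i))
    (comm : ∀ i j, pr i ≫ q i = pr j ≫ q j)
    (H : ∀ (A : X) (x : ∀ i, A ⟶ E i), (∀ i, IsTotal (x i)) →
      (∀ i j, x i ≫ q i = x j ≫ q j) →
      ∃ h : A ⟶ P, (∀ i, h ≫ pr i = x i) ∧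
        ∀ k : A ⟶ P, IsTotal k → (∀ i, k ≫ pr i = x i) → k = h) :
    IsWidePullbackCone q pr := by
  refine ⟨comm, fun A x hx => ?_⟩
  obtain ⟨i₀⟩ := ‹Nonempty ι›
  have hdom : ∀ i, rest (x i) = rest (x i₀) := fun i => by
    rw [← (hq i).rest_comp (x i), hx i i₀, (hq i₀).rest_comp]
  obtain ⟨S, r, m, hrm, hmr⟩ := hX A (rest (x i₀)) (rest_rest _)
  have htot : ∀ {Y : X} (y : A ⟶ Y), rest y = rest (x i₀) → IsTotal (m ≫ y) := fun y hy => by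
    have h1 : rest (m ≫ y) ≫ m = m := by
      rw [← comp_rest, hy, ← hrm, ← Category.assoc, hmr, Category.id_comp]
    have : rest (m ≫ y) ≫ m ≫ r = m ≫ r := by rw [← Category.assoc, h1]
    rwa [hmr, Category.comp_id] at this
  obtain ⟨h, hh, hu⟩ := H S (fun i => m ≫ x i) (fun i => htot _ (hdom i)) fun i j => by
    rw [Category.assoc, hx i j, Category.assoc]
  refine ⟨r ≫ h, fun i => ?_, fun k hk => ?_⟩
  · rw [Category.assoc, hh, ← Category.assoc, hrm, ← hdom i, rest_comp_self]
  · have hrk : rest k = rest (x i₀) := by rw [← (hpr i₀).rest_comp k, hk]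
    rw [← hu (m ≫ k) (htot k hrk) fun i => by rw [Category.assoc, hk], ← Category.assoc, hrm,
      ← hrk, rest_comp_self]

theorem widePullback_of_const {Z : RCat.{v, u}} (hX : X.IsSplit) {ι : Type w} [Nonempty ι]
    {M : Z} {B P : Z ⟶ X} {E : ι → (Z ⟶ X)} {q : ∀ i, E i ⟶ B} {pr : ∀ i, P ⟶ E i}
    (H : IsWidePullbackCone (fun i => const M ◁ q i) (fun i => const M ◁ pr i)) :
    IsWidePullbackCone (fun i => (q i).app M) (fun i => (pr i).app M) := by
  refine widePullback_of_total hX (fun i => (q i).total M) (fun i => (pr i).total M)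
    (fun i j => congr_app (H.comm i j) Pt.pt) fun A x htot hx => ?_
  obtain ⟨k, hk, hu⟩ := H.lift (const A) (fun i => constHom (x i) (htot i))
    fun i j => hom₂_ext fun a => by
      cases a
      exact hx i j
  refine ⟨k.app Pt.pt, fun i => congr_app (hk i) Pt.pt, fun k' ht hk' => ?_⟩
  refine congr_app (hu (constHom k' ht) fun i => hom₂_ext fun a => ?_) Pt.pt
  cases a
  exact hk' i

theorem isPullback_of_const {Z : RCat.{v, u}} (hX : X.IsSplit) {M : Z} {P A B D : Z ⟶ X}
    {fst : P ⟶ A} {snd : P ⟶ B} {f : A ⟶ D} {g : B ⟶ D}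
    (H : IsPullback (const M ◁ fst) (const M ◁ snd) (const M ◁ f) (const M ◁ g)) :
    IsPullback (fst.app M) (snd.app M) (f.app M) (g.app M) := by
  rw [← isRestrictionPullback_iff (f.total M) (g.total M), IsRestrictionPullback,
    isRestrictionWidePullback_iff (fun b => by cases b; exacts [g.total M, f.total M])]
  have hw : fst.app M ≫ f.app M = snd.app M ≫ g.app M := congr_app H.w Pt.pt
  refine widePullback_of_total hX (fun b => by cases b; exacts [g.total M, f.total M])
    (fun b => by cases b; exacts [snd.total M, fst.total M]) ?_ fun C x htot hx => ?_
  · rintro (_ | _) (_ | _)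
    exacts [rfl, hw.symm, hw, rfl]
  · have e : (constHom (x true) (htot true) : const C ⟶ const M ≫ A) ≫ const M ◁ f =
        (constHom (x false) (htot false) : const C ⟶ const M ≫ B) ≫ const M ◁ g :=
      hom₂_ext fun a => by
        cases a
        exact hx true false
    refine ⟨(H.lift _ _ e).app Pt.pt, ?_, fun k ht hk => ?_⟩
    · rintro (_ | _)
      exacts [congr_app (H.lift_snd _ _ e) Pt.pt, congr_app (H.lift_fst _ _ e) Pt.pt]
    · refine congr_app (H.hom_ext (k := (constHom k ht : const C ⟶ const M ≫ P)) ?_ ?_) Pt.pt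
      · rw [H.lift_fst]
        refine hom₂_ext fun a => ?_
        cases a
        exact hk true
      · rw [H.lift_snd]
        refine hom₂_ext fun a => ?_
        cases a
        exact hk false

end RCat

theorem IsWidePullbackCone.hom_ext {C : Type u} [Category.{v} C] {ι : Type w} {B P : C} {E : ι → C}
    {q : ∀ i, E i ⟶ B} {pr : ∀ i, P ⟶ E i} (H : IsWidePullbackCone q pr) {A : C} {h k : A ⟶ P}
    (e : ∀ i, h ≫ pr i = k ≫ pr i) : h = k :=
  (H.lift A (fun i => k ≫ pr i) fun i j => by rw [Category.assoc, H.comm i j, Category.assoc]).unique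
    e fun _ => rfl

namespace TangentData.IsTangentad

variable {X : sRCat.{v, u}} {D : TangentData X}

theorem pow_limitAt (h : D.IsTangentad) (n m : ℕ) (M : X.toRCat) : IsWidePullbackCone
    (fun _ : Fin (n + 1) => (iter D.ofSplit.T m).map (D.ofSplit.projAt M))
    (fun i => (iter D.ofSplit.T m).map (D.ofSplit.prAt M n i)) := by
  have := h.pow_limit n m (Y := ptCat) (RCat.const M)
  rw [iter_toSplit] at this
  exact RCat.widePullback_of_const X.isSplit (M := M)
    (q := fun _ => D.ofSplit.p ▷ iter D.ofSplit.T m)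
    (pr := fun i => D.ofSplit.π n i ▷ iter D.ofSplit.T m) ⟨this.comm, this.lift⟩

theorem pow_limitAt₀ (h : D.IsTangentad) (n : ℕ) (M : X.toRCat) : IsWidePullbackCone
    (fun _ : Fin (n + 1) => D.ofSplit.projAt M) (fun i => D.ofSplit.prAt M n i) :=
  h.pow_limitAt n 0 M

theorem pow_limit_cell (h : D.IsTangentad) (n : ℕ) {Z : RCat.{v, u}} (F : Z ⟶ X.toRCat) : IsWidePullbackCone
    (fun _ : Fin (n + 1) => F ◁ D.ofSplit.p) (fun i => F ◁ D.ofSplit.π n i) :=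
  RCat.widePullback_of_components fun M => h.pow_limitAt₀ n (F.obj M)

theorem pow_limit_cell₀ (h : D.IsTangentad) (n : ℕ) : IsWidePullbackCone
    (fun _ : Fin (n + 1) => D.ofSplit.p) (fun i => D.ofSplit.π n i) :=
  RCat.widePullback_of_components fun M => h.pow_limitAt₀ n M

theorem exists_pair (h : D.IsTangentad) {n : ℕ} {F : X.toRCat ⟶ X.toRCat} (x : Fin (n + 1) → (F ⟶ D.ofSplit.T))
    (hx : ∀ i j, x i ≫ D.ofSplit.p = x j ≫ D.ofSplit.p) :
    ∃ a : F ⟶ D.ofSplit.pow n, ∀ i, a ≫ D.ofSplit.π n i = x i :=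
  ((h.pow_limit_cell₀ n).lift F x hx).exists

theorem sum_assocAt (h : D.IsTangentad) (M : X.toRCat) {A : X.toRCat} (u v w w' : A ⟶ (D.ofSplit.pow 1).obj M)
    (h1 : u ≫ D.ofSplit.prAt M 1 1 = v ≫ D.ofSplit.prAt M 1 0)
    (h2 : w ≫ D.ofSplit.prAt M 1 0 = u ≫ D.ofSplit.sumAt M)
    (h3 : w ≫ D.ofSplit.prAt M 1 1 = v ≫ D.ofSplit.prAt M 1 1)
    (h4 : w' ≫ D.ofSplit.prAt M 1 0 = u ≫ D.ofSplit.prAt M 1 0)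
    (h5 : w' ≫ D.ofSplit.prAt M 1 1 = v ≫ D.ofSplit.sumAt M) :
    w ≫ D.ofSplit.sumAt M = w' ≫ D.ofSplit.sumAt M := by
  have hp := (h.pow_limit_cell₀ 2).comm
  have hs : D.ofSplit.s ≫ D.ofSplit.p = D.ofSplit.π 1 0 ≫ D.ofSplit.p :=
    h.bundle_additive.sum_proj
  obtain ⟨u₀, hu₀⟩ := h.exists_pair (n := 1) ![D.ofSplit.π 2 0, D.ofSplit.π 2 1] (by
    intro i j; fin_cases i <;> fin_cases j <;> exact hp _ _)
  obtain ⟨v₀, hv₀⟩ := h.exists_pair (n := 1) ![D.ofSplit.π 2 1, D.ofSplit.π 2 2] (by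
    intro i j; fin_cases i <;> fin_cases j <;> exact hp _ _)
  have hu0 : u₀ ≫ D.ofSplit.π 1 0 = D.ofSplit.π 2 0 := hu₀ 0
  have hu1 : u₀ ≫ D.ofSplit.π 1 1 = D.ofSplit.π 2 1 := hu₀ 1
  have hv0 : v₀ ≫ D.ofSplit.π 1 0 = D.ofSplit.π 2 1 := hv₀ 0
  have hv1 : v₀ ≫ D.ofSplit.π 1 1 = D.ofSplit.π 2 2 := hv₀ 1
  have e1 : (u₀ ≫ D.ofSplit.s) ≫ D.ofSplit.p = D.ofSplit.π 2 2 ≫ D.ofSplit.p := by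
    rw [Category.assoc, hs, ← Category.assoc, hu0]; exact hp _ _
  have e2 : (v₀ ≫ D.ofSplit.s) ≫ D.ofSplit.p = D.ofSplit.π 2 0 ≫ D.ofSplit.p := by
    rw [Category.assoc, hs, ← Category.assoc, hv0]; exact hp _ _
  obtain ⟨w₀, hw₀⟩ := h.exists_pair (n := 1) ![u₀ ≫ D.ofSplit.s, D.ofSplit.π 2 2] (by
    intro i j; fin_cases i <;> fin_cases j
    exacts [rfl, e1, e1.symm, rfl])
  obtain ⟨w₁, hw₁⟩ := h.exists_pair (n := 1) ![D.ofSplit.π 2 0, v₀ ≫ D.ofSplit.s] (by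
    intro i j; fin_cases i <;> fin_cases j
    exacts [rfl, e2.symm, e2, rfl])
  have key : w₀ ≫ D.ofSplit.s = w₁ ≫ D.ofSplit.s :=
    h.bundle_additive.sum_assoc u₀ v₀ w₀ w₁ (hu1.trans hv0.symm) (hw₀ 0) ((hw₀ 1).trans hv1.symm)
      ((hw₁ 0).trans hu0.symm) (hw₁ 1)
  have L := h.pow_limitAt₀ 1 M
  have c01 := L.comm 0 1
  have a1 : (u ≫ D.ofSplit.prAt M 1 0) ≫ D.ofSplit.projAt M =
      (u ≫ D.ofSplit.prAt M 1 1) ≫ D.ofSplit.projAt M := by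
    rw [Category.assoc, c01, Category.assoc]
  have a2 : (v ≫ D.ofSplit.prAt M 1 0) ≫ D.ofSplit.projAt M =
      (v ≫ D.ofSplit.prAt M 1 1) ≫ D.ofSplit.projAt M := by
    rw [Category.assoc, c01, Category.assoc]
  have a3 := a1.trans ((congrArg (· ≫ D.ofSplit.projAt M) h1).trans a2)
  have a4 := (congrArg (· ≫ D.ofSplit.projAt M) h1).trans a2
  obtain ⟨t, ht, -⟩ := (h.pow_limitAt₀ 2 M).lift A
    ![u ≫ D.ofSplit.prAt M 1 0, u ≫ D.ofSplit.prAt M 1 1, v ≫ D.ofSplit.prAt M 1 1] (by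
      intro i j; fin_cases i <;> fin_cases j
      exacts [rfl, a1, a3, a1.symm, rfl, a4, a3.symm, a4.symm, rfl])
  have t0 : t ≫ (D.ofSplit.π 2 0).app M = u ≫ (D.ofSplit.π 1 0).app M := ht 0
  have t1 : t ≫ (D.ofSplit.π 2 1).app M = u ≫ (D.ofSplit.π 1 1).app M := ht 1
  have t2 : t ≫ (D.ofSplit.π 2 2).app M = v ≫ (D.ofSplit.π 1 1).app M := ht 2
  have cu0 := RCat.congr_app hu0 M
  have cu1 := RCat.congr_app hu1 M
  have cv0 := RCat.congr_app hv0 M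
  have cv1 := RCat.congr_app hv1 M
  have cw0 := RCat.congr_app (hw₀ 0) M
  have cw1 := RCat.congr_app (hw₀ 1) M
  have cx0 := RCat.congr_app (hw₁ 0) M
  have cx1 := RCat.congr_app (hw₁ 1) M
  have hu : t ≫ u₀.app M = u := L.hom_ext fun i => by
    fin_cases i
    · exact (Category.assoc _ _ _).trans ((congrArg (t ≫ ·) cu0).trans t0)
    · exact (Category.assoc _ _ _).trans ((congrArg (t ≫ ·) cu1).trans t1)
  have hv : t ≫ v₀.app M = v := L.hom_ext fun i => by
    fin_cases i
    · exact (Category.assoc _ _ _).trans ((congrArg (t ≫ ·) cv0).trans (t1.trans h1))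
    · exact (Category.assoc _ _ _).trans ((congrArg (t ≫ ·) cv1).trans t2)
  have hw : t ≫ w₀.app M = w := L.hom_ext fun i => by
    fin_cases i
    · refine (Category.assoc _ _ _).trans ((congrArg (t ≫ ·) cw0).trans ?_)
      exact (Category.assoc _ _ _).symm.trans ((congrArg (· ≫ D.ofSplit.s.app M) hu).trans h2.symm)
    · exact (Category.assoc _ _ _).trans ((congrArg (t ≫ ·) cw1).trans (t2.trans h3.symm))
  have hx : t ≫ w₁.app M = w' := L.hom_ext fun i => by
    fin_cases i
    · exact (Category.assoc _ _ _).trans ((congrArg (t ≫ ·) cx0).trans (t0.trans h4.symm))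
    · refine (Category.assoc _ _ _).trans ((congrArg (t ≫ ·) cx1).trans ?_)
      exact (Category.assoc _ _ _).symm.trans ((congrArg (· ≫ D.ofSplit.s.app M) hv).trans h5.symm)
  rw [← hw, ← hx]
  exact (Category.assoc _ _ _).trans ((congrArg (t ≫ ·) (RCat.congr_app key M)).trans
    (Category.assoc _ _ _).symm)

theorem zero_sumAt (h : D.IsTangentad) (M : X.toRCat) {A : X.toRCat} (u : A ⟶ (D.ofSplit.pow 1).obj M)
    (h1 : u ≫ D.ofSplit.prAt M 1 0 =
      u ≫ D.ofSplit.prAt M 1 1 ≫ D.ofSplit.projAt M ≫ D.ofSplit.zeroAt M) :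
    u ≫ D.ofSplit.sumAt M = u ≫ D.ofSplit.prAt M 1 1 := by
  have hz : D.ofSplit.z ≫ D.ofSplit.p = 𝟙 (𝟙 X.toRCat) := h.bundle_additive.zero_proj
  have e : (D.ofSplit.p ≫ D.ofSplit.z) ≫ D.ofSplit.p = 𝟙 D.ofSplit.T ≫ D.ofSplit.p := by
    rw [Category.assoc, hz, Category.comp_id, Category.id_comp]
  obtain ⟨u₀, hu₀⟩ := h.exists_pair (n := 1) ![D.ofSplit.p ≫ D.ofSplit.z, 𝟙 D.ofSplit.T] (by
    intro i j; fin_cases i <;> fin_cases j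
    exacts [rfl, e, e.symm, rfl])
  have hu0 : u₀ ≫ D.ofSplit.π 1 0 = D.ofSplit.p ≫ D.ofSplit.z := hu₀ 0
  have hu1 : u₀ ≫ D.ofSplit.π 1 1 = 𝟙 D.ofSplit.T := hu₀ 1
  have key : u₀ ≫ D.ofSplit.s = u₀ ≫ D.ofSplit.π 1 1 := h.bundle_additive.zero_sum u₀ (by
    change u₀ ≫ D.ofSplit.π 1 0 = u₀ ≫ D.ofSplit.π 1 1 ≫ D.ofSplit.p ≫ D.ofSplit.z
    rw [hu0, ← Category.assoc, hu1, Category.id_comp])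
  rw [hu1] at key
  have hu : (u ≫ D.ofSplit.prAt M 1 1) ≫ u₀.app M = u :=
    (h.pow_limitAt₀ 1 M).hom_ext fun i => by
      fin_cases i
      · refine (Category.assoc _ _ _).trans
          ((congrArg ((u ≫ D.ofSplit.prAt M 1 1) ≫ ·) (RCat.congr_app hu0 M)).trans ?_)
        exact (Category.assoc _ _ _).trans h1.symm
      · refine (Category.assoc _ _ _).trans
          ((congrArg ((u ≫ D.ofSplit.prAt M 1 1) ≫ ·) (RCat.congr_app hu1 M)).trans ?_)
        exact Category.comp_id _
  conv_lhs => rw [← hu]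
  exact (Category.assoc _ _ _).trans ((congrArg ((u ≫ D.ofSplit.prAt M 1 1) ≫ ·)
    (RCat.congr_app key M)).trans (Category.comp_id _))

theorem sum_commAt (h : D.IsTangentad) (M : X.toRCat) {A : X.toRCat} (u v : A ⟶ (D.ofSplit.pow 1).obj M)
    (h1 : u ≫ D.ofSplit.prAt M 1 0 = v ≫ D.ofSplit.prAt M 1 1)
    (h2 : u ≫ D.ofSplit.prAt M 1 1 = v ≫ D.ofSplit.prAt M 1 0) :
    u ≫ D.ofSplit.sumAt M = v ≫ D.ofSplit.sumAt M := by
  have hp := (h.pow_limit_cell₀ 1).comm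
  obtain ⟨τ, hτ⟩ := h.exists_pair (n := 1) ![D.ofSplit.π 1 1, D.ofSplit.π 1 0] (by
    intro i j; fin_cases i <;> fin_cases j <;> exact hp _ _)
  have h0 : τ ≫ D.ofSplit.π 1 0 = D.ofSplit.π 1 1 := hτ 0
  have h1' : τ ≫ D.ofSplit.π 1 1 = D.ofSplit.π 1 0 := hτ 1
  have key : τ ≫ D.ofSplit.s = 𝟙 _ ≫ D.ofSplit.s := h.bundle_additive.sum_comm τ (𝟙 _)
    (h0.trans (Category.id_comp _).symm) (h1'.trans (Category.id_comp _).symm)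
  have hu : v ≫ τ.app M = u := (h.pow_limitAt₀ 1 M).hom_ext fun i => by
    fin_cases i
    · exact (Category.assoc _ _ _).trans
        ((congrArg (v ≫ ·) (RCat.congr_app h0 M)).trans h1.symm)
    · exact (Category.assoc _ _ _).trans
        ((congrArg (v ≫ ·) (RCat.congr_app h1' M)).trans h2.symm)
  rw [← hu]
  exact (Category.assoc _ _ _).trans ((congrArg (v ≫ ·) (RCat.congr_app key M)).trans
    (congrArg (v ≫ ·) (Category.id_comp _)))

end TangentData.IsTangentad

namespace TangentData.IsTangentad

variable {X : sRCat.{v, u}} {D : TangentData X}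

theorem pow_limitAt₁ (h : D.IsTangentad) (n : ℕ) (M : X.toRCat) : IsWidePullbackCone
    (fun _ : Fin (n + 1) => D.ofSplit.T.map (D.ofSplit.projAt M))
    (fun i => D.ofSplit.T.map (D.ofSplit.prAt M n i)) :=
  h.pow_limitAt n 1 M

theorem lift_sumAt (h : D.IsTangentad) (M : X.toRCat) {A : X.toRCat} (u : A ⟶ (D.ofSplit.pow 1).obj M)
    (u' : A ⟶ D.ofSplit.T.obj ((D.ofSplit.pow 1).obj M))
    (h0 : u' ≫ D.ofSplit.T.map (D.ofSplit.prAt M 1 0) =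
      u ≫ D.ofSplit.prAt M 1 0 ≫ D.ofSplit.liftAt M)
    (h1 : u' ≫ D.ofSplit.T.map (D.ofSplit.prAt M 1 1) =
      u ≫ D.ofSplit.prAt M 1 1 ≫ D.ofSplit.liftAt M) :
    u' ≫ D.ofSplit.T.map (D.ofSplit.sumAt M) = u ≫ D.ofSplit.sumAt M ≫ D.ofSplit.liftAt M := by
  have hL : IsWidePullbackCone (fun _ : Fin 2 => D.ofSplit.p ▷ D.ofSplit.T)
      (fun i => D.ofSplit.π 1 i ▷ D.ofSplit.T) :=
    RCat.widePullback_of_components fun M => h.pow_limitAt₁ 1 M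
  have hl : ∀ N : X.toRCat, D.ofSplit.l.app N ≫ D.ofSplit.T.map (D.ofSplit.p.app N) =
      D.ofSplit.p.app N ≫ D.ofSplit.z.app N := fun N =>
    (RCat.congr_app h.lift_additive.proj N).trans
      (congrArg (D.ofSplit.p.app N ≫ ·) (Category.comp_id _))
  obtain ⟨τ, hτ, -⟩ := hL.lift (D.ofSplit.pow 1) (fun i => D.ofSplit.π 1 i ≫ D.ofSplit.l)
    fun i j => RCat.hom₂_ext fun N => by
      have e : ∀ i, ((D.ofSplit.π 1 i).app N ≫ D.ofSplit.l.app N) ≫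
          D.ofSplit.T.map (D.ofSplit.p.app N) =
          ((D.ofSplit.π 1 i).app N ≫ D.ofSplit.p.app N) ≫ D.ofSplit.z.app N := fun i => by
        rw [Category.assoc, hl, Category.assoc]
      exact (e i).trans ((congrArg (· ≫ D.ofSplit.z.app N)
        ((h.pow_limitAt₀ 1 N).comm i j)).trans (e j).symm)
  have key : τ ≫ D.ofSplit.s ▷ D.ofSplit.T = 𝟙 _ ≫ D.ofSplit.s ≫ D.ofSplit.l :=
    h.lift_additive.sum (𝟙 _) τ ((hτ 0).trans (Category.id_comp _).symm)
      ((hτ 1).trans (Category.id_comp _).symm)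
  have hu : u ≫ τ.app M = u' := (h.pow_limitAt₁ 1 M).hom_ext fun i => by
    refine (Category.assoc _ _ _).trans ((congrArg (u ≫ ·) (RCat.congr_app (hτ i) M)).trans ?_)
    fin_cases i
    exacts [h0.symm, h1.symm]
  rw [← hu]
  exact (Category.assoc _ _ _).trans ((congrArg (u ≫ ·) (RCat.congr_app key M)).trans
    (congrArg (u ≫ ·) (Category.id_comp _)))

theorem flip_sumAt (h : D.IsTangentad) (M : X.toRCat) {A : X.toRCat}
    (u : A ⟶ D.ofSplit.T.obj ((D.ofSplit.pow 1).obj M))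
    (u' : A ⟶ (D.ofSplit.pow 1).obj (D.ofSplit.T.obj M))
    (h0 : u' ≫ D.ofSplit.prAt (D.ofSplit.T.obj M) 1 0 =
      u ≫ D.ofSplit.T.map (D.ofSplit.prAt M 1 0) ≫ D.ofSplit.flipAt M)
    (h1 : u' ≫ D.ofSplit.prAt (D.ofSplit.T.obj M) 1 1 =
      u ≫ D.ofSplit.T.map (D.ofSplit.prAt M 1 1) ≫ D.ofSplit.flipAt M) :
    u' ≫ D.ofSplit.sumAt (D.ofSplit.T.obj M) =
      u ≫ D.ofSplit.T.map (D.ofSplit.sumAt M) ≫ D.ofSplit.flipAt M := by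
  have hl : ∀ N : X.toRCat, D.ofSplit.c.app N ≫ D.ofSplit.p.app (D.ofSplit.T.obj N) =
      D.ofSplit.T.map (D.ofSplit.p.app N) := fun N =>
    (RCat.congr_app h.flip_additive.proj N).trans
      ((congrArg (D.ofSplit.T.map (D.ofSplit.p.app N) ≫ ·) (Category.comp_id _)).trans
        (Category.comp_id _))
  obtain ⟨τ, hτ, -⟩ := (h.pow_limit_cell 1 D.ofSplit.T).lift (D.ofSplit.pow 1 ≫ D.ofSplit.T)
    (fun i => D.ofSplit.π 1 i ▷ D.ofSplit.T ≫ D.ofSplit.c)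
    fun i j => RCat.hom₂_ext fun N => by
      have e : ∀ i, (D.ofSplit.T.map ((D.ofSplit.π 1 i).app N) ≫ D.ofSplit.c.app N) ≫
          D.ofSplit.p.app (D.ofSplit.T.obj N) = D.ofSplit.T.map ((D.ofSplit.π 1 i).app N) ≫
            D.ofSplit.T.map (D.ofSplit.p.app N) := fun i => by
        rw [Category.assoc, hl]
      exact (e i).trans (((h.pow_limitAt₁ 1 N).comm i j).trans (e j).symm)
  have key : τ ≫ D.ofSplit.T ◁ D.ofSplit.s =
      𝟙 (D.ofSplit.pow 1 ≫ D.ofSplit.T) ≫ D.ofSplit.s ▷ D.ofSplit.T ≫ D.ofSplit.c :=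
    h.flip_additive.sum (𝟙 _) τ ((hτ 0).trans (Category.id_comp _).symm)
      ((hτ 1).trans (Category.id_comp _).symm)
  have hu : u ≫ τ.app M = u' := (h.pow_limitAt₀ 1 (D.ofSplit.T.obj M)).hom_ext fun i => by
    refine (Category.assoc _ _ _).trans ((congrArg (u ≫ ·) (RCat.congr_app (hτ i) M)).trans ?_)
    fin_cases i
    exacts [h0.symm, h1.symm]
  rw [← hu]
  exact (Category.assoc _ _ _).trans ((congrArg (u ≫ ·) (RCat.congr_app key M)).trans
    (congrArg (u ≫ ·) (Category.id_comp _)))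

theorem lift_universalAt (h : D.IsTangentad) (M : X.toRCat)
    (w : (D.ofSplit.pow 1).obj M ⟶ D.ofSplit.T.obj ((D.ofSplit.pow 1).obj M))
    (h0 : w ≫ D.ofSplit.T.map (D.ofSplit.prAt M 1 0) =
      D.ofSplit.prAt M 1 0 ≫ D.ofSplit.liftAt M)
    (h1 : w ≫ D.ofSplit.T.map (D.ofSplit.prAt M 1 1) =
      D.ofSplit.prAt M 1 1 ≫ D.ofSplit.zeroAt (D.ofSplit.T.obj M)) :
    IsPullback (w ≫ D.ofSplit.T.map (D.ofSplit.sumAt M))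
      (D.ofSplit.prAt M 1 0 ≫ D.ofSplit.projAt M) (D.ofSplit.T.map (D.ofSplit.projAt M))
      (D.ofSplit.zeroAt M) := by
  have hL : IsWidePullbackCone (fun _ : Fin 2 => D.ofSplit.p ▷ D.ofSplit.T)
      (fun i => D.ofSplit.π 1 i ▷ D.ofSplit.T) :=
    RCat.widePullback_of_components fun M => h.pow_limitAt₁ 1 M
  let x₁ : D.ofSplit.T ⟶ D.ofSplit.T ≫ D.ofSplit.T :=
    (ρ_ D.ofSplit.T).inv ≫ D.ofSplit.T ◁ D.ofSplit.z
  have hx₁ : ∀ N, x₁.app N = D.ofSplit.z.app (D.ofSplit.T.obj N) := fun N => Category.id_comp _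
  have hz : ∀ N, D.ofSplit.z.app N ≫ D.ofSplit.p.app N = 𝟙 _ := fun N =>
    RCat.congr_app h.bundle_additive.zero_proj N
  have hl : ∀ N : X.toRCat, D.ofSplit.l.app N ≫ D.ofSplit.T.map (D.ofSplit.p.app N) =
      D.ofSplit.p.app N ≫ D.ofSplit.z.app N := fun N =>
    (RCat.congr_app h.lift_additive.proj N).trans
      (congrArg (D.ofSplit.p.app N ≫ ·) (Category.comp_id _))
  have hzp : ∀ N : X.toRCat, D.ofSplit.z.app (D.ofSplit.T.obj N) ≫
      D.ofSplit.T.map (D.ofSplit.p.app N) = D.ofSplit.p.app N ≫ D.ofSplit.z.app N := fun N =>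
    (D.ofSplit.z.naturality (D.ofSplit.p.app N)).symm
  have ec : ∀ N, ((D.ofSplit.π 1 0).app N ≫ D.ofSplit.l.app N) ≫
      D.ofSplit.T.map (D.ofSplit.p.app N) = ((D.ofSplit.π 1 1).app N ≫ x₁.app N) ≫
      D.ofSplit.T.map (D.ofSplit.p.app N) := fun N => by
    rw [Category.assoc, hl, Category.assoc, hx₁, hzp, ← Category.assoc, ← Category.assoc]
    exact congrArg (· ≫ D.ofSplit.z.app N) ((h.pow_limitAt₀ 1 N).comm 0 1)
  obtain ⟨τ, hτ, -⟩ := hL.lift (D.ofSplit.pow 1) ![D.ofSplit.π 1 0 ≫ D.ofSplit.l,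
      D.ofSplit.π 1 1 ≫ x₁] fun i j => RCat.hom₂_ext fun N => by
    fin_cases i <;> fin_cases j
    exacts [rfl, ec N, (ec N).symm, rfl]
  have hw : τ.app M = w := (h.pow_limitAt₁ 1 M).hom_ext fun i => by
    refine (RCat.congr_app (hτ i) M).trans ?_
    fin_cases i
    · exact h0.symm
    · exact (congrArg ((D.ofSplit.π 1 1).app M ≫ ·) (hx₁ M)).trans h1.symm
  have := RCat.isPullback_of_const X.isSplit (M := M)
    (fst := τ ≫ D.ofSplit.s ▷ D.ofSplit.T) (snd := D.ofSplit.π 1 0 ≫ D.ofSplit.p)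
    (f := D.ofSplit.p ▷ D.ofSplit.T ≫ (λ_ D.ofSplit.T).hom) (g := D.ofSplit.z)
    (h.lift_universal τ (hτ 0) (hτ 1) (Y := ptCat) (RCat.const M))
  rw [← hw]
  have e : (D.ofSplit.p ▷ D.ofSplit.T ≫ (λ_ D.ofSplit.T).hom).app M =
      D.ofSplit.T.map (D.ofSplit.projAt M) := Category.comp_id _
  rw [e] at this
  exact this

/-- A tangentad in `sRCat` is a tangent restriction category. -/
theorem ofSplit (h : D.IsTangentad) : D.ofSplit.IsTangentRestriction where
  bundle_additive M :=
    { zero_proj := RCat.congr_app h.bundle_additive.zero_proj M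
      sum_proj := RCat.congr_app h.bundle_additive.sum_proj M
      sum_assoc := h.sum_assocAt M
      zero_sum := h.zero_sumAt M
      sum_comm := h.sum_commAt M }
  pow_limit n m M := (isRestrictionWidePullback_iff fun _ =>
    RCat.map_total _ (D.ofSplit.p.total M)).2 (h.pow_limitAt n m M)
  lift_additive M :=
    { proj := (RCat.congr_app h.lift_additive.proj M).trans
        (congrArg (D.ofSplit.p.app M ≫ ·) (Category.comp_id _))
      zero := (RCat.congr_app h.lift_additive.zero M).trans
        (congrArg (· ≫ D.ofSplit.T.map (D.ofSplit.z.app M)) (Category.comp_id _))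
      sum := h.lift_sumAt M }
  flip_additive M :=
    { proj := (RCat.congr_app h.flip_additive.proj M).trans
        (congrArg (D.ofSplit.T.map (D.ofSplit.p.app M) ≫ ·) (Category.comp_id _))
      zero := (RCat.congr_app h.flip_additive.zero M).trans
        (congrArg (· ≫ D.ofSplit.z.app (D.ofSplit.T.obj M)) (Category.comp_id _))
      sum := h.flip_sumAt M }
  lift_coassoc M := (RCat.congr_app h.lift_coassoc M).trans
    (congrArg (D.ofSplit.l.app M ≫ ·) (Category.comp_id _))
  lift_flip M := RCat.congr_app h.lift_flip M
  lift_flip_flip M := by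
    have e : D.ofSplit.T ◁ D.ofSplit.l ≫ (α_ D.ofSplit.T D.ofSplit.T D.ofSplit.T).inv ≫
        D.ofSplit.c ▷ D.ofSplit.T ≫ (α_ D.ofSplit.T D.ofSplit.T D.ofSplit.T).hom ≫
        D.ofSplit.T ◁ D.ofSplit.c =
        D.ofSplit.c ≫ D.ofSplit.l ▷ D.ofSplit.T ≫
        (α_ D.ofSplit.T D.ofSplit.T D.ofSplit.T).hom := h.lift_flip_flip
    have := RCat.congr_app e M
    simpa [projAt, zeroAt, prAt, sumAt, liftAt, flipAt, -ofSplit_T, -ofSplit_c, -ofSplit_l]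
      using this
  flip_flip M := RCat.congr_app h.flip_flip M
  flip_braid M := by
    have e : D.ofSplit.c ▷ D.ofSplit.T ≫ (α_ D.ofSplit.T D.ofSplit.T D.ofSplit.T).hom ≫
        D.ofSplit.T ◁ D.ofSplit.c ≫ (α_ D.ofSplit.T D.ofSplit.T D.ofSplit.T).inv ≫
        D.ofSplit.c ▷ D.ofSplit.T ≫ (α_ D.ofSplit.T D.ofSplit.T D.ofSplit.T).hom =
        (α_ D.ofSplit.T D.ofSplit.T D.ofSplit.T).hom ≫ D.ofSplit.T ◁ D.ofSplit.c ≫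
        (α_ D.ofSplit.T D.ofSplit.T D.ofSplit.T).inv ≫ D.ofSplit.c ▷ D.ofSplit.T ≫
        (α_ D.ofSplit.T D.ofSplit.T D.ofSplit.T).hom ≫ D.ofSplit.T ◁ D.ofSplit.c := h.flip_braid
    have := RCat.congr_app e M
    simpa [projAt, zeroAt, prAt, sumAt, liftAt, flipAt, -ofSplit_T, -ofSplit_c, -ofSplit_l]
      using this
  lift_universal M w h0 h1 :=
    (isRestrictionPullback_iff (RCat.map_total _ (D.ofSplit.p.total M)) (D.ofSplit.z.total M)).2
      (h.lift_universalAt M w h0 h1)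

end TangentData.IsTangentad

/-! ### Splitting the restriction idempotents -/

/-- The objects of the split completion: the restriction idempotents. -/
structure SplitObj (X : RCat.{v, u}) where
  A : X
  e : A ⟶ A
  rest_e : rest e = e

/-- The morphisms of the split completion. -/
@[ext]
structure SplitHom {X : RCat.{v, u}} (P Q : SplitObj X) where
  f : P.A ⟶ Q.A
  left : P.e ≫ f = f
  right : f ≫ Q.e = f

theorem SplitObj.e_idem {X : RCat.{v, u}} (P : SplitObj X) : P.e ≫ P.e = P.e := by
  have := rest_idem P.e
  rwa [P.rest_e] at this

@[simps id_f comp_f]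
instance {X : RCat.{v, u}} : Category (SplitObj X) where
  Hom P Q := SplitHom P Q
  id P := ⟨P.e, P.e_idem, P.e_idem⟩
  comp g k := ⟨g.f ≫ k.f, by rw [← Category.assoc, g.left], by rw [Category.assoc, k.right]⟩
  id_comp g := SplitHom.ext g.left
  comp_id g := SplitHom.ext g.right
  assoc g k l := SplitHom.ext (Category.assoc _ _ _)

theorem SplitHom.left_rest {X : RCat.{v, u}} {P Q : SplitObj X} (g : SplitHom P Q) :
    P.e ≫ rest g.f = rest g.f := by
  conv_lhs => rw [← P.rest_e, ← rest_rest_comp, P.rest_e, g.left]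

@[simps rest_f]
instance {X : RCat.{v, u}} : RestrictionCategory (SplitObj X) where
  rest {P _} g := ⟨rest g.f, g.left_rest, by
    have := g.left_rest
    rwa [← P.rest_e, rest_comm, P.rest_e] at this⟩
  rest_comp_self g := SplitHom.ext (rest_comp_self g.f)
  rest_comm g k := SplitHom.ext (rest_comm g.f k.f)
  rest_rest_comp g k := SplitHom.ext (rest_rest_comp g.f k.f)
  comp_rest g k := SplitHom.ext (comp_rest g.f k.f)

/-- The split completion of a restriction category. -/
abbrev splitCompletion (X : RCat.{v, u}) : sRCat.{v, max u v} where
  carrier := SplitObj X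
  isSplit P e he := by
    have he' : rest e.f = e.f := congrArg SplitHom.f he
    have hi : e.f ≫ e.f = e.f := by
      have := rest_idem e.f
      rwa [he'] at this
    exact ⟨⟨P.A, e.f, he'⟩, ⟨e.f, e.left, hi⟩, ⟨e.f, hi, e.right⟩, SplitHom.ext hi, SplitHom.ext hi⟩

/-- The split completion of a restriction functor. -/
abbrev splitMap {X Y : RCat.{v, u}} (F : X ⟶ Y) :
    (splitCompletion X).toRCat ⟶ (splitCompletion Y).toRCat :=
  { obj := fun P => ⟨F.obj P.A, F.map P.e, by rw [← F.map_rest, P.rest_e]⟩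
    map := fun g => ⟨F.map g.f, by rw [← F.map_comp, g.left], by rw [← F.map_comp, g.right]⟩
    map_id := fun _ => rfl
    map_comp := fun g k => SplitHom.ext (F.map_comp g.f k.f)
    map_rest := fun g => SplitHom.ext (F.map_rest g.f) }

/-- The split completion of a total natural transformation. -/
def splitMap₂ {X Y : RCat.{v, u}} {F G : X ⟶ Y} (a : F ⟶ G) : splitMap F ⟶ splitMap G :=
  { app := fun P => ⟨F.map P.e ≫ a.app P.A,
      by rw [← Category.assoc, ← F.map_comp, P.e_idem],
      by
        change (_ ≫ _) ≫ G.map P.e = _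
        rw [Category.assoc, ← a.naturality, ← Category.assoc, ← F.map_comp, P.e_idem]⟩
    naturality := fun P Q g => SplitHom.ext (by
      change F.map g.f ≫ F.map Q.e ≫ a.app Q.A = (F.map P.e ≫ a.app P.A) ≫ G.map g.f
      rw [← Category.assoc, ← F.map_comp, g.right, Category.assoc, ← a.naturality,
        ← Category.assoc, ← F.map_comp, g.left])
    total := fun P => SplitHom.ext (by
      change rest (F.map P.e ≫ a.app P.A) = F.map P.e
      rw [(a.total P.A).rest_comp, ← F.map_rest, P.rest_e]) }

section SplitLemmas

variable {X Y Z : RCat.{v, u}}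

theorem splitMap₂_f {F G : X ⟶ Y} (a : F ⟶ G) (P : SplitObj X) :
    ((splitMap₂ a).app P).f = F.map P.e ≫ a.app P.A := rfl

theorem splitMap_comp (F : X ⟶ Y) (G : Y ⟶ Z) : splitMap (F ≫ G) = splitMap F ≫ splitMap G := rfl

theorem splitMap_id : splitMap (𝟙 X) = 𝟙 (splitCompletion X).toRCat := rfl

theorem splitMap₂_id (F : X ⟶ Y) : splitMap₂ (𝟙 F) = 𝟙 (splitMap F) :=
  RCat.hom₂_ext fun _ => SplitHom.ext (Category.comp_id _)

theorem splitMap₂_comp {F G H : X ⟶ Y} (a : F ⟶ G) (b : G ⟶ H) :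
    splitMap₂ (a ≫ b) = splitMap₂ a ≫ splitMap₂ b :=
  RCat.hom₂_ext fun P => SplitHom.ext (by
    change F.map P.e ≫ a.app P.A ≫ b.app P.A = (F.map P.e ≫ a.app P.A) ≫ G.map P.e ≫ b.app P.A
    rw [Category.assoc, ← Category.assoc (a.app P.A), ← a.naturality, Category.assoc,
      ← Category.assoc (F.map P.e) (F.map P.e), ← F.map_comp, P.e_idem])

theorem splitMap₂_whiskerLeft (F : X ⟶ Y) {G H : Y ⟶ Z} (a : G ⟶ H) :
    splitMap₂ (F ◁ a) = splitMap F ◁ splitMap₂ a := rfl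

theorem splitMap₂_whiskerRight {F G : X ⟶ Y} (a : F ⟶ G) (H : Y ⟶ Z) :
    splitMap₂ (a ▷ H) = splitMap₂ a ▷ splitMap H :=
  RCat.hom₂_ext fun _ => SplitHom.ext (H.map_comp _ _).symm

/-- Postcomposition with a component of a split completion. -/
theorem split_comp {F G : X ⟶ Y} (a : F ⟶ G) {Q : SplitObj Y} {P : SplitObj X}
    (g : Q ⟶ (splitMap F).obj P) : (g ≫ (splitMap₂ a).app P).f = g.f ≫ a.app P.A := by
  change g.f ≫ F.map P.e ≫ a.app P.A = _
  have : g.f ≫ F.map P.e = g.f := g.right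
  rw [← Category.assoc, this]

theorem split_widePullback {ι : Type w} {B P : X ⟶ Y} {E : ι → (X ⟶ Y)} {q : ∀ i, E i ⟶ B}
    {pr : ∀ i, P ⟶ E i} (M : SplitObj X)
    (H : IsWidePullbackCone (fun i => (q i).app M.A) (fun i => (pr i).app M.A)) :
    IsWidePullbackCone (fun i => (splitMap₂ (q i)).app M) (fun i => (splitMap₂ (pr i)).app M) := by
  refine ⟨fun i j => SplitHom.ext ?_, fun Q x hx => ?_⟩
  · refine (split_comp _ _).trans (Eq.trans ?_ (split_comp _ _).symm)
    rw [splitMap₂_f, splitMap₂_f, Category.assoc, Category.assoc]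
    exact congrArg (P.map M.e ≫ ·) (H.comm i j)
  · obtain ⟨k, hk, hu⟩ := H.lift Q.A (fun i => (x i).f) fun i j => by
      have := congrArg SplitHom.f (hx i j)
      rwa [split_comp, split_comp] at this
    have hext : ∀ {a b : Q.A ⟶ P.obj M.A}, (∀ i, a ≫ (pr i).app M.A = b ≫ (pr i).app M.A) → a = b :=
      fun {a b} e => H.hom_ext e
    refine ⟨⟨k, hext fun i => ?_, hext fun i => ?_⟩, fun i => SplitHom.ext ?_, fun k' hk' => ?_⟩
    · rw [Category.assoc, hk, (x i).left]
    · change (k ≫ P.map M.e) ≫ _ = _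
      rw [Category.assoc, (pr i).naturality, ← Category.assoc, hk]
      exact (x i).right
    · exact (split_comp _ _).trans (hk i)
    · refine SplitHom.ext (hext fun i => ?_)
      rw [hk, ← hk' i, split_comp]

theorem split_isPullback {P A B D : X ⟶ Y} {fst : P ⟶ A} {snd : P ⟶ B} {f : A ⟶ D} {g : B ⟶ D}
    (M : SplitObj X) (H : IsPullback (fst.app M.A) (snd.app M.A) (f.app M.A) (g.app M.A)) :
    IsPullback ((splitMap₂ fst).app M) ((splitMap₂ snd).app M) ((splitMap₂ f).app M)
      ((splitMap₂ g).app M) := by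
  have hw : (splitMap₂ fst).app M ≫ (splitMap₂ f).app M =
      (splitMap₂ snd).app M ≫ (splitMap₂ g).app M := SplitHom.ext (by
    refine (split_comp _ _).trans (Eq.trans ?_ (split_comp _ _).symm)
    rw [splitMap₂_f, splitMap₂_f, Category.assoc, Category.assoc]
    exact congrArg (P.map M.e ≫ ·) H.w)
  have key : ∀ (Q : SplitObj Y) (x : Q ⟶ (splitMap A).obj M) (y : Q ⟶ (splitMap B).obj M),
      x ≫ (splitMap₂ f).app M = y ≫ (splitMap₂ g).app M →
      ∃ k : Q ⟶ (splitMap P).obj M,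
        k ≫ (splitMap₂ fst).app M = x ∧ k ≫ (splitMap₂ snd).app M = y := fun Q x y hxy => by
    have e : x.f ≫ f.app M.A = y.f ≫ g.app M.A := by
      have := congrArg SplitHom.f hxy
      rwa [split_comp, split_comp] at this
    have r1 : x.f ≫ A.map M.e = x.f := x.right
    have r2 : y.f ≫ B.map M.e = y.f := y.right
    refine ⟨⟨H.lift x.f y.f e, H.hom_ext ?_ ?_, H.hom_ext ?_ ?_⟩, SplitHom.ext ?_, SplitHom.ext ?_⟩
    · rw [Category.assoc, H.lift_fst, x.left]
    · rw [Category.assoc, H.lift_snd, y.left]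
    · change (_ ≫ P.map M.e) ≫ _ = _
      rw [Category.assoc, fst.naturality, ← Category.assoc, H.lift_fst, r1]
    · change (_ ≫ P.map M.e) ≫ _ = _
      rw [Category.assoc, snd.naturality, ← Category.assoc, H.lift_snd, r2]
    · exact (split_comp _ _).trans (H.lift_fst _ _ _)
    · exact (split_comp _ _).trans (H.lift_snd _ _ _)
  refine ⟨⟨hw⟩, ⟨Limits.PullbackCone.IsLimit.mk _ (fun s => (key s.pt s.fst s.snd s.condition).choose)
    (fun s => (key s.pt s.fst s.snd s.condition).choose_spec.1)
    (fun s => (key s.pt s.fst s.snd s.condition).choose_spec.2) fun s m h1 h2 => ?_⟩⟩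
  have k1 := congrArg SplitHom.f (h1.trans (key s.pt s.fst s.snd s.condition).choose_spec.1.symm)
  have k2 := congrArg SplitHom.f (h2.trans (key s.pt s.fst s.snd s.condition).choose_spec.2.symm)
  rw [split_comp, split_comp] at k1 k2
  exact SplitHom.ext (H.hom_ext k1 k2)

theorem iter_split (T : X ⟶ X) (m : ℕ) : iter (splitMap T) m = splitMap (iter T m) := by
  induction m with
  | zero => rfl
  | succ m ih => exact congrArg (fun S => S ≫ splitMap T) ih

end SplitLemmas

section SplitLemmas

variable {X Y Z : RCat.{v, u}}

/-- Postcomposition with the image of a component of a split completion. -/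
theorem split_comp_map {F G : X ⟶ Y} (a : F ⟶ G) (H : Y ⟶ Z) {Q : SplitObj Z} {P : SplitObj X}
    (g : Q ⟶ (splitMap H).obj ((splitMap F).obj P)) :
    (g ≫ (splitMap H).map ((splitMap₂ a).app P)).f = g.f ≫ H.map (a.app P.A) := by
  change g.f ≫ H.map (F.map P.e ≫ a.app P.A) = _
  have : g.f ≫ H.map (F.map P.e) = g.f := g.right
  rw [H.map_comp, ← Category.assoc, this]

theorem splitMap_map_app {F G : X ⟶ Y} (a : F ⟶ G) (H : Y ⟶ Z) (P : SplitObj X) :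
    (splitMap H).map ((splitMap₂ a).app P) = (splitMap₂ (a ▷ H)).app P :=
  (RCat.congr_app (splitMap₂_whiskerRight a H) P).symm

theorem split_comp₂ {F G H : X ⟶ Y} (a : F ⟶ G) (b : G ⟶ H) {Q : SplitObj Y} {P : SplitObj X}
    (g : Q ⟶ (splitMap F).obj P) :
    (g ≫ (splitMap₂ a).app P ≫ (splitMap₂ b).app P).f = g.f ≫ a.app P.A ≫ b.app P.A := by
  rw [← Category.assoc, split_comp, split_comp, Category.assoc]

theorem split_comp_map₂ {F G : X ⟶ Y} (a : F ⟶ G) {H : Y ⟶ Z} {L : X ⟶ Z} (b : G ≫ H ⟶ L)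
    {Q : SplitObj Z} {P : SplitObj X} (g : Q ⟶ (splitMap H).obj ((splitMap F).obj P)) :
    (g ≫ (splitMap H).map ((splitMap₂ a).app P) ≫ (splitMap₂ b).app P).f =
      g.f ≫ H.map (a.app P.A) ≫ b.app P.A := by
  rw [← Category.assoc]
  refine (split_comp b (P := P) (g ≫ (splitMap H).map ((splitMap₂ a).app P))).trans ?_
  refine (congrArg (· ≫ b.app P.A) (split_comp_map a H (P := P) g)).trans ?_
  exact Category.assoc _ _ _

end SplitLemmas

theorem IsWidePullbackCone.congr {C : Type u} [Category.{v} C] {ι : Type w} {B P : C} {E : ι → C}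
    {q q' : ∀ i, E i ⟶ B} {pr pr' : ∀ i, P ⟶ E i} (H : IsWidePullbackCone q pr)
    (hq : ∀ i, q i = q' i) (hpr : ∀ i, pr i = pr' i) : IsWidePullbackCone q' pr' := by
  obtain rfl := funext hq
  obtain rfl := funext hpr
  exact H

namespace TangentData

variable {X : RCat.{v, u}} (D : TangentData X)

/-- The tangent structure on the split completion. -/
def split : TangentData (splitCompletion X).toRCat where
  T := splitMap D.T
  p := splitMap₂ D.p
  pow n := splitMap (D.pow n)
  π n i := splitMap₂ (D.π n i)
  z := splitMap₂ D.z
  s := splitMap₂ D.s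
  l := splitMap₂ D.l
  c := splitMap₂ D.c

namespace IsTangentRestriction

variable {D}

theorem split_bundle (h : D.IsTangentRestriction) (P : SplitObj X) : (D.split.bundleAt P).IsAdditive where
  zero_proj := SplitHom.ext (by
    refine (split_comp D.p (P := P) ((splitMap₂ D.z).app P)).trans ?_
    rw [splitMap₂_f, Category.assoc]
    exact (congrArg (P.e ≫ ·) (h.bundle_additive P.A).zero_proj).trans (Category.comp_id _))
  sum_proj := SplitHom.ext (by
    refine (split_comp D.p (P := P) ((splitMap₂ D.s).app P)).trans (Eq.trans ?_
      (split_comp D.p (P := P) ((splitMap₂ (D.π 1 0)).app P)).symm)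
    rw [splitMap₂_f, splitMap₂_f, Category.assoc, Category.assoc]
    exact congrArg ((D.pow 1).map P.e ≫ ·) (h.bundle_additive P.A).sum_proj)
  sum_assoc {Q} u v w w' h1 h2 h3 h4 h5 := SplitHom.ext (by
    refine (split_comp D.s (P := P) w).trans (Eq.trans ?_ (split_comp D.s (P := P) w').symm)
    have e1 := (split_comp (D.π 1 1) (P := P) u).symm.trans
      ((congrArg SplitHom.f h1).trans (split_comp (D.π 1 0) (P := P) v))
    have e2 := (split_comp (D.π 1 0) (P := P) w).symm.trans
      ((congrArg SplitHom.f h2).trans (split_comp D.s (P := P) u))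
    have e3 := (split_comp (D.π 1 1) (P := P) w).symm.trans
      ((congrArg SplitHom.f h3).trans (split_comp (D.π 1 1) (P := P) v))
    have e4 := (split_comp (D.π 1 0) (P := P) w').symm.trans
      ((congrArg SplitHom.f h4).trans (split_comp (D.π 1 0) (P := P) u))
    have e5 := (split_comp (D.π 1 1) (P := P) w').symm.trans
      ((congrArg SplitHom.f h5).trans (split_comp D.s (P := P) v))
    exact (h.bundle_additive P.A).sum_assoc u.f v.f w.f w'.f e1 e2 e3 e4 e5)
  zero_sum {Q} u h1 := SplitHom.ext (by
    refine (split_comp D.s (P := P) u).trans (Eq.trans ?_ (split_comp (D.π 1 1) (P := P) u).symm)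
    refine (h.bundle_additive P.A).zero_sum u.f ?_
    refine (split_comp (D.π 1 0) (P := P) u).symm.trans ((congrArg SplitHom.f h1).trans ?_)
    change (u ≫ (splitMap₂ (D.π 1 1) ≫ splitMap₂ D.p ≫ splitMap₂ D.z).app P).f = _
    rw [← splitMap₂_comp, ← splitMap₂_comp]
    exact split_comp (D.π 1 1 ≫ D.p ≫ D.z) (P := P) u)
  sum_comm {Q} u v h1 h2 := SplitHom.ext (by
    refine (split_comp D.s (P := P) u).trans (Eq.trans ?_ (split_comp D.s (P := P) v).symm)
    exact (h.bundle_additive P.A).sum_comm u.f v.f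
      ((split_comp (D.π 1 0) (P := P) u).symm.trans
        ((congrArg SplitHom.f h1).trans (split_comp (D.π 1 1) (P := P) v)))
      ((split_comp (D.π 1 1) (P := P) u).symm.trans
        ((congrArg SplitHom.f h2).trans (split_comp (D.π 1 0) (P := P) v))))

theorem split_pow_limit (h : D.IsTangentRestriction) (n m : ℕ) (P : SplitObj X) : IsWidePullbackCone
    (fun _ : Fin (n + 1) => (iter D.split.T m).map (D.split.projAt P))
    (fun i => (iter D.split.T m).map (D.split.prAt P n i)) := by
  have e : iter D.split.T m = splitMap (iter D.T m) := iter_split D.T m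
  rw [e]
  exact (split_widePullback (q := fun _ : Fin (n + 1) => D.p ▷ iter D.T m)
    (pr := fun i => D.π n i ▷ iter D.T m) P (h.pow_limit' n m P.A)).congr
    (fun _ => (splitMap_map_app D.p (iter D.T m) P).symm)
    (fun i => (splitMap_map_app (D.π n i) (iter D.T m) P).symm)

theorem split_lift_additive (h : D.IsTangentRestriction) (P : SplitObj X) : (D.split.bundleAt P).IsHom
    ((D.split.bundleAt P).map D.split.T.toFunctor) (D.split.zeroAt P) (D.split.liftAt P) where
  proj := SplitHom.ext (by
    refine (split_comp_map D.p D.T (P := P) ((splitMap₂ D.l).app P)).trans (Eq.trans ?_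
      (split_comp D.z (P := P) ((splitMap₂ D.p).app P)).symm)
    rw [splitMap₂_f, splitMap₂_f, Category.assoc, Category.assoc]
    exact congrArg (D.T.map P.e ≫ ·) (h.lift_additive P.A).proj)
  zero := SplitHom.ext (by
    refine (split_comp D.l (P := P) ((splitMap₂ D.z).app P)).trans (Eq.trans ?_
      (split_comp_map D.z D.T (P := P) ((splitMap₂ D.z).app P)).symm)
    rw [splitMap₂_f, Category.assoc, Category.assoc]
    exact congrArg (P.e ≫ ·) (h.lift_additive P.A).zero)
  sum {Q} u u' h1 h2 := SplitHom.ext (by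
    refine (split_comp_map D.s D.T (P := P) u').trans (Eq.trans ?_ ((congrArg SplitHom.f
      (Category.assoc u ((splitMap₂ D.s).app P) ((splitMap₂ D.l).app P)).symm).trans
      ((split_comp D.l (P := P) (u ≫ (splitMap₂ D.s).app P)).trans
        (congrArg (· ≫ D.l.app P.A) (split_comp D.s (P := P) u)))).symm)
    have e : ∀ i, (u ≫ (splitMap₂ (D.π 1 i)).app P ≫ (splitMap₂ D.l).app P).f =
        u.f ≫ (D.π 1 i).app P.A ≫ D.l.app P.A := fun i => split_comp₂ (D.π 1 i) D.l (P := P) u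
    have := (h.lift_additive P.A).sum u.f u'.f
      ((split_comp_map (D.π 1 0) D.T (P := P) u').symm.trans
        ((congrArg SplitHom.f h1).trans (e 0)))
      ((split_comp_map (D.π 1 1) D.T (P := P) u').symm.trans
        ((congrArg SplitHom.f h2).trans (e 1)))
    exact this.trans (Category.assoc _ _ _).symm)

theorem split_flip_additive (h : D.IsTangentRestriction) (P : SplitObj X) :
    ((D.split.bundleAt P).map D.split.T.toFunctor).IsHom (D.split.bundleAt (D.split.T.obj P))
      (𝟙 (D.split.T.obj P)) (D.split.flipAt P) where
  proj := SplitHom.ext (by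
    refine (split_comp D.p (P := (splitMap D.T).obj P) ((splitMap₂ D.c).app P)).trans ?_
    change (D.T.map (D.T.map P.e) ≫ D.c.app P.A) ≫ D.p.app (D.T.obj P.A) =
      D.T.map (D.T.map P.e ≫ D.p.app P.A) ≫ D.T.map P.e
    have e : D.c.app P.A ≫ D.p.app (D.T.obj P.A) = D.T.map (D.p.app P.A) :=
      (h.flip_additive P.A).proj.trans (Category.comp_id _)
    have n : D.T.map P.e ≫ D.p.app P.A = D.p.app P.A ≫ P.e := D.p.naturality P.e
    rw [Category.assoc, e, ← D.T.map_comp, ← D.T.map_comp, n, Category.assoc, P.e_idem])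
  zero := SplitHom.ext (by
    refine (split_comp D.c (P := P) ((splitMap D.T).map ((splitMap₂ D.z).app P))).trans ?_
    change D.T.map (P.e ≫ D.z.app P.A) ≫ D.c.app P.A =
      D.T.map P.e ≫ D.T.map P.e ≫ D.z.app (D.T.obj P.A)
    have e : D.T.map (D.z.app P.A) ≫ D.c.app P.A = D.z.app (D.T.obj P.A) :=
      (h.flip_additive P.A).zero.trans (Category.id_comp _)
    rw [D.T.map_comp, Category.assoc, e, ← Category.assoc, ← D.T.map_comp, P.e_idem])
  sum {Q} u u' h1 h2 := SplitHom.ext (by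
    have e : ∀ i, (u ≫ (splitMap D.T).map ((splitMap₂ (D.π 1 i)).app P) ≫
        (splitMap₂ D.c).app P).f = u.f ≫ D.T.map ((D.π 1 i).app P.A) ≫ D.c.app P.A := fun i =>
      split_comp_map₂ (D.π 1 i) D.c (P := P) u
    have e' : (u ≫ (splitMap D.T).map ((splitMap₂ D.s).app P) ≫
        (splitMap₂ D.c).app P).f = u.f ≫ D.T.map (D.s.app P.A) ≫ D.c.app P.A :=
      split_comp_map₂ D.s D.c (P := P) u
    refine (split_comp D.s (P := (splitMap D.T).obj P) u').trans (Eq.trans ?_ e'.symm)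
    exact (h.flip_additive P.A).sum u.f u'.f
      ((split_comp (D.π 1 0) (P := (splitMap D.T).obj P) u').symm.trans
        ((congrArg SplitHom.f h1).trans (e 0)))
      ((split_comp (D.π 1 1) (P := (splitMap D.T).obj P) u').symm.trans
        ((congrArg SplitHom.f h2).trans (e 1))))

theorem exists_lift_cell (h : D.IsTangentRestriction) : ∃ τ : D.pow 1 ⟶ D.pow 1 ≫ D.T,
    (∀ N, τ.app N ≫ D.T.map (D.prAt N 1 0) = D.prAt N 1 0 ≫ D.liftAt N) ∧
    ∀ N, τ.app N ≫ D.T.map (D.prAt N 1 1) = D.prAt N 1 1 ≫ D.zeroAt (D.T.obj N) := by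
  have hL : IsWidePullbackCone (fun _ : Fin 2 => D.p ▷ D.T) (fun i => D.π 1 i ▷ D.T) :=
    RCat.widePullback_of_components fun M => h.pow_limit' 1 1 M
  have ec : ∀ N, ((D.π 1 0).app N ≫ D.l.app N) ≫ D.T.map (D.p.app N) =
      ((D.π 1 1).app N ≫ D.z.app (D.T.obj N)) ≫ D.T.map (D.p.app N) := fun N => by
    have e1 : D.l.app N ≫ D.T.map (D.p.app N) = D.p.app N ≫ D.z.app N :=
      (h.lift_additive N).proj
    have e2 : D.z.app (D.T.obj N) ≫ D.T.map (D.p.app N) = D.p.app N ≫ D.z.app N :=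
      (D.z.naturality (D.p.app N)).symm
    rw [Category.assoc, e1, Category.assoc, e2, ← Category.assoc, ← Category.assoc]
    exact congrArg (· ≫ D.z.app N) ((h.pow_limit' 1 0 N).comm 0 1)
  obtain ⟨τ, hτ, -⟩ := hL.lift (D.pow 1) ![D.π 1 0 ≫ D.l, D.π 1 1 ≫ (D.T ◁ D.z)]
    fun i j => RCat.hom₂_ext fun N => by
      fin_cases i <;> fin_cases j
      exacts [rfl, ec N, (ec N).symm, rfl]
  exact ⟨τ, fun N => RCat.congr_app (hτ 0) N, fun N => RCat.congr_app (hτ 1) N⟩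

theorem split_lift_universal (h : D.IsTangentRestriction) (P : SplitObj X)
    (w : (D.split.pow 1).obj P ⟶ D.split.T.obj ((D.split.pow 1).obj P))
    (h0 : w ≫ D.split.T.map (D.split.prAt P 1 0) = D.split.prAt P 1 0 ≫ D.split.liftAt P)
    (h1 : w ≫ D.split.T.map (D.split.prAt P 1 1) =
      D.split.prAt P 1 1 ≫ D.split.zeroAt (D.split.T.obj P)) :
    IsPullback (w ≫ D.split.T.map (D.split.sumAt P)) (D.split.prAt P 1 0 ≫ D.split.projAt P)
      (D.split.T.map (D.split.projAt P)) (D.split.zeroAt P) := by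
  obtain ⟨τ, h0', h1'⟩ := h.exists_lift_cell
  have e : w = (splitMap₂ τ).app P := (h.split_pow_limit 1 1 P).hom_ext fun i => SplitHom.ext (by
    refine Eq.trans ?_ (split_comp_map (D.π 1 i) D.T (P := P) ((splitMap₂ τ).app P)).symm
    rw [splitMap₂_f, Category.assoc]
    fin_cases i
    · refine (congrArg SplitHom.f h0).trans ?_
      refine (split_comp D.l (P := P) ((splitMap₂ (D.π 1 0)).app P)).trans ?_
      rw [splitMap₂_f, Category.assoc]
      exact congrArg ((D.pow 1).map P.e ≫ ·) (h0' P.A).symm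
    · refine (congrArg SplitHom.f h1).trans ?_
      refine (split_comp D.z (P := (splitMap D.T).obj P) ((splitMap₂ (D.π 1 1)).app P)).trans ?_
      rw [splitMap₂_f, Category.assoc]
      exact congrArg ((D.pow 1).map P.e ≫ ·) (h1' P.A).symm)
  subst e
  have := split_isPullback (fst := τ ≫ D.s ▷ D.T) (snd := D.π 1 0 ≫ D.p)
    (f := (D.p ▷ D.T : D.T ≫ D.T ⟶ 𝟙 X ≫ D.T)) (g := (D.z : 𝟙 X ⟶ D.T)) P
    (h.lift_universal' P.A (τ.app P.A) (h0' P.A) (h1' P.A))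
  have e1 : (splitMap₂ (τ ≫ D.s ▷ D.T)).app P =
      (splitMap₂ τ).app P ≫ (splitMap D.T).map ((splitMap₂ D.s).app P) := by
    rw [splitMap_map_app, splitMap₂_comp]
    rfl
  have e2 : (splitMap₂ (D.π 1 0 ≫ D.p)).app P =
      (splitMap₂ (D.π 1 0)).app P ≫ (splitMap₂ D.p).app P := by
    rw [splitMap₂_comp]
    rfl
  have e3 : (splitMap₂ (D.p ▷ D.T)).app P = (splitMap D.T).map ((splitMap₂ D.p).app P) :=
    (splitMap_map_app _ _ _).symm
  rw [e1, e2, e3] at this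
  exact this

/-- The split completion of a tangent restriction category. -/
theorem split (h : D.IsTangentRestriction) : D.split.IsTangentRestriction where
  bundle_additive P := h.split_bundle P
  pow_limit n m P := (isRestrictionWidePullback_iff fun _ =>
    RCat.map_total _ (D.split.p.total P)).2 (h.split_pow_limit n m P)
  lift_additive := h.split_lift_additive
  flip_additive := h.split_flip_additive
  lift_coassoc P := SplitHom.ext (by
    refine (split_comp_map D.l D.T (P := P) ((splitMap₂ D.l).app P)).trans (Eq.trans ?_
      (split_comp D.l (P := (splitMap D.T).obj P) ((splitMap₂ D.l).app P)).symm)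
    rw [splitMap₂_f, Category.assoc, Category.assoc]
    exact congrArg (D.T.map P.e ≫ ·) (h.lift_coassoc P.A))
  lift_flip P := SplitHom.ext (by
    refine (split_comp D.c (P := P) ((splitMap₂ D.l).app P)).trans ?_
    rw [splitMap₂_f, Category.assoc]
    exact congrArg (D.T.map P.e ≫ ·) (h.lift_flip P.A))
  lift_flip_flip P := SplitHom.ext (by
    refine (congrArg SplitHom.f (Category.assoc _ _ _).symm).trans ?_
    refine (split_comp D.c (P := (splitMap D.T).obj P) (((splitMap₂ D.l).app
      ((splitMap D.T).obj P)) ≫ (splitMap D.T).map ((splitMap₂ D.c).app P))).trans ?_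
    refine (congrArg (· ≫ _) (split_comp_map D.c D.T (P := P) ((splitMap₂ D.l).app
      ((splitMap D.T).obj P)))).trans ?_
    refine Eq.trans ?_ (split_comp_map D.l D.T (P := P) ((splitMap₂ D.c).app P)).symm
    rw [splitMap₂_f, splitMap₂_f, Category.assoc, Category.assoc, Category.assoc]
    exact congrArg (D.T.map (D.T.map P.e) ≫ ·) (h.lift_flip_flip P.A))
  flip_flip P := SplitHom.ext (by
    refine (split_comp D.c (P := P) ((splitMap₂ D.c).app P)).trans ?_
    rw [splitMap₂_f, Category.assoc]
    exact (congrArg (D.T.map (D.T.map P.e) ≫ ·) (h.flip_flip P.A)).trans (Category.comp_id _))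
  flip_braid P := SplitHom.ext (by
    refine (congrArg SplitHom.f (Category.assoc _ _ _).symm).trans (Eq.trans ?_
      (congrArg SplitHom.f (Category.assoc (D.split.flipAt (D.split.T.obj P))
        (D.split.T.map (D.split.flipAt P)) (D.split.flipAt (D.split.T.obj P)))))
    refine (split_comp_map D.c D.T (P := P) (((splitMap D.T).map ((splitMap₂ D.c).app P)) ≫
      ((splitMap₂ D.c).app ((splitMap D.T).obj P)))).trans ?_
    refine (congrArg (· ≫ _) (split_comp D.c (P := (splitMap D.T).obj P)
      ((splitMap D.T).map ((splitMap₂ D.c).app P)))).trans ?_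
    refine Eq.trans ?_ (split_comp D.c (P := (splitMap D.T).obj P)
      (((splitMap₂ D.c).app ((splitMap D.T).obj P)) ≫
        ((splitMap D.T).map ((splitMap₂ D.c).app P)))).symm
    refine Eq.trans ?_ (congrArg (· ≫ D.c.app (D.T.obj P.A)) (split_comp_map D.c D.T (P := P)
      ((splitMap₂ D.c).app ((splitMap D.T).obj P)))).symm
    change (D.T.map (D.T.map (D.T.map P.e) ≫ D.c.app P.A) ≫ D.c.app (D.T.obj P.A)) ≫
      D.T.map (D.c.app P.A) = ((D.T.map (D.T.map (D.T.map P.e)) ≫ D.c.app (D.T.obj P.A)) ≫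
        D.T.map (D.c.app P.A)) ≫ D.c.app (D.T.obj P.A)
    rw [D.T.map_comp, Category.assoc, Category.assoc, Category.assoc, Category.assoc]
    exact congrArg (D.T.map (D.T.map (D.T.map P.e)) ≫ ·) (h.flip_braid P.A))
  lift_universal P w h0 h1 := (isRestrictionPullback_iff (RCat.map_total _ (D.split.p.total P))
    (D.split.z.total P)).2 (h.split_lift_universal P w h0 h1)

end IsTangentRestriction

end TangentData

/-! ### The 2-functors between tangent restriction categories and tangentads in `sRCat` -/

section SplitLemmas

variable {X Y Z W : RCat.{v, u}}

theorem splitMap₂_leftUnitor (F : X ⟶ Y) :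
    splitMap₂ (λ_ F).hom = (λ_ (splitMap F)).hom :=
  RCat.hom₂_ext fun _ => SplitHom.ext (Category.comp_id _)

theorem splitMap₂_rightUnitor_inv (F : X ⟶ Y) :
    splitMap₂ (ρ_ F).inv = (ρ_ (splitMap F)).inv :=
  RCat.hom₂_ext fun _ => SplitHom.ext (Category.comp_id _)

theorem splitMap₂_associator (F : X ⟶ Y) (G : Y ⟶ Z) (H : Z ⟶ W) :
    splitMap₂ (α_ F G H).hom = (α_ (splitMap F) (splitMap G) (splitMap H)).hom :=
  RCat.hom₂_ext fun _ => SplitHom.ext (Category.comp_id _)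

theorem splitMap₂_associator_inv (F : X ⟶ Y) (G : Y ⟶ Z) (H : Z ⟶ W) :
    splitMap₂ (α_ F G H).inv = (α_ (splitMap F) (splitMap G) (splitMap H)).inv :=
  RCat.hom₂_ext fun _ => SplitHom.ext (Category.comp_id _)

theorem splitMap₂_rightUnitor (F : X ⟶ Y) :
    splitMap₂ (ρ_ F).hom = (ρ_ (splitMap F)).hom :=
  RCat.hom₂_ext fun _ => SplitHom.ext (Category.comp_id _)

theorem splitMap₂_leftUnitor_inv (F : X ⟶ Y) :
    splitMap₂ (λ_ F).inv = (λ_ (splitMap F)).inv :=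
  RCat.hom₂_ext fun _ => SplitHom.ext (Category.comp_id _)

theorem splitMap₂_twice {T : X ⟶ X} {T' : Y ⟶ Y} {F : X ⟶ Y} (a : T ≫ F ⟶ F ≫ T') :
    splitMap₂ (twice a) = twice (T := splitMap T) (F := splitMap F) (T' := splitMap T')
      (splitMap₂ a) := by
  unfold twice
  rw [splitMap₂_comp, splitMap₂_comp, splitMap₂_comp, splitMap₂_comp, splitMap₂_associator,
    splitMap₂_associator_inv, splitMap₂_associator, splitMap₂_whiskerLeft, splitMap₂_whiskerRight]

theorem splitMap₂_compLaw {T : X ⟶ X} {T' : Y ⟶ Y} {T'' : Z ⟶ Z} {F : X ⟶ Y} {G : Y ⟶ Z}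
    (a : T ≫ F ⟶ F ≫ T') (b : T' ≫ G ⟶ G ≫ T'') :
    splitMap₂ (compLaw a b) = compLaw (T := splitMap T) (T' := splitMap T') (T'' := splitMap T'')
      (F := splitMap F) (G := splitMap G) (splitMap₂ a) (splitMap₂ b) := by
  unfold compLaw
  rw [splitMap₂_comp, splitMap₂_comp, splitMap₂_comp, splitMap₂_comp, splitMap₂_associator,
    splitMap₂_associator_inv, splitMap₂_associator_inv, splitMap₂_whiskerLeft,
    splitMap₂_whiskerRight]

end SplitLemmas

/-- The split completion of a tangent restriction category, as a tangentad in `sRCat`. -/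
def splitTng (X : TngRCat.{v, u}) : Tng sRCat.{v, max u v} :=
  Tangentad.mk ⟨splitCompletion X.X, X.D.split.toSplit (splitCompletion X.X)⟩
    X.isTangentRestriction.split.toSplit

/-- The split completion of a lax tangent restriction functor. -/
def splitLax {A B : TngRCat.{v, u}} (f : A ⟶ B) :
    LaxMor (splitTng A).toTngPair (splitTng B).toTngPair where
  F := splitMap f.hom.F
  α := splitMap₂ f.hom.α
  proj := by
    have := congrArg splitMap₂ f.hom.proj
    rw [splitMap₂_comp, splitMap₂_comp, splitMap₂_comp, splitMap₂_whiskerLeft,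
      splitMap₂_whiskerRight, splitMap₂_leftUnitor, splitMap₂_rightUnitor_inv] at this
    exact this
  zero := by
    have := congrArg splitMap₂ f.hom.zero
    rw [splitMap₂_comp, splitMap₂_comp, splitMap₂_comp, splitMap₂_whiskerLeft,
      splitMap₂_whiskerRight, splitMap₂_leftUnitor, splitMap₂_rightUnitor_inv] at this
    exact this
  sum := by
    obtain ⟨a, h1, h2⟩ := f.hom.sum
    refine ⟨splitMap₂ a, fun i => ?_, ?_⟩
    · have := congrArg splitMap₂ (h1 i)
      rw [splitMap₂_comp, splitMap₂_comp, splitMap₂_whiskerLeft, splitMap₂_whiskerRight] at this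
      exact this
    · have := congrArg splitMap₂ h2
      rw [splitMap₂_comp, splitMap₂_comp, splitMap₂_whiskerLeft, splitMap₂_whiskerRight] at this
      exact this
  lift := by
    have := congrArg splitMap₂ f.hom.lift
    rw [splitMap₂_comp, splitMap₂_comp, splitMap₂_whiskerLeft, splitMap₂_whiskerRight,
      splitMap₂_twice] at this
    exact this
  flip := by
    have := congrArg splitMap₂ f.hom.flip
    rw [splitMap₂_comp, splitMap₂_comp, splitMap₂_whiskerLeft, splitMap₂_whiskerRight,
      splitMap₂_twice] at this
    exact this

/-- The split completion of a tangent 2-morphism. -/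
def splitCell {A B : TngRCat.{v, u}} {f g : A ⟶ B} (θ : f ⟶ g) :
    LaxMor.Hom (splitLax f) (splitLax g) where
  cell := splitMap₂ θ.hom.cell
  comm := by
    have := congrArg splitMap₂ θ.hom.comm
    rw [splitMap₂_comp, splitMap₂_comp, splitMap₂_whiskerLeft, splitMap₂_whiskerRight] at this
    exact this

theorem LaxMor.ext_heq {K : Type u} [Bicategory.{w, v} K] {A B : TngPair K} {f g : LaxMor A B}
    (hF : f.F = g.F) (hα : f.α ≍ g.α) : f = g := by
  obtain ⟨F, α, _, _, _, _, _⟩ := f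
  obtain ⟨G, β, _, _, _, _, _⟩ := g
  dsimp only at hF
  subst hF
  obtain rfl := eq_of_heq hα
  rfl

theorem eqToHom_hom_cell {K : Type u} [Bicategory.{w, v} K] {J : Type u'} {F : J → TngPair K}
    {A B : InducedBicategory (TngPair K) F} {f g : A ⟶ B} (h : f = g) :
    (eqToHom h).hom.cell = eqToHom (congrArg (fun k => k.hom.F) h) := by
  subst h; rfl

theorem sandwich_cell {K : Type u} [Bicategory.{w, v} K] {J : Type u'} {F : J → TngPair K}
    {A B : InducedBicategory (TngPair K) F} {f f' g' g : A ⟶ B} (h : f = f') (a : f' ⟶ g')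
    (k : g' = g) : (eqToHom h ≫ a ≫ eqToHom k).hom.cell =
      eqToHom (congrArg (fun k => k.hom.F) h) ≫ a.hom.cell ≫
        eqToHom (congrArg (fun k => k.hom.F) k) := by
  subst h k
  simp only [eqToHom_refl, Category.comp_id, Category.id_comp]

theorem eq_sandwich {K : Type u} [Bicategory.{w, v} K] {J : Type u'} {F : J → TngPair K}
    {A B : InducedBicategory (TngPair K) F} {f f' g' g : A ⟶ B} (h : f = f') (a : f' ⟶ g')
    (k : g' = g) (x : f ⟶ g) (e : x.hom.cell = eqToHom (congrArg (fun k => k.hom.F) h) ≫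
      a.hom.cell ≫ eqToHom (congrArg (fun k => k.hom.F) k)) : x = eqToHom h ≫ a ≫ eqToHom k :=
  InducedBicategory.hom₂_ext (TngPair.hom₂_ext (e.trans (sandwich_cell h a k).symm))

theorem eq_sandwich_rfl {C : Type u} [Category.{v} C] {F G : C} (h : F = F) (k : G = G)
    (a : F ⟶ G) : a = eqToHom h ≫ a ≫ eqToHom k := by
  simp only [eqToHom_refl, Category.comp_id, Category.id_comp]

theorem splitLax_id (A : TngRCat.{v, u}) : splitLax (𝟙 A) = TngPair.idMor (splitTng A).toTngPair :=
  LaxMor.ext_heq rfl (heq_of_eq (by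
    change splitMap₂ ((ρ_ A.D.T).hom ≫ (λ_ A.D.T).inv) = _
    rw [splitMap₂_comp, splitMap₂_rightUnitor, splitMap₂_leftUnitor_inv]
    rfl))

theorem splitLax_comp {A B C : TngRCat.{v, u}} (f : A ⟶ B) (g : B ⟶ C) :
    splitLax (f ≫ g) = TngPair.compMor (splitLax f) (splitLax g) :=
  LaxMor.ext_heq rfl (heq_of_eq (splitMap₂_compLaw f.hom.α g.hom.α))

/-- The 2-functor that splits the restriction idempotents of tangent restriction categories. -/
def splitFunctor : StrictPseudofunctor TngRCat.{v, u} (Tng sRCat.{v, max u v}) :=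
  StrictPseudofunctor.mk''
    { obj := splitTng
      map := fun f => InducedBicategory.mkHom (splitLax f)
      map₂ := fun θ => ⟨splitCell θ⟩
      map₂_id := fun f => InducedBicategory.hom₂_ext (TngPair.hom₂_ext (splitMap₂_id f.hom.F))
      map₂_comp := fun a b =>
        InducedBicategory.hom₂_ext (TngPair.hom₂_ext (splitMap₂_comp a.hom.cell b.hom.cell))
      map_id := fun A => InducedBicategory.hom_ext (splitLax_id A)
      map_comp := fun f g => InducedBicategory.hom_ext (splitLax_comp f g)
      map₂_whisker_left := fun f _ _ θ => eq_sandwich _ _ _ _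
        (eq_sandwich_rfl _ _ (splitMap₂ (f.hom.F ◁ θ.hom.cell)))
      map₂_whisker_right := fun {_ _ _ f f'} θ g => eq_sandwich _ _ _ _
        ((splitMap₂_whiskerRight θ.hom.cell g.hom.F).trans
          (eq_sandwich_rfl _ _ (splitMap₂ θ.hom.cell ▷ splitMap g.hom.F))) }

/-- The inclusion of tangentads in `sRCat` into tangent restriction categories. -/
def inclusion : StrictPseudofunctor (Tng sRCat.{v, u}) TngRCat.{v, u} :=
  StrictPseudofunctor.mk''
    { obj := fun A => TangentRestrictionCategory.mk ⟨A.X.toRCat, A.D.ofSplit⟩ A.isTangentad.ofSplit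
      map := fun f => InducedBicategory.mkHom
        { F := f.hom.F
          α := f.hom.α
          proj := f.hom.proj
          zero := f.hom.zero
          sum := f.hom.sum
          lift := f.hom.lift
          flip := f.hom.flip }
      map₂ := fun θ => ⟨{ cell := θ.hom.cell, comm := θ.hom.comm }⟩
      map₂_id := fun _ => rfl
      map₂_comp := fun _ _ => rfl
      map_id := fun _ => rfl
      map_comp := fun _ _ => rfl
      map₂_whisker_left := fun f _ _ θ => eq_sandwich _ _ _ _
        (eq_sandwich_rfl _ _ (f ◁ θ).hom.cell)
      map₂_whisker_right := fun θ g => eq_sandwich _ _ _ _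
        (eq_sandwich_rfl _ _ (θ ▷ g).hom.cell) }

/-! ### The unit of the pullback-extension context -/

theorem RCat.functor_ext {X Y : RCat.{v, u}} {F G : X ⟶ Y} (hobj : ∀ A, F.obj A = G.obj A)
    (hmap : ∀ {A B : X} (f : A ⟶ B),
      F.map f = eqToHom (hobj A) ≫ G.map f ≫ eqToHom (hobj B).symm) : F = G := by
  obtain ⟨F, hF⟩ := F
  obtain ⟨G, hG⟩ := G
  obtain rfl : F = G := CategoryTheory.Functor.ext hobj fun _ _ f => hmap f
  rfl

theorem compLaw_app {X Y Z : RCat.{v, u}} {T : X ⟶ X} {T' : Y ⟶ Y} {T'' : Z ⟶ Z} {F : X ⟶ Y}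
    {G : Y ⟶ Z} (a : T ≫ F ⟶ F ≫ T') (b : T' ≫ G ⟶ G ≫ T'') (M : X) :
    (compLaw a b).app M = G.map (a.app M) ≫ b.app (F.obj M) := by
  change 𝟙 _ ≫ G.map (a.app M) ≫ 𝟙 _ ≫ b.app (F.obj M) ≫ 𝟙 _ = _
  rw [Category.id_comp]
  refine congrArg (G.map (a.app M) ≫ ·) ?_
  exact (Category.id_comp _).trans (Category.comp_id _)

theorem twice_app {X Y : RCat.{v, u}} {T : X ⟶ X} {T' : Y ⟶ Y} {F : X ⟶ Y}
    (a : T ≫ F ⟶ F ≫ T') (M : X) :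
    (twice a).app M = a.app (T.obj M) ≫ T'.map (a.app M) := by
  change 𝟙 _ ≫ a.app (T.obj M) ≫ 𝟙 _ ≫ T'.map (a.app M) ≫ 𝟙 _ = _
  rw [Category.id_comp]
  refine congrArg (a.app (T.obj M) ≫ ·) ?_
  exact (Category.id_comp _).trans (Category.comp_id _)

theorem split_eqToHom_f {X : RCat.{v, u}} {A : X} {e e' : A ⟶ A} {he : rest e = e}
    {he' : rest e' = e'} (h : (⟨A, e, he⟩ : SplitObj X) = ⟨A, e', he'⟩) : (eqToHom h).f = e := by
  obtain rfl : e = e' := by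
    injection h
  rfl

/-- The embedding of a restriction category into its split completion, `A ↦ (A, 𝟙 A)`. -/
def unitFunctor (X : RCat.{v, max u v}) : X ⟶ (splitCompletion.{v, max u v} X).toRCat :=
  { obj := fun A => ⟨A, 𝟙 A, rest_id A⟩
    map := fun f => ⟨f, Category.id_comp f, Category.comp_id f⟩
    map_id := fun _ => rfl
    map_comp := fun _ _ => rfl
    map_rest := fun _ => rfl }

/-- The (identity) comparison of the embedding with an endofunctor. -/
def unitCell {X : RCat.{v, max u v}} (T : X ⟶ X) :
    T ≫ unitFunctor X ⟶ unitFunctor X ≫ splitMap T :=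
  { app := fun A => ⟨𝟙 (T.obj A), Category.id_comp _, by
      change 𝟙 _ ≫ T.map (𝟙 A) = _
      rw [T.map_id, Category.comp_id]⟩
    naturality := fun A B f => SplitHom.ext ((Category.comp_id _).trans (Category.id_comp _).symm)
    total := fun A => SplitHom.ext (rest_id _) }

theorem unitCell_comp {X : RCat.{v, max u v}} {S T : X ⟶ X} (a : S ⟶ T) :
    unitCell S ≫ unitFunctor X ◁ splitMap₂ a = a ▷ unitFunctor X ≫ unitCell T :=
  RCat.hom₂_ext fun M => SplitHom.ext (by
    change 𝟙 _ ≫ S.map (𝟙 M) ≫ a.app M = a.app M ≫ 𝟙 _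
    rw [S.map_id, Category.id_comp, Category.id_comp, Category.comp_id])

theorem unitCell_one (X : RCat.{v, max u v}) :
    unitCell (𝟙 X) = (λ_ (unitFunctor X)).hom ≫ (ρ_ (unitFunctor X)).inv :=
  RCat.hom₂_ext fun M => SplitHom.ext (Category.comp_id (𝟙 M)).symm

theorem unitCell_twice {X : RCat.{v, max u v}} (T : X ⟶ X) :
    twice (unitCell T) = unitCell (T ≫ T) :=
  RCat.hom₂_ext fun M => by
    rw [twice_app]
    refine SplitHom.ext ?_
    change 𝟙 _ ≫ T.map (𝟙 (T.obj M)) = 𝟙 _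
    rw [T.map_id, Category.id_comp]

/-- The embedding of a tangent restriction category into its split completion. -/
def unitMor (X : TngRCat.{v, max u v}) :
    LaxMor X.toTngPair (inclusion.obj (splitFunctor.{v, max u v}.obj X)).toTngPair where
  F := unitFunctor X.X
  α := unitCell X.D.T
  proj := (unitCell_comp X.D.p).trans (congrArg (X.D.p ▷ unitFunctor X.X ≫ ·) (unitCell_one X.X))
  zero := (unitCell_comp X.D.z).symm.trans ((congrArg
    (· ≫ unitFunctor X.X ◁ splitMap₂ X.D.z) (unitCell_one X.X)).trans (Category.assoc _ _ _))
  sum := ⟨unitCell (X.D.pow 1), fun i => unitCell_comp (X.D.π 1 i), (unitCell_comp X.D.s).symm⟩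
  lift := by
    have := (unitCell_comp X.D.l).symm
    rw [← unitCell_twice] at this
    exact this
  flip := by
    have := (unitCell_comp X.D.c).symm
    rw [← unitCell_twice] at this
    exact this

theorem split_conj {X : RCat.{v, u}} {A B : X} {e e' : A ⟶ A} {d d' : B ⟶ B} {he : rest e = e}
    {he' : rest e' = e'} {hd : rest d = d} {hd' : rest d' = d'}
    (h : (⟨A, e, he⟩ : SplitObj X) = ⟨A, e', he'⟩) (k : (⟨B, d', hd'⟩ : SplitObj X) = ⟨B, d, hd⟩)
    (g : (⟨A, e', he'⟩ : SplitObj X) ⟶ ⟨B, d', hd'⟩) : (eqToHom h ≫ g ≫ eqToHom k).f = g.f := by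
  obtain rfl : e = e' := by
    injection h
  obtain rfl : d' = d := by
    injection k
  rw [eqToHom_refl, eqToHom_refl, Category.id_comp, Category.comp_id]

theorem unitFunctor_naturality {X Y : RCat.{v, max u v}} (F : X ⟶ Y) :
    F ≫ unitFunctor Y = unitFunctor X ≫ splitMap F :=
  have hobj : ∀ A : X, (⟨F.obj A, 𝟙 (F.obj A), rest_id _⟩ : SplitObj Y) =
      ⟨F.obj A, F.map (𝟙 A), by rw [← F.map_rest, rest_id]⟩ := fun A => by
    simp only [F.map_id]
  RCat.functor_ext hobj fun {A B} f => SplitHom.ext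
    (split_conj (hobj A) (hobj B).symm ((splitMap F).map ((unitFunctor X).map f))).symm

theorem unitFunctor_naturality_app {X Y : RCat.{v, max u v}} (F : X ⟶ Y) (A : X) :
    ((eqToHom (unitFunctor_naturality F)).app A).f = 𝟙 (F.obj A) := by
  rw [RCat.eqToHom_app₀]
  exact split_eqToHom_f _

theorem unitMor_naturality {X Y : TngRCat.{v, max u v}} (f : X ⟶ Y) :
    f ≫ InducedBicategory.mkHom (unitMor Y) = InducedBicategory.mkHom (unitMor X) ≫
      inclusion.map (splitFunctor.map f) :=
  InducedBicategory.hom_ext (LaxMor.ext_of_comm (unitFunctor_naturality f.hom.F)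
    (RCat.hom₂_ext fun M => SplitHom.ext (by
      have e : ∀ N, ((eqToHom (unitFunctor_naturality f.hom.F)).app N).f = 𝟙 (f.hom.F.obj N) :=
        unitFunctor_naturality_app f.hom.F
      have l : (compLaw f.hom.α (unitCell Y.D.T)).app M = _ := compLaw_app _ _ _
      have r : (compLaw (T'' := splitMap Y.D.T) (G := splitMap f.hom.F) (unitCell X.D.T)
        (splitMap₂ f.hom.α)).app M = _ := compLaw_app _ _ _
      change ((compLaw f.hom.α (unitCell Y.D.T)).app M).f ≫
        Y.D.T.map ((eqToHom (unitFunctor_naturality f.hom.F)).app M).f =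
        ((eqToHom (unitFunctor_naturality f.hom.F)).app (X.D.T.obj M)).f ≫
          ((compLaw (T'' := splitMap Y.D.T) (G := splitMap f.hom.F) (unitCell X.D.T)
            (splitMap₂ f.hom.α)).app M).f
      rw [e, e, l, r]
      change (f.hom.α.app M ≫ 𝟙 _) ≫ Y.D.T.map (𝟙 _) =
        𝟙 _ ≫ f.hom.F.map (𝟙 _) ≫ f.hom.F.map (X.D.T.map (𝟙 _)) ≫ f.hom.α.app M
      rw [X.D.T.map_id, f.hom.F.map_id, Y.D.T.map_id, Category.comp_id, Category.id_comp]
      exact (Category.comp_id _).trans ((Category.id_comp _).trans (Category.id_comp _)).symm)))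

theorem unitFunctor_naturality₂ {X Y : RCat.{v, max u v}} {F G : X ⟶ Y} (t : F ⟶ G) :
    t ▷ unitFunctor Y ≫ eqToHom (unitFunctor_naturality G) =
      eqToHom (unitFunctor_naturality F) ≫ unitFunctor X ◁ splitMap₂ t :=
  RCat.hom₂_ext fun M => SplitHom.ext (by
    change t.app M ≫ ((eqToHom (unitFunctor_naturality G)).app M).f =
      ((eqToHom (unitFunctor_naturality F)).app M).f ≫ F.map (𝟙 M) ≫ t.app M
    have e : F.map (𝟙 M) ≫ t.app M = t.app M := by rw [F.map_id, Category.id_comp]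
    rw [unitFunctor_naturality_app, unitFunctor_naturality_app]
    exact (Category.comp_id _).trans ((Category.id_comp _).trans e).symm)

theorem comp_eqToHom_cell {K : Type u} [Bicategory.{w, v} K] {J : Type u'} {F : J → TngPair K}
    {A B : InducedBicategory (TngPair K) F} {f g g' : A ⟶ B} (a : f ⟶ g) (k : g = g') :
    (a ≫ eqToHom k).hom.cell = a.hom.cell ≫ eqToHom (congrArg (fun k => k.hom.F) k) := by
  subst k
  simp only [eqToHom_refl, Category.comp_id]

theorem eqToHom_comp_cell {K : Type u} [Bicategory.{w, v} K] {J : Type u'} {F : J → TngPair K}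
    {A B : InducedBicategory (TngPair K) F} {f f' g : A ⟶ B} (k : f = f') (a : f' ⟶ g) :
    (eqToHom k ≫ a).hom.cell = eqToHom (congrArg (fun k => k.hom.F) k) ≫ a.hom.cell := by
  subst k
  simp only [eqToHom_refl, Category.id_comp]

theorem unitMor_naturality₂ {X Y : TngRCat.{v, max u v}} {f g : X ⟶ Y} (θ : f ⟶ g) :
    θ ▷ InducedBicategory.mkHom (unitMor Y) ≫ eqToHom (unitMor_naturality g) =
      eqToHom (unitMor_naturality f) ≫ InducedBicategory.mkHom (unitMor X) ◁
        inclusion.map₂ (splitFunctor.map₂ θ) := by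
  refine InducedBicategory.hom₂_ext (TngPair.hom₂_ext ?_)
  rw [comp_eqToHom_cell, eqToHom_comp_cell]
  exact unitFunctor_naturality₂ θ.hom.cell

/-- The pullback-extension context of tangent restriction categories. -/
def tngRCatContext :
    PullbackExtensionContext sRCat.{v, max u v} TngRCat.{v, max u v} where
  Ξ := splitFunctor.{v, max u v}
  Inc := inclusion
  η X := InducedBicategory.mkHom (unitMor X)
  naturality f := unitMor_naturality f
  naturality₂ θ := unitMor_naturality₂ θ

/-! ### Vector fields of a tangent restriction category -/

/-- A vector field: a total section of the projection. -/
structure VFObj {X : RCat.{v, u}} (D : TangentData X) where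
  M : X
  v : M ⟶ D.T.obj M
  total : IsTotal v
  sect : v ≫ D.projAt M = 𝟙 M

/-- Morphisms commuting strictly with the vector fields. -/
@[ext]
structure VFHom {X : RCat.{v, u}} {D : TangentData X} (P Q : VFObj D) where
  f : P.M ⟶ Q.M
  comm : P.v ≫ D.T.map f = f ≫ Q.v

section VF

variable {X : RCat.{v, u}} {D : TangentData X}

instance : Category (VFObj D) where
  Hom P Q := VFHom P Q
  id P := ⟨𝟙 P.M, by rw [D.T.map_id, Category.comp_id, Category.id_comp]⟩
  comp g k := ⟨g.f ≫ k.f, by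
    rw [D.T.map_comp, ← Category.assoc, g.comm, Category.assoc, k.comm, Category.assoc]⟩
  id_comp g := VFHom.ext (Category.id_comp g.f)
  comp_id g := VFHom.ext (Category.comp_id g.f)
  assoc g k l := VFHom.ext (Category.assoc g.f k.f l.f)

instance : RestrictionCategory (VFObj D) where
  rest {P Q} g := ⟨rest g.f, by
    rw [D.T.map_rest, comp_rest, g.comm, Q.total.rest_comp]⟩
  rest_comp_self g := VFHom.ext (rest_comp_self g.f)
  rest_comm g k := VFHom.ext (rest_comm g.f k.f)
  rest_rest_comp g k := VFHom.ext (rest_rest_comp g.f k.f)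
  comp_rest g k := VFHom.ext (comp_rest g.f k.f)

variable (D) in
/-- The restriction category of vector fields. -/
abbrev vfCat : RCat.{v, max u v} where
  carrier := VFObj D

/-- The functor that forgets the vector field. -/
abbrev vfForget {X : RCat.{v, max u v}} (D : TangentData X) : vfCat.{v, max u v} D ⟶ X :=
  { obj := fun P => P.M
    map := fun g => g.f
    map_id := fun _ => rfl
    map_comp := fun _ _ => rfl
    map_rest := fun _ => rfl }

namespace TangentData

theorem proj_naturality (D : TangentData X) {M N : X} (f : M ⟶ N) :
    D.T.map f ≫ D.projAt N = D.projAt M ≫ f := D.p.naturality f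

theorem zero_naturality (D : TangentData X) {M N : X} (f : M ⟶ N) :
    f ≫ D.zeroAt N = D.zeroAt M ≫ D.T.map f := D.z.naturality f

theorem flip_naturality (D : TangentData X) {M N : X} (f : M ⟶ N) :
    D.T.map (D.T.map f) ≫ D.flipAt N = D.flipAt M ≫ D.T.map (D.T.map f) := D.c.naturality f

theorem lift_naturality (D : TangentData X) {M N : X} (f : M ⟶ N) :
    D.T.map f ≫ D.liftAt N = D.liftAt M ≫ D.T.map (D.T.map f) := D.l.naturality f

theorem pr_naturality (D : TangentData X) (n : ℕ) (i : Fin (n + 1)) {M N : X} (f : M ⟶ N) :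
    (D.pow n).map f ≫ D.prAt N n i = D.prAt M n i ≫ D.T.map f := (D.π n i).naturality f

theorem sum_naturality (D : TangentData X) {M N : X} (f : M ⟶ N) :
    (D.pow 1).map f ≫ D.sumAt N = D.sumAt M ≫ D.T.map f := D.s.naturality f

namespace IsTangentRestriction

theorem flip_proj (h : D.IsTangentRestriction) (M : X) : D.flipAt M ≫ D.projAt (D.T.obj M) = D.T.map (D.projAt M) :=
  (h.flip_additive M).proj.trans (Category.comp_id _)

theorem flip_map_proj (h : D.IsTangentRestriction) (M : X) : D.flipAt M ≫ D.T.map (D.projAt M) = D.projAt (D.T.obj M) := by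
  rw [← h.flip_proj, ← Category.assoc, h.flip_flip, Category.id_comp]

theorem map_zero_flip (h : D.IsTangentRestriction) (M : X) : D.T.map (D.zeroAt M) ≫ D.flipAt M = D.zeroAt (D.T.obj M) :=
  (h.flip_additive M).zero.trans (Category.id_comp _)

theorem zero_flip (h : D.IsTangentRestriction) (M : X) : D.zeroAt (D.T.obj M) ≫ D.flipAt M = D.T.map (D.zeroAt M) := by
  rw [← h.map_zero_flip, Category.assoc, h.flip_flip, Category.comp_id]

theorem pow_limit₀ (h : D.IsTangentRestriction) (n : ℕ) (M : X) : IsWidePullbackCone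
    (fun _ : Fin (n + 1) => D.projAt M) (fun i => D.prAt M n i) := h.pow_limit' n 0 M

theorem pow_limit₁ (h : D.IsTangentRestriction) (n : ℕ) (M : X) : IsWidePullbackCone
    (fun _ : Fin (n + 1) => D.T.map (D.projAt M)) (fun i => D.T.map (D.prAt M n i)) :=
  h.pow_limit' n 1 M

/-- The tangent bundle of a vector field. -/
def vfT (h : D.IsTangentRestriction) (P : VFObj D) : VFObj D where
  M := D.T.obj P.M
  v := D.T.map P.v ≫ D.flipAt P.M
  total := (RCat.map_total D.T P.total).comp (D.c.total P.M)
  sect := by rw [Category.assoc, h.flip_proj, ← D.T.map_comp, P.sect, D.T.map_id]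

theorem exists_powField (h : D.IsTangentRestriction) (n : ℕ) (P : VFObj D) :
    ∃ k : (D.pow n).obj P.M ⟶ D.T.obj ((D.pow n).obj P.M),
      ∀ i, k ≫ D.T.map (D.prAt P.M n i) = D.prAt P.M n i ≫ D.T.map P.v ≫ D.flipAt P.M :=
  ((h.pow_limit₁ n P.M).lift _ (fun i => D.prAt P.M n i ≫ D.T.map P.v ≫ D.flipAt P.M)
    fun i j => by
      have e : ∀ i, (D.prAt P.M n i ≫ D.T.map P.v ≫ D.flipAt P.M) ≫ D.T.map (D.projAt P.M) =
          (D.prAt P.M n i ≫ D.projAt P.M) ≫ P.v := fun i => by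
        rw [Category.assoc, Category.assoc, h.flip_map_proj, D.proj_naturality, Category.assoc]
      rw [e, e, (h.pow_limit₀ n P.M).comm i j]).exists

/-- The vector field on a fibre power of the tangent bundle. -/
noncomputable def powField (h : D.IsTangentRestriction) (n : ℕ) (P : VFObj D) :
    (D.pow n).obj P.M ⟶ D.T.obj ((D.pow n).obj P.M) := (h.exists_powField n P).choose

theorem powField_pr (h : D.IsTangentRestriction) (n : ℕ) (P : VFObj D) (i : Fin (n + 1)) :
    h.powField n P ≫ D.T.map (D.prAt P.M n i) =
      D.prAt P.M n i ≫ D.T.map P.v ≫ D.flipAt P.M := (h.exists_powField n P).choose_spec i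

/-- The fibre powers of the tangent bundle of a vector field. -/
noncomputable def vfPow (h : D.IsTangentRestriction) (n : ℕ) (P : VFObj D) : VFObj D where
  M := (D.pow n).obj P.M
  v := h.powField n P
  total := by
    refine IsTotal.of_comp (g := D.T.map (D.prAt P.M n 0)) ?_
    rw [h.powField_pr]
    exact ((D.π n 0).total P.M).comp (h.vfT P).total
  sect := (h.pow_limit₀ n P.M).hom_ext fun i => by
    rw [Category.id_comp, Category.assoc, ← D.proj_naturality, ← Category.assoc, h.powField_pr,
      Category.assoc]
    have := (h.vfT P).sect
    change (D.T.map P.v ≫ D.flipAt P.M) ≫ D.projAt _ = 𝟙 _ at this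
    rw [this, Category.comp_id]

/-- The tangent bundle functor on vector fields. -/
def vfTan (h : D.IsTangentRestriction) : vfCat D ⟶ vfCat D :=
  { obj := h.vfT
    map := fun {P Q} g => ⟨D.T.map g.f, by
      change (D.T.map P.v ≫ D.flipAt P.M) ≫ D.T.map (D.T.map g.f) =
        D.T.map g.f ≫ D.T.map Q.v ≫ D.flipAt Q.M
      rw [Category.assoc, ← D.flip_naturality, ← Category.assoc, ← D.T.map_comp, g.comm,
        D.T.map_comp, Category.assoc]⟩
    map_id := fun P => VFHom.ext (D.T.map_id P.M)
    map_comp := fun g k => VFHom.ext (D.T.map_comp g.f k.f)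
    map_rest := fun g => VFHom.ext (D.T.map_rest g.f) }

/-- The fibre powers of the projection on vector fields. -/
noncomputable def vfPowFunctor (h : D.IsTangentRestriction) (n : ℕ) : vfCat D ⟶ vfCat D :=
  { obj := h.vfPow n
    map := fun {P Q} g => ⟨(D.pow n).map g.f, (h.pow_limit₁ n Q.M).hom_ext fun i => by
      change (h.powField n P ≫ D.T.map ((D.pow n).map g.f)) ≫ _ =
        ((D.pow n).map g.f ≫ h.powField n Q) ≫ _
      rw [Category.assoc, ← D.T.map_comp, D.pr_naturality, D.T.map_comp, ← Category.assoc,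
        h.powField_pr, Category.assoc ((D.pow n).map g.f), h.powField_pr,
        ← Category.assoc ((D.pow n).map g.f), D.pr_naturality]
      simp only [Category.assoc]
      rw [← D.flip_naturality, ← Category.assoc (D.T.map P.v), ← D.T.map_comp, g.comm,
        D.T.map_comp, Category.assoc]⟩
    map_id := fun P => VFHom.ext ((D.pow n).map_id P.M)
    map_comp := fun g k => VFHom.ext ((D.pow n).map_comp g.f k.f)
    map_rest := fun g => VFHom.ext ((D.pow n).map_rest g.f) }

theorem sum_field (h : D.IsTangentRestriction) (P : VFObj D) :
    h.powField 1 P ≫ D.T.map (D.sumAt P.M) = D.sumAt P.M ≫ D.T.map P.v ≫ D.flipAt P.M := by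
  have := (h.flip_additive P.M).sum (h.powField 1 P) ((D.pow 1).map P.v) (by
    change (D.pow 1).map P.v ≫ D.prAt _ 1 0 = h.powField 1 P ≫ D.T.map (D.prAt _ 1 0) ≫ D.flipAt _
    rw [D.pr_naturality, ← Category.assoc, h.powField_pr, Category.assoc, Category.assoc,
      h.flip_flip, Category.comp_id]) (by
    change (D.pow 1).map P.v ≫ D.prAt _ 1 1 = h.powField 1 P ≫ D.T.map (D.prAt _ 1 1) ≫ D.flipAt _
    rw [D.pr_naturality, ← Category.assoc, h.powField_pr, Category.assoc, Category.assoc,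
      h.flip_flip, Category.comp_id])
  change (D.pow 1).map P.v ≫ D.sumAt (D.T.obj P.M) =
    h.powField 1 P ≫ D.T.map (D.sumAt P.M) ≫ D.flipAt P.M at this
  rw [← Category.assoc, ← D.sum_naturality, this, Category.assoc, Category.assoc, h.flip_flip,
    Category.comp_id]

/-- The tangent structure on vector fields: `T (M, v) = (T M, c ∘ T v)`. -/
noncomputable def vfData (h : D.IsTangentRestriction) : TangentData (vfCat D) where
  T := h.vfTan
  p :=
    { app := fun P => ⟨D.projAt P.M, by
        change (D.T.map P.v ≫ D.flipAt P.M) ≫ D.T.map (D.projAt P.M) = D.projAt P.M ≫ P.v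
        rw [Category.assoc, h.flip_map_proj, D.proj_naturality]⟩
      naturality := fun _ _ g => VFHom.ext (D.p.naturality g.f)
      total := fun P => VFHom.ext (D.p.total P.M) }
  pow := h.vfPowFunctor
  π n i :=
    { app := fun P => ⟨D.prAt P.M n i, h.powField_pr n P i⟩
      naturality := fun _ _ g => VFHom.ext ((D.π n i).naturality g.f)
      total := fun P => VFHom.ext ((D.π n i).total P.M) }
  z :=
    { app := fun P => ⟨D.zeroAt P.M, by
        change _ = D.zeroAt P.M ≫ D.T.map P.v ≫ D.flipAt P.M
        rw [← Category.assoc, ← D.zero_naturality, Category.assoc, h.zero_flip]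
        rfl⟩
      naturality := fun _ _ g => VFHom.ext (D.z.naturality g.f)
      total := fun P => VFHom.ext (D.z.total P.M) }
  s :=
    { app := fun P => ⟨D.sumAt P.M, h.sum_field P⟩
      naturality := fun _ _ g => VFHom.ext (D.s.naturality g.f)
      total := fun P => VFHom.ext (D.s.total P.M) }
  l :=
    { app := fun P => ⟨D.liftAt P.M, by
        change (D.T.map P.v ≫ D.flipAt P.M) ≫ D.T.map (D.liftAt P.M) =
          D.liftAt P.M ≫ D.T.map (D.T.map P.v ≫ D.flipAt P.M) ≫ D.flipAt (D.T.obj P.M)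
        rw [Category.assoc, ← h.lift_flip_flip, D.T.map_comp, Category.assoc, ← Category.assoc,
          D.lift_naturality, Category.assoc]⟩
      naturality := fun _ _ g => VFHom.ext (D.l.naturality g.f)
      total := fun P => VFHom.ext (D.l.total P.M) }
  c :=
    { app := fun P => ⟨D.flipAt P.M, by
        change (D.T.map (D.T.map P.v ≫ D.flipAt P.M) ≫ D.flipAt (D.T.obj P.M)) ≫
          D.T.map (D.flipAt P.M) = D.flipAt P.M ≫ D.T.map (D.T.map P.v ≫ D.flipAt P.M) ≫
            D.flipAt (D.T.obj P.M)
        rw [D.T.map_comp, Category.assoc, Category.assoc, h.flip_braid, Category.assoc,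
          ← Category.assoc, D.flip_naturality, Category.assoc]⟩
      naturality := fun _ _ g => VFHom.ext (D.c.naturality g.f)
      total := fun P => VFHom.ext (D.c.total P.M) }

end IsTangentRestriction

end TangentData

end VF

section VF

variable {X : RCat.{v, u}} {D : TangentData X}

theorem vf_widePullback {ι : Type w} {B P : VFObj D} {E : ι → VFObj D} {q : ∀ i, E i ⟶ B}
    {pr : ∀ i, P ⟶ E i} (H : IsWidePullbackCone (fun i => (q i).f) (fun i => (pr i).f))
    (H₁ : IsWidePullbackCone (fun i => D.T.map (q i).f) (fun i => D.T.map (pr i).f)) :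
    IsWidePullbackCone q pr := by
  refine ⟨fun i j => VFHom.ext (H.comm i j), fun Q x hx => ?_⟩
  obtain ⟨k, hk, hu⟩ := H.lift Q.M (fun i => (x i).f) fun i j => congrArg VFHom.f (hx i j)
  refine ⟨⟨k, H₁.hom_ext fun i => ?_⟩, fun i => VFHom.ext (hk i), fun k' hk' =>
    VFHom.ext (hu k'.f fun i => congrArg VFHom.f (hk' i))⟩
  have hk' : ∀ i, k ≫ (pr i).f = (x i).f := hk
  rw [Category.assoc, ← D.T.map_comp, hk', (x i).comm, Category.assoc, (pr i).comm,
    ← Category.assoc, hk']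

theorem vf_isPullback {P A B E : VFObj D} {fst : P ⟶ A} {snd : P ⟶ B} {f : A ⟶ E}
    {g : B ⟶ E} (H : IsPullback fst.f snd.f f.f g.f)
    (H₁ : ∀ {Q : X} (a b : Q ⟶ D.T.obj P.M), a ≫ D.T.map fst.f = b ≫ D.T.map fst.f →
      a ≫ D.T.map snd.f = b ≫ D.T.map snd.f → a = b) : IsPullback fst snd f g := by
  have key : ∀ (Q : VFObj D) (x : Q ⟶ A) (y : Q ⟶ B), x ≫ f = y ≫ g →
      ∃ k : Q ⟶ P, k ≫ fst = x ∧ k ≫ snd = y := fun Q x y hxy => by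
    have e : x.f ≫ f.f = y.f ≫ g.f := congrArg VFHom.f hxy
    refine ⟨⟨H.lift x.f y.f e, H₁ _ _ ?_ ?_⟩, VFHom.ext (H.lift_fst _ _ _),
      VFHom.ext (H.lift_snd _ _ _)⟩
    · rw [Category.assoc, ← D.T.map_comp, H.lift_fst, x.comm, Category.assoc, fst.comm,
        ← Category.assoc, H.lift_fst]
    · rw [Category.assoc, ← D.T.map_comp, H.lift_snd, y.comm, Category.assoc, snd.comm,
        ← Category.assoc, H.lift_snd]
  refine ⟨⟨VFHom.ext H.w⟩, ⟨Limits.PullbackCone.IsLimit.mk _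
    (fun s => (key s.pt s.fst s.snd s.condition).choose)
    (fun s => (key s.pt s.fst s.snd s.condition).choose_spec.1)
    (fun s => (key s.pt s.fst s.snd s.condition).choose_spec.2) fun s m h1 h2 => ?_⟩⟩
  have k1 := congrArg VFHom.f (h1.trans (key s.pt s.fst s.snd s.condition).choose_spec.1.symm)
  have k2 := congrArg VFHom.f (h2.trans (key s.pt s.fst s.snd s.condition).choose_spec.2.symm)
  exact VFHom.ext (H.hom_ext k1 k2)

namespace TangentData

namespace IsTangentRestriction

/-- The image under `T` of the universality diagram of the vertical lift is jointly monic. -/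
theorem lift_jointly_mono (h : D.IsTangentRestriction) (M : X)
    (w : (D.pow 1).obj M ⟶ D.T.obj ((D.pow 1).obj M))
    (h0 : w ≫ D.T.map (D.prAt M 1 0) = D.prAt M 1 0 ≫ D.liftAt M)
    (h1 : w ≫ D.T.map (D.prAt M 1 1) = D.prAt M 1 1 ≫ D.zeroAt (D.T.obj M)) {Q : X}
    (a b : Q ⟶ D.T.obj ((D.pow 1).obj M))
    (e₁ : a ≫ D.T.map (w ≫ D.T.map (D.sumAt M)) = b ≫ D.T.map (w ≫ D.T.map (D.sumAt M)))
    (e₂ : a ≫ D.T.map (D.prAt M 1 0 ≫ D.projAt M) = b ≫ D.T.map (D.prAt M 1 0 ≫ D.projAt M)) :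
    a = b := by
  obtain ⟨θ, hθ, -⟩ := (h.pow_limit₀ 1 (D.T.obj M)).lift (D.T.obj ((D.pow 1).obj M))
    (fun i => D.T.map (D.prAt M 1 i) ≫ D.flipAt M) fun i j => by
      rw [Category.assoc, h.flip_proj, Category.assoc, h.flip_proj]
      exact (h.pow_limit₁ 1 M).comm i j
  replace hθ : ∀ i, θ ≫ D.prAt (D.T.obj M) 1 i = D.T.map (D.prAt M 1 i) ≫ D.flipAt M := hθ
  obtain ⟨τ, t0, t1⟩ := h.exists_lift_cell
  have hs : θ ≫ D.sumAt (D.T.obj M) = D.T.map (D.sumAt M) ≫ D.flipAt M := by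
    have := (h.flip_additive M).sum (𝟙 _) θ ((hθ 0).trans (Category.id_comp _).symm)
      ((hθ 1).trans (Category.id_comp _).symm)
    exact this.trans (Category.id_comp _)
  have hl : D.T.map (D.liftAt M) ≫ D.flipAt (D.T.obj M) ≫ D.T.map (D.flipAt M) =
      D.flipAt M ≫ D.liftAt (D.T.obj M) := by
    have e : D.T.map (D.liftAt M) = D.flipAt M ≫ D.liftAt (D.T.obj M) ≫ D.T.map (D.flipAt M) ≫
        D.flipAt (D.T.obj M) := by
      rw [h.lift_flip_flip, ← Category.assoc, h.flip_flip, Category.id_comp]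
    have e' : D.T.map (D.flipAt M) ≫ D.T.map (D.flipAt M) = 𝟙 _ := by
      rw [← D.T.map_comp, h.flip_flip, D.T.map_id]
    rw [e]
    simp only [Category.assoc]
    rw [reassoc_of% (h.flip_flip (D.T.obj M)), e', Category.comp_id]
  have hw : D.T.map w ≫ D.flipAt ((D.pow 1).obj M) ≫ D.T.map θ = θ ≫ τ.app (D.T.obj M) := by
    refine (h.pow_limit₁ 1 (D.T.obj M)).hom_ext fun i => ?_
    have a1 : (D.T.map w ≫ D.flipAt ((D.pow 1).obj M) ≫ D.T.map θ) ≫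
        D.T.map (D.prAt (D.T.obj M) 1 i) =
        D.T.map (w ≫ D.T.map (D.prAt M 1 i)) ≫ D.flipAt (D.T.obj M) ≫ D.T.map (D.flipAt M) := by
      rw [Category.assoc, Category.assoc, ← D.T.map_comp, hθ, D.T.map_comp, D.T.map_comp,
        ← Category.assoc (D.flipAt _), ← D.flip_naturality, Category.assoc, Category.assoc]
    rw [a1, Category.assoc]
    fin_cases i
    · refine (congrArg (fun t => D.T.map t ≫ _) h0).trans (Eq.trans ?_
        (congrArg (θ ≫ ·) (t0 (D.T.obj M))).symm)
      rw [D.T.map_comp, Category.assoc, hl, ← Category.assoc θ, hθ, Category.assoc]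
    · refine (congrArg (fun t => D.T.map t ≫ _) h1).trans (Eq.trans ?_
        (congrArg (θ ≫ ·) (t1 (D.T.obj M))).symm)
      rw [D.T.map_comp, Category.assoc, ← Category.assoc (D.T.map (D.zeroAt _)), h.map_zero_flip,
        ← Category.assoc θ, hθ, Category.assoc, D.zero_naturality]
  have hfst : D.T.map (w ≫ D.T.map (D.sumAt M)) ≫ D.flipAt (D.T.obj M) ≫ D.T.map (D.flipAt M) =
      θ ≫ τ.app (D.T.obj M) ≫ D.T.map (D.sumAt (D.T.obj M)) := by
    rw [← Category.assoc θ, ← hw, D.T.map_comp, Category.assoc,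
      ← Category.assoc (D.T.map (D.T.map (D.sumAt M))), D.flip_naturality, Category.assoc,
      ← D.T.map_comp, ← hs, D.T.map_comp, Category.assoc, Category.assoc]
  have hsnd : D.T.map (D.prAt M 1 0 ≫ D.projAt M) =
      θ ≫ D.prAt (D.T.obj M) 1 0 ≫ D.projAt (D.T.obj M) := by
    rw [D.T.map_comp, ← Category.assoc, hθ, Category.assoc, h.flip_proj]
  have hθm : a ≫ θ = b ≫ θ := by
    refine (h.lift_universal' (D.T.obj M) (τ.app (D.T.obj M)) (t0 _) (t1 _)).hom_ext ?_ ?_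
    · rw [Category.assoc, ← hfst, ← Category.assoc, e₁, Category.assoc, hfst, Category.assoc]
    · rw [Category.assoc, ← hsnd, e₂, hsnd, Category.assoc]
  refine (h.pow_limit₁ 1 M).hom_ext fun i => ?_
  have e : D.T.map (D.prAt M 1 i) = θ ≫ D.prAt (D.T.obj M) 1 i ≫ D.flipAt M := by
    rw [← Category.assoc, hθ, Category.assoc, h.flip_flip, Category.comp_id]
  rw [e, ← Category.assoc, hθm, Category.assoc]

end IsTangentRestriction

end TangentData

end VF

section VF

variable {X : RCat.{v, max u v}} {D : TangentData X}

theorem vf_iter (h : D.IsTangentRestriction) (m : ℕ) :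
    iter h.vfTan m ≫ vfForget.{v, u} D = vfForget.{v, u} D ≫ iter D.T m := by
  induction m with
  | zero => rfl
  | succ m ih => exact congrArg (fun F => F ≫ D.T) ih

theorem vf_iter_limit (h : D.IsTangentRestriction) (n m : ℕ) (P : VFObj D)
    (F : vfCat D ⟶ X) (hF : F = vfForget.{v, u} D ≫ iter D.T m) :
    IsWidePullbackCone (fun _ : Fin (n + 1) => F.map (h.vfData.projAt P))
      (fun i => F.map (h.vfData.prAt P n i)) := by
  subst hF
  exact h.pow_limit' n m P.M

/-- The vector fields of a tangent restriction category form a tangent restriction category. -/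
theorem TangentData.IsTangentRestriction.vf (h : D.IsTangentRestriction) :
    h.vfData.IsTangentRestriction where
  bundle_additive P :=
    { zero_proj := VFHom.ext (h.bundle_additive P.M).zero_proj
      sum_proj := VFHom.ext (h.bundle_additive P.M).sum_proj
      sum_assoc := fun u v w w' h1 h2 h3 h4 h5 => VFHom.ext
        ((h.bundle_additive P.M).sum_assoc u.f v.f w.f w'.f (congrArg VFHom.f h1)
          (congrArg VFHom.f h2) (congrArg VFHom.f h3) (congrArg VFHom.f h4) (congrArg VFHom.f h5))
      zero_sum := fun u h1 => VFHom.ext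
        ((h.bundle_additive P.M).zero_sum u.f (congrArg VFHom.f h1))
      sum_comm := fun u v h1 h2 => VFHom.ext
        ((h.bundle_additive P.M).sum_comm u.f v.f (congrArg VFHom.f h1) (congrArg VFHom.f h2)) }
  pow_limit n m P := (isRestrictionWidePullback_iff fun _ =>
    RCat.map_total _ (h.vfData.p.total P)).2
      (vf_widePullback (vf_iter_limit h n m P (iter h.vfTan m ≫ vfForget.{v, u} D) (vf_iter h m))
        (vf_iter_limit h n (m + 1) P (iter h.vfTan (m + 1) ≫ vfForget.{v, u} D)
          (vf_iter h (m + 1))))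
  lift_additive P :=
    { proj := VFHom.ext (h.lift_additive P.M).proj
      zero := VFHom.ext (h.lift_additive P.M).zero
      sum := fun u u' h1 h2 => VFHom.ext
        ((h.lift_additive P.M).sum u.f u'.f (congrArg VFHom.f h1) (congrArg VFHom.f h2)) }
  flip_additive P :=
    { proj := VFHom.ext (h.flip_additive P.M).proj
      zero := VFHom.ext (h.flip_additive P.M).zero
      sum := fun u u' h1 h2 => VFHom.ext
        ((h.flip_additive P.M).sum u.f u'.f (congrArg VFHom.f h1) (congrArg VFHom.f h2)) }
  lift_coassoc P := VFHom.ext (h.lift_coassoc P.M)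
  lift_flip P := VFHom.ext (h.lift_flip P.M)
  lift_flip_flip P := VFHom.ext (h.lift_flip_flip P.M)
  flip_flip P := VFHom.ext (h.flip_flip P.M)
  flip_braid P := VFHom.ext (h.flip_braid P.M)
  lift_universal P w h0 h1 := (isRestrictionPullback_iff
    (RCat.map_total _ (h.vfData.p.total P)) (h.vfData.z.total P)).2
    (vf_isPullback (h.lift_universal' P.M w.f (congrArg VFHom.f h0) (congrArg VFHom.f h1))
      (h.lift_jointly_mono P.M w.f (congrArg VFHom.f h0) (congrArg VFHom.f h1)))

end VF

/-- The tangent restriction category of vector fields. -/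
noncomputable def VF (X : TngRCat.{v, max u v}) : TngRCat.{v, max u v} :=
  TangentRestrictionCategory.mk ⟨vfCat.{v, max u v} X.D, X.isTangentRestriction.vfData⟩
    (TangentData.IsTangentRestriction.vf.{v, u} X.isTangentRestriction)

/-- The strict tangent restriction functor that forgets the vector field. -/
noncomputable def VF.forget (X : TngRCat.{v, max u v}) : VF.{v, u} X ⟶ X :=
  InducedBicategory.mkHom
    { F := vfForget.{v, u} X.D
      α := 𝟙 _
      proj := RCat.hom₂_ext fun P => by
        change 𝟙 _ ≫ X.D.projAt P.M = X.D.projAt P.M ≫ 𝟙 P.M ≫ 𝟙 P.M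
        rw [Category.id_comp, Category.comp_id, Category.comp_id]
      zero := RCat.hom₂_ext fun P => by
        change X.D.zeroAt P.M ≫ 𝟙 _ = 𝟙 P.M ≫ 𝟙 P.M ≫ X.D.zeroAt P.M
        rw [Category.comp_id, Category.id_comp, Category.id_comp]
      sum := by
        refine ⟨𝟙 _, fun i => RCat.hom₂_ext fun P => ?_, RCat.hom₂_ext fun P => ?_⟩
        · exact (Category.id_comp (X.D.prAt P.M 1 i)).trans (Category.comp_id _).symm
        · exact (Category.comp_id (X.D.sumAt P.M)).trans (Category.id_comp _).symm
      lift := by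
        refine RCat.hom₂_ext fun P => (congrArg (X.D.liftAt P.M ≫ ·) (twice_app _ P)).trans ?_
        change X.D.liftAt P.M ≫ 𝟙 _ ≫ X.D.T.map (𝟙 _) = 𝟙 _ ≫ X.D.liftAt P.M
        rw [X.D.T.map_id, Category.comp_id, Category.comp_id, Category.id_comp]
      flip := by
        refine RCat.hom₂_ext fun P => (congrArg (X.D.flipAt P.M ≫ ·) (twice_app _ P)).trans
          (Eq.trans ?_ (congrArg (· ≫ X.D.flipAt P.M) (twice_app _ P)).symm)
        change X.D.flipAt P.M ≫ 𝟙 _ ≫ X.D.T.map (𝟙 _) = (𝟙 _ ≫ X.D.T.map (𝟙 _)) ≫ X.D.flipAt P.M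
        rw [X.D.T.map_id, Category.comp_id, Category.comp_id]
        exact (Category.id_comp _).symm }

end TangentVF

open TangentVF

namespace TangentVF

open RestrictionCategory

/-! ### The universal property of the vector fields of a tangent restriction category -/

/-! Vector fields are computed componentwise, and the embedding into the split completion does not
change what a vector field on an object is.

Let `X` be any tangent restriction category. A lax tangent functor `Z ⟶ VF X` is the same thing as a
lax tangent functor `G : Z ⟶ X` with a natural family of total sections `w_A : G A ⟶ T (G A)`
compatible with the distributive law; this is `FieldAlong G`. Naturality of `w` says that each `G f`
is a morphism of vector fields. Compatibility with the law, composed once with the involution `c`,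
says the same of each component of the law. So `G` lifts (`FieldAlong.lift`), and conversely every
functor into `VF X` carries such a family (`VF.field`); the two passages are mutually inverse on the
nose (`FieldAlong.lift_forget`, `VF.hom_ext`). On 2-cells, lifting through the forgetful functor is
a property, namely commutation with the fields (`VF.lift₂`, `VF.hom₂_ext`). Nothing here needs
idempotents to split.

If idempotents of `X` split, they also split in `VF X` (`vf_isSplit`): a splitting `r`, `m` of `e`
on `(M, v)` carries the field `m ≫ v ≫ T r`. Hence `VF X` is a tangentad in `sRCat`, and the
universal property above, read in `Tng sRCat`, makes it a tangentad of vector fields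
(`vfTngUniversal`). This settles existence for the split completion.

For general `X`, the embedding `η` is fully faithful and commutes with the tangent structure through
cells whose underlying maps are identities. A field along `G ≫ η` is therefore just a field along
`G`. A cone over the cospan consists of `a : Z ⟶ X` and `b : Z ⟶ VF (Split X)` with `a ≫ η` equal to
the functor underlying `b`. The fields of `b` then live along `a ≫ η`, so they descend to `a` and
give the unique functor `Z ⟶ VF X` (`vf_isTwoPullback`).

Finally, the universal property fixes the tangentad of vector fields up to an isomorphism that
matches the universal fields (`UniversalVectorField.exists_iso`), and strict 2-pullbacks can be
carried along such an isomorphism (`IsTwoPullback.of_iso`). This yields the square for every choice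
of universal vector field, together with the formula for its comparison functor. -/

/-- A vector field along a lax tangent restriction functor, in components. -/
@[ext]
structure FieldAlong {Z X : TngRCat.{v, u}} (G : Z ⟶ X) where
  cell : G.hom.F ⟶ G.hom.F ≫ X.D.T
  sect : ∀ A, cell.app A ≫ X.D.projAt (G.hom.F.obj A) = 𝟙 (G.hom.F.obj A)
  comm : ∀ A, G.hom.α.app A ≫ X.D.T.map (cell.app A) =
    cell.app (Z.D.T.obj A) ≫ X.D.T.map (G.hom.α.app A) ≫ X.D.flipAt (G.hom.F.obj A)

/-! ### Lifting a functor with a field along it to vector fields -/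

namespace FieldAlong

/-- Naturality of the field, turned around so that it is literally the condition for `G f` to be a
morphism in `VF X`. -/
theorem field_map {Z X : TngRCat.{v, u}} {G : Z ⟶ X} (w : FieldAlong G) {A B : Z.X} (f : A ⟶ B) :
    w.cell.app A ≫ X.D.T.map (G.hom.F.map f) = G.hom.F.map f ≫ w.cell.app B :=
  (w.cell.naturality f).symm

variable {Z X : TngRCat.{v, max u v}} {G : Z ⟶ X} (w : FieldAlong G)

/-- The restriction functor into vector fields induced by a vector field along `G`. -/
noncomputable def liftFunctor : Z.X ⟶ (VF.{v, u} X).X :=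
  { obj := fun A => ⟨G.hom.F.obj A, w.cell.app A, w.cell.total A, w.sect A⟩
    map := fun f => ⟨G.hom.F.map f, w.field_map f⟩
    map_id := fun A => VFHom.ext (G.hom.F.map_id A)
    map_comp := fun f g => VFHom.ext (G.hom.F.map_comp f g)
    map_rest := fun f => VFHom.ext (G.hom.F.map_rest f) }

/-- The tangent bundle of `(G A, w_A)` carries the field `T w_A ≫ c`, so this is the condition for
`α_A` to be a morphism of vector fields. It is `w.comm` composed with `c`, because `c ≫ c = 𝟙` moves
the flip to the other side. -/
theorem law_comm (A : Z.X) : w.cell.app (Z.D.T.obj A) ≫ X.D.T.map (G.hom.α.app A) =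
    G.hom.α.app A ≫ X.D.T.map (w.cell.app A) ≫ X.D.flipAt (G.hom.F.obj A) := by
  have h := X.isTangentRestriction.flip_flip (G.hom.F.obj A)
  have e := congrArg (· ≫ X.D.flipAt (G.hom.F.obj A)) (w.comm A)
  simp only [Category.assoc] at e
  refine Eq.trans ?_ e.symm
  exact ((congrArg (fun t => w.cell.app (Z.D.T.obj A) ≫ X.D.T.map (G.hom.α.app A) ≫ t) h).trans
    (congrArg (w.cell.app (Z.D.T.obj A) ≫ ·) (Category.comp_id _))).symm

/-- The distributive law of the induced functor into vector fields. -/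
noncomputable def liftLaw : Z.D.T ≫ w.liftFunctor ⟶ w.liftFunctor ≫ (VF.{v, u} X).D.T :=
  { app := fun A => ⟨G.hom.α.app A, w.law_comm A⟩
    naturality := fun _ _ f => VFHom.ext (G.hom.α.naturality f)
    total := fun A => VFHom.ext (G.hom.α.total A) }

/-- The additivity axiom of a lax tangent morphism asks for a 2-cell between second fibre powers.
This lemma shows that the one belonging to `G` respects the vector fields, so it can serve for the
lift as well. -/
theorem pow_comm (a : Z.D.pow 1 ≫ G.hom.F ⟶ G.hom.F ≫ X.D.pow 1)
    (ha : ∀ i, a ≫ G.hom.F ◁ X.D.π 1 i = Z.D.π 1 i ▷ G.hom.F ≫ G.hom.α) (A : Z.X) :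
    w.cell.app ((Z.D.pow 1).obj A) ≫ X.D.T.map (a.app A) =
      a.app A ≫ X.isTangentRestriction.powField 1 (w.liftFunctor.obj A) := by
  -- `T` preserves the fibre powers, so maps into `T (T₂ (G A))` may be compared after the
  -- projections `T π_i`. There `a` becomes `α`, and the claim reduces to `field_map` for `π_i` and
  -- to `law_comm`.
  refine (X.isTangentRestriction.pow_limit₁ 1 (G.hom.F.obj A)).hom_ext fun i => ?_
  have e : a.app A ≫ X.D.prAt (G.hom.F.obj A) 1 i =
      G.hom.F.map (Z.D.prAt A 1 i) ≫ G.hom.α.app A := RCat.congr_app (ha i) A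
  have l := X.isTangentRestriction.powField_pr 1 (w.liftFunctor.obj A) i
  rw [Category.assoc]
  refine (congrArg (_ ≫ ·) ((X.D.T.map_comp _ _).symm.trans ((congrArg X.D.T.map e).trans
    (X.D.T.map_comp _ _)))).trans ?_
  rw [← Category.assoc]
  refine (congrArg (· ≫ X.D.T.map (G.hom.α.app A)) (w.field_map (Z.D.prAt A 1 i))).trans ?_
  rw [Category.assoc]
  refine (congrArg (_ ≫ ·) (w.law_comm A)).trans ?_
  rw [← Category.assoc, ← e, Category.assoc]
  exact (congrArg (a.app A ≫ ·) l.symm).trans (Category.assoc _ _ _).symm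

/-- The lax tangent restriction functor into vector fields induced by a vector field along `G`. -/
noncomputable def lift : Z ⟶ VF.{v, u} X := InducedBicategory.mkHom
  { F := w.liftFunctor
    α := w.liftLaw
    -- The structure maps of `VF X` have those of `X` underneath and a morphism of fields is
    -- determined by its underlying map, so each axiom is the corresponding axiom of `G`, component
    -- by component.
    proj := RCat.hom₂_ext fun A => VFHom.ext (RCat.congr_app G.hom.proj A)
    zero := RCat.hom₂_ext fun A => VFHom.ext (RCat.congr_app G.hom.zero A)
    sum := by
      obtain ⟨a, ha, hs⟩ := G.hom.sum
      refine ⟨{ app := fun A => ⟨a.app A, w.pow_comm a ha A⟩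
                naturality := fun _ _ f => VFHom.ext (a.naturality f)
                total := fun A => VFHom.ext (a.total A) }, fun i => ?_, ?_⟩
      · exact RCat.hom₂_ext fun A => VFHom.ext (RCat.congr_app (ha i) A)
      · exact RCat.hom₂_ext fun A => VFHom.ext (RCat.congr_app hs A)
    lift := RCat.hom₂_ext fun A => VFHom.ext (RCat.congr_app G.hom.lift A)
    flip := RCat.hom₂_ext fun A => VFHom.ext (RCat.congr_app G.hom.flip A) }

/-- The underlying functors agree by definition. The laws differ only by the law of the forgetful
functor, which is an identity. -/
theorem lift_forget : w.lift ≫ VF.forget X = G :=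
  InducedBicategory.hom_ext (LaxMor.ext_heq rfl (heq_of_eq (RCat.hom₂_ext fun A => by
    refine (compLaw_app w.liftLaw (VF.forget X).hom.α A).trans ?_
    exact Category.comp_id (G.hom.α.app A))))

/-- The two fields live over different functors, so their components can only be compared
heterogeneously until the functors are identified. -/
theorem lift_congr {G' : Z ⟶ X} (e : G = G') {w : FieldAlong G} {w' : FieldAlong G'}
    (h : ∀ A, w.cell.app A ≍ w'.cell.app A) : w.lift = w'.lift := by
  subst e
  congr 1
  exact FieldAlong.ext (RCat.hom₂_ext fun A => eq_of_heq (h A))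

end FieldAlong

/-! ### Functors into vector fields are determined by their fields -/

namespace VF

variable {Z X : TngRCat.{v, max u v}}

theorem forget_law (H : Z ⟶ VF.{v, u} X) (A : Z.X) :
    (H ≫ VF.forget X).hom.α.app A = (H.hom.α.app A).f :=
  (compLaw_app H.hom.α (VF.forget X).hom.α A).trans (Category.comp_id (H.hom.α.app A).f)

/-- The vector field along `U` with component `v` at `(M, v)`. -/
def universalField (X : TngRCat.{v, max u v}) : FieldAlong (VF.forget.{v, u} X) where
  cell :=
    { app := fun P => P.v
      naturality := fun _ _ f => f.comm.symm
      total := fun P => P.total }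
  sect P := P.sect
  comm P := by
    have h := X.isTangentRestriction.flip_flip P.M
    -- The forgetful functor has an identity law, and the component of the field at `T (M, v)` is `T
    -- v ≫ c`. What remains is `T v = T v ≫ c ≫ c`.
    change 𝟙 _ ≫ X.D.T.map P.v =
      (X.D.T.map P.v ≫ X.D.flipAt P.M) ≫ X.D.T.map (𝟙 _) ≫ X.D.flipAt P.M
    rw [X.D.T.map_id, Category.assoc]
    refine (Category.id_comp _).trans ?_
    refine (Category.comp_id _).symm.trans (congrArg (X.D.T.map P.v ≫ ·) ?_)
    exact h.symm.trans (congrArg (X.D.flipAt P.M ≫ ·) (Category.id_comp _).symm)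

/-- The vector field along `H ≫ U` that underlies `H`. -/
def field (H : Z ⟶ VF.{v, u} X) : FieldAlong (H ≫ VF.forget X) where
  cell :=
    { app := fun A => (H.hom.F.obj A).v
      naturality := fun _ _ f => (H.hom.F.map f).comm.symm
      total := fun A => (H.hom.F.obj A).total }
  sect A := (H.hom.F.obj A).sect
  comm A := by
    rw [forget_law]
    -- The law of `H` consists of morphisms of vector fields. This is the converse of `law_comm`:
    -- composing their defining equation with `c` gives the compatibility required of a field along
    -- a functor.
    have e := (H.hom.α.app A).comm
    have h := X.isTangentRestriction.flip_flip (H.hom.F.obj A).M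
    have e' := congrArg (· ≫ X.D.flipAt (H.hom.F.obj A).M) e
    refine Eq.trans ?_ (e'.symm.trans (Category.assoc _ _ _))
    change _ = ((H.hom.α.app A).f ≫ X.D.T.map (H.hom.F.obj A).v ≫ X.D.flipAt (H.hom.F.obj A).M) ≫
      X.D.flipAt (H.hom.F.obj A).M
    rw [Category.assoc]
    exact (congrArg ((H.hom.α.app A).f ≫ ·) ((Category.assoc _ _ _).trans
      ((congrArg (X.D.T.map (H.hom.F.obj A).v ≫ ·) h).trans (Category.comp_id _)))).symm

/-- On objects and morphisms the equality is definitional, since a vector field is its base object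
together with its section. Only the law needs an argument, because the law of `H ≫ U` contains an
extra identity. -/
theorem lift_field (H : Z ⟶ VF.{v, u} X) : (field H).lift = H :=
  InducedBicategory.hom_ext (LaxMor.ext_heq rfl (heq_of_eq (RCat.hom₂_ext fun A =>
    VFHom.ext (forget_law H A))))

/-- The uniqueness half of the universal property: both functors are recovered as lifts of their
fields. The fields are compared heterogeneously because their base objects agree only through `e`.
-/
theorem hom_ext {H K : Z ⟶ VF.{v, u} X} (e : H ≫ VF.forget X = K ≫ VF.forget X)
    (h : ∀ A, (H.hom.F.obj A).v ≍ (K.hom.F.obj A).v) : H = K := by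
  rw [← lift_field H, ← lift_field K]
  exact FieldAlong.lift_congr e h

/-- The forgetful functor is faithful on morphisms, hence whiskering with it is faithful on 2-cells.
-/
theorem hom₂_ext {H K : Z ⟶ VF.{v, u} X} {θ θ' : H ⟶ K}
    (h : θ ▷ VF.forget X = θ' ▷ VF.forget X) : θ = θ' :=
  InducedBicategory.hom₂_ext (TngPair.hom₂_ext (RCat.hom₂_ext fun A => VFHom.ext
    (congrArg (fun t => t.hom.cell.app A) h)))

/-- A tangent 2-morphism that commutes with the vector fields. -/
def lift₂ {H K : Z ⟶ VF.{v, u} X} (ψ : H ≫ VF.forget X ⟶ K ≫ VF.forget X)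
    (h : ∀ A, (H.hom.F.obj A).v ≫ X.D.T.map (ψ.hom.cell.app A) =
      ψ.hom.cell.app A ≫ (K.hom.F.obj A).v) : H ⟶ K where
  hom :=
    { cell :=
        { app := fun A => ⟨ψ.hom.cell.app A, h A⟩
          naturality := fun _ _ f => VFHom.ext (ψ.hom.cell.naturality f)
          total := fun A => VFHom.ext (ψ.hom.cell.total A) }
      -- Compatibility with the laws is inherited from `ψ`: by `forget_law`, the laws of the
      -- composites with the forgetful functor have the same components as those of `H` and `K`.
      comm := RCat.hom₂_ext fun A => VFHom.ext (by
        have e := RCat.congr_app ψ.hom.comm A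
        have e' : (H ≫ VF.forget X).hom.α.app A ≫ X.D.T.map (ψ.hom.cell.app A) =
          ψ.hom.cell.app (Z.D.T.obj A) ≫ (K ≫ VF.forget X).hom.α.app A := e
        rw [forget_law, forget_law] at e'
        exact e') }

end VF

/-! ### Vector fields of tangentads in split restriction categories -/

/-- The vector fields of a split restriction category form a split restriction category. -/
theorem vf_isSplit {X : RCat.{v, u}} (D : TangentData X) (hX : X.IsSplit) :
    (vfCat D).IsSplit := by
  intro P e he
  obtain ⟨B, r, m, hrm, hmr⟩ := hX P.M e.f (congrArg VFHom.f he)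
  -- A section is total, since it is the first factor of an identity.
  have hm : IsTotal m := by
    refine IsTotal.of_comp (g := r) ?_
    rw [hmr]
    exact isTotal_id B
  -- The field on the splitting object is `v` restricted along `m` and projected along `T r`. That
  -- `m` is a morphism of fields follows from `r ≫ m = e`, the commutation of `e` with `v`, and `m ≫
  -- e = m`.
  have hv : (m ≫ P.v ≫ D.T.map r) ≫ D.T.map m = m ≫ P.v := by
    rw [Category.assoc, Category.assoc, ← D.T.map_comp, hrm, e.comm, ← hrm, Category.assoc,
      ← Category.assoc, hmr, Category.id_comp]
  refine ⟨⟨B, m ≫ P.v ≫ D.T.map r, ?_, ?_⟩, ⟨r, ?_⟩, ⟨m, hv⟩, VFHom.ext hrm, VFHom.ext hmr⟩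
  -- `T r` need not be total, so totality is read off after composing with `T m`: by `hv` the result
  -- is `m ≫ v`, a composite of total maps.
  · refine IsTotal.of_comp (g := D.T.map m) ?_
    rw [hv]
    exact hm.comp P.total
  · rw [Category.assoc, Category.assoc, D.proj_naturality, ← Category.assoc P.v, P.sect,
      Category.id_comp, hmr]
  · change P.v ≫ D.T.map r = r ≫ m ≫ P.v ≫ D.T.map r
    rw [← Category.assoc, hrm, ← Category.assoc, ← e.comm, Category.assoc, ← D.T.map_comp, ← hrm,
      Category.assoc, hmr, Category.comp_id]

/-- The tangentad of vector fields of a tangentad in split restriction categories. -/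
noncomputable def vfTng (A : Tng sRCat.{v, max u v}) : Tng sRCat.{v, max u v} :=
  -- The tangentad axioms are turned into componentwise ones by `ofSplit`. The construction on
  -- fields takes place there, and `toSplit` returns to `sRCat`, which is legitimate because
  -- splitness is preserved.
  Tangentad.mk ⟨⟨vfCat.{v, max u v} A.D.ofSplit, vf_isSplit A.D.ofSplit A.X.isSplit⟩,
      A.isTangentad.ofSplit.vfData.toSplit _⟩
    (TangentData.IsTangentRestriction.vf.{v, u} A.isTangentad.ofSplit).toSplit

/-! ### Dictionary between tangentads in split restriction categories and their components -/

/-- A lax tangent restriction functor between tangentads in `sRCat`, as a 1-morphism of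
tangentads. -/
def ofInclusion {A B : Tng sRCat.{v, u}} (f : inclusion.obj A ⟶ inclusion.obj B) : A ⟶ B :=
  InducedBicategory.mkHom
    { F := f.hom.F
      α := f.hom.α
      proj := f.hom.proj
      zero := f.hom.zero
      sum := f.hom.sum
      lift := f.hom.lift
      flip := f.hom.flip }

/-- A tangent 2-morphism between tangentads in `sRCat`, as a 2-morphism of tangentads. -/
def ofInclusion₂ {A B : Tng sRCat.{v, u}} {f g : A ⟶ B} (θ : inclusion.map f ⟶ inclusion.map g) :
    f ⟶ g := ⟨{ cell := θ.hom.cell, comm := θ.hom.comm }⟩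

/-- The inclusion only re-bundles the same data, so `ofInclusion` is a definitional left inverse. -/
theorem inclusion_map_injective {A B : Tng sRCat.{v, u}} {f g : A ⟶ B}
    (h : inclusion.map f = inclusion.map g) : f = g :=
  congrArg ofInclusion h

/-- The strict tangent 1-morphism that forgets the vector field. -/
noncomputable def vfTngForget (A : Tng sRCat.{v, max u v}) : vfTng.{v, u} A ⟶ A :=
  ofInclusion (VF.forget.{v, u} (inclusion.obj A))

/-- The vector field in a Hom-tangent category given by a vector field in components. -/
def FieldAlong.toHom {X' A : Tng sRCat.{v, u}} {G : X' ⟶ A}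
    (w : FieldAlong (inclusion.map G)) : HomVectorField X' A where
  G := G
  u :=
    { hom :=
        { cell := w.cell
          -- The law of the composite of `G` with `(T, c)` has component `T α_M ≫ c` by
          -- `compLaw_app`, which is why `FieldAlong.comm` has the form it has.
          comm := RCat.hom₂_ext fun M => (w.comm M).trans (congrArg (w.cell.app _ ≫ ·)
            (compLaw_app (inclusion.map G).hom.α A.D.ofSplit.c M).symm) } }
  sect := InducedBicategory.hom₂_ext (TngPair.hom₂_ext (RCat.hom₂_ext fun M =>
    (congrArg (w.cell.app M ≫ ·) (Category.comp_id _)).trans (w.sect M)))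

/-- The components of a vector field in a Hom-tangent category. -/
def HomVectorField.toField {X' A : Tng sRCat.{v, u}} (a : HomVectorField X' A) :
    FieldAlong (inclusion.map a.G) where
  cell := a.u.hom.cell
  sect M := (congrArg (_ ≫ ·) (Category.comp_id _)).symm.trans
    (RCat.congr_app (congrArg (fun t => t.hom.cell) a.sect) M)
  comm M := (RCat.congr_app a.u.hom.comm M).trans
    (congrArg (_ ≫ ·) (compLaw_app (inclusion.map a.G).hom.α A.D.ofSplit.c M))

theorem HomVectorField.ext_app {X' A : Tng sRCat.{v, u}} {a b : HomVectorField X' A}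
    (h : a.G = b.G) (h' : ∀ M, a.toField.cell.app M ≍ b.toField.cell.app M) : a = b := by
  obtain ⟨G, s, hs⟩ := a
  obtain ⟨G', t, ht⟩ := b
  dsimp only at h
  subst h
  obtain rfl : s = t := InducedBicategory.hom₂_ext (TngPair.hom₂_ext
    (RCat.hom₂_ext fun M => eq_of_heq (h' M)))
  rfl

/-- The universal vector field. -/
noncomputable def vfTngField (A : Tng sRCat.{v, max u v}) :
    HomVectorField (vfTng.{v, u} A) A :=
  FieldAlong.toHom (G := vfTngForget.{v, u} A) (VF.universalField.{v, u} (inclusion.obj A))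

/-- The associator in the definition of `Γ` has identity components, so whiskering evaluates the
field of `a` at the image object. -/
theorem Γ_field_app {V X' A : Tng sRCat.{v, u}} (a : HomVectorField V A) (H : X' ⟶ V)
    (M : X'.X.toRCat) : ((a.Γ X').obj H).toField.cell.app M =
      a.toField.cell.app ((inclusion.map H).hom.F.obj M) :=
  Category.comp_id _

/-- This reads a morphism between induced vector fields in components, in the form that `VF.lift₂`
takes as its hypothesis. It gives fullness of `Γ`. -/
theorem Γ_comm_app {V X' A : Tng sRCat.{v, u}} (a : HomVectorField V A) {H K : X' ⟶ V}
    (φ : (a.Γ X').obj H ⟶ (a.Γ X').obj K) (M : X'.X.toRCat) :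
    a.toField.cell.app ((inclusion.map H).hom.F.obj M) ≫
      A.D.ofSplit.T.map ((inclusion.map₂ φ.φ).hom.cell.app M) =
    (inclusion.map₂ φ.φ).hom.cell.app M ≫
      a.toField.cell.app ((inclusion.map K).hom.F.obj M) := by
  have := RCat.congr_app (congrArg (fun t => (inclusion.map₂ t).hom.cell) φ.comm) M
  have e : ((a.Γ X').obj H).toField.cell.app M ≫
      A.D.ofSplit.T.map ((inclusion.map₂ φ.φ).hom.cell.app M) =
    (inclusion.map₂ φ.φ).hom.cell.app M ≫ ((a.Γ X').obj K).toField.cell.app M := this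
  rw [Γ_field_app, Γ_field_app] at e
  exact e

/-- A tangentad in `sRCat` admits the construction of vector fields. -/
noncomputable def vfTngUniversal (A : Tng sRCat.{v, max u v}) : UniversalVectorField A where
  V := vfTng.{v, u} A
  vf := vfTngField.{v, u} A
  -- The tangent bundle of `(M, v)` lies over `T M` definitionally, and the law of the forgetful
  -- functor is an identity.
  strict := ⟨rfl, rfl⟩
  universal X' :=
    { full := ⟨fun {H K} φ => by
        -- The same 1-morphisms, with target presented as `VF` of the included tangentad so that the
        -- universal property in components applies.
        let θ : inclusion.obj X' ⟶ VF.{v, u} (inclusion.obj A) := inclusion.map H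
        let θ' : inclusion.obj X' ⟶ VF.{v, u} (inclusion.obj A) := inclusion.map K
        exact ⟨ofInclusion₂ (VF.lift₂ (H := θ) (K := θ') (inclusion.map₂ φ.φ)
          (Γ_comm_app (vfTngField.{v, u} A) φ)), rfl⟩⟩
      faithful := ⟨fun {H K} φ ψ e => InducedBicategory.hom₂_ext (TngPair.hom₂_ext
        (RCat.hom₂_ext fun M => VFHom.ext
          (RCat.congr_app (congrArg (fun t : HomVectorField.Hom _ _ =>
            (inclusion.map₂ t.φ).hom.cell) e) M)))⟩
      bijective_obj := by
        refine ⟨fun H K e => ?_, fun a => ?_⟩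
        -- Injectivity on objects: the induced vector field of `H` records both the composite of `H`
        -- with the forgetful functor and, by `Γ_field_app`, the field at each object, and these
        -- determine `H`.
        · refine inclusion_map_injective (VF.hom_ext (X := inclusion.obj A) ?_ fun M => ?_)
          · exact congrArg (fun t => inclusion.map t.G) e
          · have h : ∀ {a b : HomVectorField X' A}, a = b →
                a.toField.cell.app M ≍ b.toField.cell.app M := by
              rintro a _ rfl
              rfl
            exact (heq_of_eq (Γ_field_app (vfTngField.{v, u} A) H M).symm).trans
              ((h e).trans (heq_of_eq (Γ_field_app (vfTngField.{v, u} A) K M)))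
        -- Surjectivity on objects: the preimage of a vector field on `G` is the lift of `G` along
        -- its components.
        · refine ⟨ofInclusion (FieldAlong.lift.{v, u} a.toField), HomVectorField.ext_app ?_ ?_⟩
          · exact inclusion_map_injective (FieldAlong.lift_forget a.toField)
          · intro M
            exact heq_of_eq (Γ_field_app (vfTngField.{v, u} A)
              (ofInclusion (FieldAlong.lift.{v, u} a.toField)) M) }

/-! ### Vector fields and the embedding into the split completion -/

/-- The embedding of a tangent restriction category into its split completion. -/
abbrev unitHom (X : TngRCat.{v, max u v}) :
    X ⟶ inclusion.obj (splitFunctor.{v, max u v}.obj X) :=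
  InducedBicategory.mkHom (unitMor.{v, u} X)

/-! ### Fields along the embedding -/

section Unit

variable {Z X : TngRCat.{v, max u v}} {G : Z ⟶ X}

/-- The law of the embedding has identities as underlying maps, so composing with it leaves the
components of the law of `G` unchanged. -/
theorem comp_unit_law (G : Z ⟶ X) (A : Z.X) :
    ((G ≫ unitHom.{v, u} X).hom.α.app A).f = G.hom.α.app A := by
  refine (congrArg SplitHom.f (compLaw_app G.hom.α (unitCell X.D.T) A)).trans ?_
  exact Category.comp_id (G.hom.α.app A)

/-- Structure maps of the split completion are precomposed with the idempotent of the object. At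
`(M, 𝟙)` that factor is a functor applied to an identity, and it disappears. -/
theorem split_flip_f (M : X.X) :
    ((splitMap₂ X.D.c).app ((unitFunctor X.X).obj M)).f = X.D.flipAt M := by
  refine (splitMap₂_f X.D.c _).trans ?_
  refine (congrArg (· ≫ X.D.flipAt M) ((X.D.T ≫ X.D.T).map_id M)).trans (Category.id_comp _)

theorem split_proj_f (M : X.X) :
    ((splitMap₂ X.D.p).app ((unitFunctor X.X).obj M)).f = X.D.projAt M := by
  refine (splitMap₂_f X.D.p _).trans ?_
  refine (congrArg (· ≫ X.D.projAt M) (X.D.T.map_id M)).trans (Category.id_comp _)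

/-- The image of a vector field under the embedding into the split completion. -/
def FieldAlong.compUnit (w : FieldAlong G) : FieldAlong (G ≫ unitHom.{v, u} X) where
  cell :=
    -- The idempotents at source and target are `𝟙` and `T 𝟙 = 𝟙`, so every map of `X` between these
    -- objects is a map of the split completion.
    { app := fun A => ⟨w.cell.app A, Category.id_comp _,
        (congrArg (w.cell.app A ≫ ·) (X.D.T.map_id _)).trans (Category.comp_id _)⟩
      naturality := fun _ _ f => SplitHom.ext (w.cell.naturality f)
      total := fun A => SplitHom.ext (w.cell.total A) }
  sect A := SplitHom.ext ((congrArg (w.cell.app A ≫ ·) (split_proj_f _)).trans (w.sect A))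
  comm A := SplitHom.ext (by
    change ((G ≫ unitHom.{v, u} X).hom.α.app A).f ≫ X.D.T.map (w.cell.app A) =
      w.cell.app (Z.D.T.obj A) ≫ X.D.T.map ((G ≫ unitHom.{v, u} X).hom.α.app A).f ≫
        ((splitMap₂ X.D.c).app ((unitFunctor X.X).obj (G.hom.F.obj A))).f
    rw [comp_unit_law, split_flip_f]
    exact w.comm A)

/-- A vector field along the composite with the embedding into the split completion. -/
def FieldAlong.ofCompUnit (w : FieldAlong (G ≫ unitHom.{v, u} X)) : FieldAlong G where
  cell :=
    -- Conversely, taking underlying maps loses nothing, because the embedding is full and faithful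
    -- and reflects totality.
    { app := fun A => (w.cell.app A).f
      naturality := fun _ _ f => congrArg SplitHom.f (w.cell.naturality f)
      total := fun A => congrArg SplitHom.f (w.cell.total A) }
  sect A := (congrArg ((w.cell.app A).f ≫ ·) (split_proj_f _)).symm.trans
    (congrArg SplitHom.f (w.sect A))
  comm A := by
    have e : ((G ≫ unitHom.{v, u} X).hom.α.app A).f ≫ X.D.T.map (w.cell.app A).f =
      (w.cell.app (Z.D.T.obj A)).f ≫ X.D.T.map ((G ≫ unitHom.{v, u} X).hom.α.app A).f ≫
        ((splitMap₂ X.D.c).app ((unitFunctor X.X).obj (G.hom.F.obj A))).f :=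
      congrArg SplitHom.f (w.comm A)
    rw [comp_unit_law, split_flip_f] at e
    exact e

end Unit

/-! ### The comparison functor and the 2-pullback for the explicit model -/

variable (X : TngRCat.{v, max u v})

/-- The comparison `VF(η)`, which sends `(M, v)` to `((M, 𝟙), v)`. -/
noncomputable def vfUnit :
    VF.{v, u} X ⟶ VF.{v, u} (inclusion.obj (splitFunctor.{v, max u v}.obj X)) :=
  FieldAlong.lift (VF.universalField.{v, u} X).compUnit

/-- The object `((M, 𝟙), v)` still contains `M` and `v`. Together with `VF.hom_ext` this yields
uniqueness in the 2-pullback, where the fields of two competing functors have to be compared. -/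
theorem vfUnit_obj_injective {P Q : VFObj X.D}
    (h : (vfUnit.{v, u} X).hom.F.obj P = (vfUnit.{v, u} X).hom.F.obj Q) : P = Q := by
  -- Stated for arbitrary objects so that the equality can be eliminated. The second component is
  -- heterogeneous since the base objects are identified only afterwards.
  have key : ∀ {P' Q' : VFObj (inclusion.obj (splitFunctor.{v, max u v}.obj X)).D}, P' = Q' →
      P'.M = Q'.M ∧ P'.v.f ≍ Q'.v.f := by
    rintro P' _ rfl
    exact ⟨rfl, HEq.rfl⟩
  obtain ⟨hM, hv⟩ := key h
  obtain ⟨M, v, _, _⟩ := P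
  obtain ⟨N, v', _, _⟩ := Q
  obtain rfl : M = N := congrArg SplitObj.A hM
  obtain rfl : v = v' := eq_of_heq hv
  rfl

theorem eqToHom_hom_cell_app {Z Y : TngRCat.{v, u}} {f g : Z ⟶ Y} (h : f = g) (A : Z.X) :
    (eqToHom h).hom.cell.app A = eqToHom (congrArg (fun k => k.hom.F.obj A) h) := by
  subst h
  rfl

/-- In a compatible pair of 2-cells the second one carries no new data: up to the two forgetful
passages, from fields and from idempotents, its components are those of the first. -/
theorem unit_cell_eq {Z : TngRCat.{v, max u v}} {h k : Z ⟶ VF.{v, u} X}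
    (a : h ≫ VF.forget X ⟶ k ≫ VF.forget X) (b : h ≫ vfUnit.{v, u} X ⟶ k ≫ vfUnit.{v, u} X)
    {e : (k ≫ VF.forget X) ≫ unitHom.{v, u} X = (k ≫ vfUnit.{v, u} X) ≫ VF.forget _}
    {e' : (h ≫ VF.forget X) ≫ unitHom.{v, u} X = (h ≫ vfUnit.{v, u} X) ≫ VF.forget _}
    (H : a ▷ unitHom.{v, u} X ≫ eqToHom e = eqToHom e' ≫ b ▷ VF.forget _) (A : Z.X) :
    (b.hom.cell.app A).f.f = a.hom.cell.app A := by
  have := congrArg (fun t => t.hom.cell.app A) H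
  have e1 : (a ▷ unitHom.{v, u} X).hom.cell.app A ≫ (eqToHom e).hom.cell.app A =
    (eqToHom e').hom.cell.app A ≫ (b ▷ VF.forget _).hom.cell.app A := this
  rw [eqToHom_hom_cell_app, eqToHom_hom_cell_app] at e1
  -- The functors related by `e` and `e'` have definitionally equal values on objects, so the
  -- `eqToHom` components are identities.
  have e2 := (Category.comp_id _).symm.trans (e1.trans (Category.id_comp _))
  exact (congrArg SplitHom.f e2).symm

/-- The vector fields of a tangent restriction category are the 2-pullback of the vector fields
of its split completion. -/
theorem vf_isTwoPullback : IsTwoPullback (VF.forget.{v, u} X) (vfUnit.{v, u} X)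
    (unitHom.{v, u} X)
    (VF.forget.{v, u} (inclusion.obj (splitFunctor.{v, max u v}.obj X))) where
  comm := (FieldAlong.lift_forget _).symm
  lift Z a b hab := by
    -- The fields of `b` live along `b ≫ U`, which by `hab` is `a ≫ η`. Packing them together with
    -- their components allows `hab` to be rewritten while their values are kept.
    obtain ⟨w, hw⟩ : ∃ w : FieldAlong (a ≫ unitHom.{v, u} X),
        ∀ A, w.cell.app A ≍ (b.hom.F.obj A).v := by
      rw [hab]
      exact ⟨VF.field b, fun A => HEq.rfl⟩
    -- The mediating functor is the lift of `a` by the descended field. It has the right second leg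
    -- because both functors have the same underlying functor, by `hab`, and the same fields, by
    -- `hw`.
    have h1 := FieldAlong.lift_forget.{v, u} w.ofCompUnit
    have h2 : w.ofCompUnit.lift ≫ vfUnit.{v, u} X = b := by
      refine VF.hom_ext ?_ fun A => ?_
      · rw [Strict.assoc]
        have c : vfUnit.{v, u} X ≫ VF.forget _ = VF.forget X ≫ unitHom.{v, u} X :=
          FieldAlong.lift_forget _
        rw [c, ← Strict.assoc, h1, hab]
      · exact hw A
    refine ⟨w.ofCompUnit.lift, ⟨h1, h2⟩, fun h' ⟨h1', h2'⟩ => ?_⟩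
    refine VF.hom_ext (h1'.trans h1.symm) fun A => ?_
    -- Equality of the second legs and injectivity of the comparison functor on objects force the
    -- two competing functors to take the same values, fields included.
    have e : h'.hom.F.obj A = w.ofCompUnit.lift.hom.F.obj A := vfUnit_obj_injective X
      (congrArg (fun t => t.hom.F.obj A) (h2'.trans h2.symm))
    rw [e]
  lift₂ Z h k a b H := by
    have e := unit_cell_eq X a b H
    -- The lift of `a` exists because its components underlie those of `b`, which commute with the
    -- fields in the split completion. Uniqueness already follows from the first projection.
    refine ⟨VF.lift₂ a fun A => ?_, ⟨rfl, ?_⟩, fun θ hθ => VF.hom₂_ext hθ.1⟩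
    · rw [← e A]
      exact congrArg SplitHom.f (b.hom.cell.app A).comm
    · exact InducedBicategory.hom₂_ext (TngPair.hom₂_ext (RCat.hom₂_ext fun A =>
        VFHom.ext (SplitHom.ext (e A).symm)))

/-! ### Uniqueness of objects of vector fields -/

/-! ### Whiskering in a strict 2-category, and transport of 2-pullbacks -/

section Strict

variable {J : Type u} [Bicategory.{w, v} J] [Bicategory.Strict J]

/-- In a strict 2-category the two sides of a coherence law have boundaries that are equal but not
definitionally so. Stating these laws as heterogeneous equalities allows them to be chained without
carrying `eqToHom`s. -/
theorem whiskerRight_heq {A B C : J} {f f' g g' : A ⟶ B} (hf : f = f') (hg : g = g') {x : f ⟶ g}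
    {x' : f' ⟶ g'} (hx : x ≍ x') {h h' : B ⟶ C} (e : h = h') : x ▷ h ≍ x' ▷ h' := by
  subst hf hg hx e
  rfl

theorem whiskerRight_comp_heq {A B C D : J} {f g : A ⟶ B} (x : f ⟶ g) (h : B ⟶ C) (k : C ⟶ D) :
    x ▷ (h ≫ k) ≍ (x ▷ h) ▷ k := by
  rw [whiskerRight_comp, Strict.associator_eqToIso, Strict.associator_eqToIso]
  simp

theorem whiskerRight_id_heq {A B : J} {f g : A ⟶ B} (x : f ⟶ g) : x ▷ 𝟙 B ≍ x := by
  rw [whiskerRight_id, Strict.rightUnitor_eqToIso, Strict.rightUnitor_eqToIso]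
  simp

theorem comp_whiskerLeft_heq {A B C D : J} (h : A ⟶ B) (k : B ⟶ C) {f g : C ⟶ D} (x : f ⟶ g) :
    (h ≫ k) ◁ x ≍ h ◁ k ◁ x := by
  rw [comp_whiskerLeft, Strict.associator_eqToIso, Strict.associator_eqToIso]
  simp

/-- Translates the compatibility condition on pairs of 2-cells in `IsTwoPullback` into a
heterogeneous equality and back. -/
theorem comp_eqToHom_eq_iff_heq {A B : J} {f f' g g' : A ⟶ B} (x : f ⟶ g) (x' : f' ⟶ g') (h : g = g')
    (k : f = f') : x ≫ eqToHom h = eqToHom k ≫ x' ↔ x ≍ x' := by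
  subst h k
  simp

/-- A 2-pullback may be transported along an isomorphism of one of the legs of the cospan. -/
theorem IsTwoPullback.of_iso {P A B B' C : J} {fst : P ⟶ A} {snd : P ⟶ B} {f : A ⟶ C} {g : B ⟶ C}
    (H : IsTwoPullback fst snd f g) {i : B ⟶ B'} {j : B' ⟶ B} (hij : i ≫ j = 𝟙 B)
    (hji : j ≫ i = 𝟙 B') {g' : B' ⟶ C} (hg : i ≫ g' = g) :
    IsTwoPullback fst (snd ≫ i) f g' := by
  have hj : j ≫ g = g' := by rw [← hg, ← Strict.assoc, hji, Strict.id_comp]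
  refine ⟨by rw [Strict.assoc, hg, H.comm], fun Z a b hab => ?_, fun Z h k a b hab => ?_⟩
  -- A cone over `f` and `g'` becomes a cone over `f` and `g` by composing its second leg with the
  -- inverse `j`, since `j ≫ g = g'`.
  · obtain ⟨h, ⟨h1, h2⟩, hu⟩ := H.lift Z a (b ≫ j) (by rw [Strict.assoc, hj, hab])
    refine ⟨h, ⟨h1, ?_⟩, fun h' ⟨h1', h2'⟩ => hu h' ⟨h1', ?_⟩⟩
    · rw [← Strict.assoc, h2, Strict.assoc, hji, Strict.comp_id]
    · rw [← h2', Strict.assoc, Strict.assoc, hij, Strict.comp_id]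
  · have e : ∀ h : Z ⟶ P, h ≫ snd = (h ≫ snd ≫ i) ≫ j := fun h => by
      rw [Strict.assoc, Strict.assoc, hij, Strict.comp_id]
    have e' : ∀ h : Z ⟶ P, (h ≫ snd) ≫ i = h ≫ snd ≫ i := fun h => Strict.assoc _ _ _
    -- The 2-cell for the original square is `b` whiskered with `j`. Its boundary `(h ≫ snd ≫ i) ≫
    -- j` only equals `h ≫ snd` propositionally, which accounts for the `eqToHom`s on both sides.
    let b' : h ≫ snd ⟶ k ≫ snd := eqToHom (e h) ≫ b ▷ j ≫ eqToHom (e k).symm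
    have hb' : b' ≍ b ▷ j := by simp [b']
    -- Whiskering with `j` and then `i` is whiskering with `j ≫ i = 𝟙`, so `b` is recovered. In the
    -- same way `forth` uses `j ≫ g = g'` to transfer the compatibility condition.
    have back : b' ▷ i ≍ b :=
      (whiskerRight_heq (e h) (e k) hb' rfl).trans ((whiskerRight_comp_heq b j i).symm.trans
        ((whiskerRight_heq rfl rfl HEq.rfl hji).trans (whiskerRight_id_heq b)))
    have forth : b' ▷ g ≍ b ▷ g' :=
      (whiskerRight_heq (e h) (e k) hb' rfl).trans ((whiskerRight_comp_heq b j g).symm.trans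
        (whiskerRight_heq rfl rfl HEq.rfl hj))
    rw [comp_eqToHom_eq_iff_heq] at hab
    obtain ⟨θ, ⟨t1, t2⟩, hu⟩ := H.lift₂ Z h k a b' (by
      rw [comp_eqToHom_eq_iff_heq]
      exact hab.trans forth.symm)
    refine ⟨θ, ⟨t1, ?_⟩, fun θ' ⟨t1', t2'⟩ => hu θ' ⟨t1', ?_⟩⟩
    · refine eq_of_heq ((whiskerRight_comp_heq θ snd i).trans ?_)
      rw [t2]
      exact back
    -- For uniqueness, `i ≫ j = 𝟙` rewrites `θ' ▷ snd` as `θ' ▷ (snd ≫ i)` whiskered with `j`, and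
    -- the latter is `b'`.
    · refine eq_of_heq (HEq.trans ?_ hb'.symm)
      subst t2'
      exact (whiskerRight_id_heq _).symm.trans
        ((whiskerRight_heq rfl rfl HEq.rfl hij.symm).trans
          ((whiskerRight_comp_heq _ i j).trans (whiskerRight_heq (e' h) (e' k)
            (whiskerRight_comp_heq θ' snd i).symm rfl)))

end Strict

/-! ### Uniqueness of the universal vector field up to isomorphism -/

section Universal

variable {K : Type u} [Bicategory.{w, v} K]

theorem HomVectorField.ext_heq {X' X : Tng K} {a b : HomVectorField X' X} (h : a.G = b.G)
    (h' : a.u ≍ b.u) : a = b := by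
  obtain ⟨G, s, hs⟩ := a
  obtain ⟨G', t, ht⟩ := b
  dsimp only at h
  subst h
  obtain rfl := eq_of_heq h'
  rfl

variable [Bicategory.Strict K]

/-- Inducing vector fields is functorial in the 1-morphism. This turns equations between composites
of comparison maps into statements about the universal fields themselves. -/
theorem HomVectorField.Γ_comp {Z Y V X : Tng K} (a : HomVectorField V X) (H : Z ⟶ Y) (L : Y ⟶ V) :
    (a.Γ Z).obj (H ≫ L) = (((a.Γ Y).obj L).Γ Z).obj H := by
  refine HomVectorField.ext_heq (Strict.assoc _ _ _) ?_
  change (H ≫ L) ◁ a.u ≫ (α_ (H ≫ L) a.G (tan X)).inv ≍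
    H ◁ (L ◁ a.u ≫ (α_ L a.G (tan X)).inv) ≫ (α_ H (L ≫ a.G) (tan X)).inv
  rw [Strict.associator_eqToIso, Strict.associator_eqToIso, Strict.associator_eqToIso]
  -- By strictness every associator is an `eqToHom`, invisible to heterogeneous equality; only the
  -- comparison of `(H ≫ L) ◁ a.u` with the iterated whiskering remains.
  simp only [eqToIso.inv, Bicategory.whiskerLeft_comp, whiskerLeft_eqToHom, Category.assoc,
    eqToHom_trans, comp_eqToHom_heq_iff, heq_comp_eqToHom_iff]
  exact comp_whiskerLeft_heq _ _ _

theorem HomVectorField.Γ_id {V X : Tng K} (a : HomVectorField V X) : (a.Γ V).obj (𝟙 V) = a := by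
  refine HomVectorField.ext_heq (Strict.id_comp _) ?_
  change 𝟙 V ◁ a.u ≫ (α_ (𝟙 V) a.G (tan X)).inv ≍ a.u
  rw [id_whiskerLeft, Strict.associator_eqToIso, Strict.leftUnitor_eqToIso,
    Strict.leftUnitor_eqToIso]
  simp

/-- Any two tangentads of vector fields are isomorphic. -/
theorem UniversalVectorField.exists_iso {X : Tng K} (V W : UniversalVectorField X) :
    ∃ (i : V.V ⟶ W.V) (j : W.V ⟶ V.V), i ≫ j = 𝟙 _ ∧ j ≫ i = 𝟙 _ ∧
      (W.vf.Γ V.V).obj i = V.vf ∧ (V.vf.Γ W.V).obj j = W.vf := by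
  -- Each universal vector field is induced from the other one, by surjectivity of `Γ` on objects.
  obtain ⟨i, hi⟩ := (W.universal V.V).bijective_obj.2 V.vf
  obtain ⟨j, hj⟩ := (V.universal W.V).bijective_obj.2 W.vf
  -- `Γ` is injective on objects, so `i ≫ j` and `𝟙` need only induce the same field. Both induce
  -- the universal one, by `Γ_comp`, the defining properties of `i` and `j`, and `Γ_id`; the other
  -- composite is symmetric.
  refine ⟨i, j, (V.universal V.V).bijective_obj.1 ?_, (W.universal W.V).bijective_obj.1 ?_, hi, hj⟩
  · rw [HomVectorField.Γ_comp, hj, hi, HomVectorField.Γ_id]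
  · rw [HomVectorField.Γ_comp, hi, hj, HomVectorField.Γ_id]

end Universal

/-! ### The square for an arbitrary tangentad of vector fields -/

/-- The square of the forgetful functors of vector fields, for an arbitrary tangentad of vector
fields of the split completion. -/
theorem exists_isTwoPullback (X : TngRCat.{v, max u v})
    (V : UniversalVectorField (tngRCatContext.{v, u}.Ξ.obj X)) :
    ∃ k : VF.{v, u} X ⟶ tngRCatContext.{v, u}.Inc.obj V.V,
      IsTwoPullback (VF.forget.{v, u} X) k (tngRCatContext.{v, u}.η X)
        (tngRCatContext.{v, u}.Inc.map V.vf.G) ∧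
      ∀ P : VFObj X.D, (V.vf.u.hom.cell.app (k.hom.F.obj P)).f ≍ P.v := by
  let W := vfTngUniversal.{v, u} (splitFunctor.{v, max u v}.obj X)
  obtain ⟨i, j, hij, hji, hi, hj⟩ := UniversalVectorField.exists_iso V W
  let i' := inclusion.map i
  let j' : VF.{v, u} (inclusion.obj (splitFunctor.{v, max u v}.obj X)) ⟶ inclusion.obj V.V :=
    inclusion.map j
  -- The comparison into `V` is the explicit one followed by the isomorphism out of the explicit
  -- model `W`, so the roles of `i` and `j` are exchanged when the transport lemma is applied.
  refine ⟨vfUnit.{v, u} X ≫ j', (vf_isTwoPullback.{v, u} X).of_iso (i := j') (j := i') ?_ ?_ ?_,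
    fun P => ?_⟩
  · exact congrArg (fun t => inclusion.map t) hji
  · exact congrArg (fun t => inclusion.map t) hij
  · exact congrArg (fun t => inclusion.map t.G) hj
  -- The field induced from `V` along `j` is the universal field of `W`, and at the image of `(M,
  -- v)` the latter has underlying map `v`. The equality is heterogeneous because the base object in
  -- `V` agrees with `(M, 𝟙)` only through `hj`.
  · have key : ∀ {a b : HomVectorField W.V (splitFunctor.{v, max u v}.obj X)}, a = b →
        (a.toField.cell.app ((vfUnit.{v, u} X).hom.F.obj P)).f ≍
          (b.toField.cell.app ((vfUnit.{v, u} X).hom.F.obj P)).f := by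
      rintro a _ rfl
      rfl
    have e := key hj
    exact (heq_of_eq (congrArg SplitHom.f (Γ_field_app V.vf j _).symm)).trans e

end TangentVF

theorem mainTheorem12 :
    (∀ X : TngRCat.{v, max u v}, tngRCatContext.{v, u}.AdmitsExtended X) ∧
      ∀ X : TngRCat.{v, max u v},
        tngRCatContext.{v, u}.IsObjectOfVectorFields (VF.forget.{v, u} X) ∧
        ∀ V : UniversalVectorField (tngRCatContext.{v, u}.Ξ.obj X),
          ∃ k : VF.{v, u} X ⟶ tngRCatContext.{v, u}.Inc.obj V.V,
            IsTwoPullback (VF.forget.{v, u} X) k (tngRCatContext.{v, u}.η X)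
              (tngRCatContext.{v, u}.Inc.map V.vf.G) ∧
            ∀ P : VFObj X.D, (V.vf.u.hom.cell.app (k.hom.F.obj P)).f ≍ P.v := by
  -- Being an object of vector fields requires one tangentad of vector fields of the split
  -- completion; the explicit one supplies it, and it also witnesses the first half of
  -- admissibility.
  have h : ∀ X : TngRCat.{v, max u v},
      tngRCatContext.{v, u}.IsObjectOfVectorFields (VF.forget.{v, u} X) := fun X => by
    obtain ⟨k, hk, -⟩ := exists_isTwoPullback.{v, u} X
      (vfTngUniversal.{v, u} (splitFunctor.{v, max u v}.obj X))
    exact ⟨_, k, hk⟩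
  exact ⟨fun X => ⟨⟨vfTngUniversal.{v, u} (splitFunctor.{v, max u v}.obj X)⟩, _, _, h X⟩,
    fun X => ⟨h X, exists_isTwoPullback.{v, u} X⟩⟩
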